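/- Let $d\in\mathbb N$, let $\gamma\in L^1(\mathbb R^+;\mathbb R^{d\times d})$, and let $r:[0,\infty)\to\mathbb R^{d\times d}$ be the differential resolvent of $\gamma$ (for $D=0$), i.e. the solution of $$r'(t)=-\int_0^t\gamma(t-s)\,r(s)\,ds,\quad t\ge 0,\qquad r(0)=I .$$ Assume that $r\in L^1(\mathbb R^+;\mathbb R^{d\times d})$. Let $\psi\in H^3(\mathbb R;\mathbb R^{d\times d})$, i.e. $\psi$ and its first three weak derivatives are in $L^2(\mathbb R)$ ($\psi$ is identified with its continuous representative), and let $\psi$ be of positive type: for all $n$ and all $t_1,\dots,t_n\in\mathbb R$ the block matrix $\bigl(\psi(t_k-t_l)\bigr)_{k,l=1}^n$ is symmetric positive semidefinite. Then there is $\varphi\in L^2(\mathbb R;\mathbb R^{d\times d})$, depending only on $\gamma$ and $\psi$, such that the following holds for every two-sided $d$-dimensional Brownian motion $\widetilde W$ on a probability space. The Wiener integrals $$F_0(t)=\int_{-\infty}^{\infty}\varphi(t-s)\,d\widetilde W(s),\qquad t\in\mathbb R,$$ exist and have a jointly measurable version, and every such version $F_0$ is a centered stationary Gaussian process. The generalized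 Langevin equation with infinite time horizon $$\dot V_\infty(t)=-\int_{-\infty}^t\gamma(t-s)V_\infty(s)\,ds+F_0(t),\qquad t\in\mathbb R,$$ has a strong solution $V_\infty$ (a jointly measurable process which, for all $t_1\le t_2$, almost surely satisfies the equation integrated over $[t_1,t_2]$) with $\sup_{t\in\mathbb R}\mathbb E\|V_\infty(t)\|^2<\infty$. This solution is unique up to modification, it is a centered stationary Gaussian process, and its autocorrelation function is $\psi$: $$\mathbb E\bigl(V_\infty(s+t)\,V_\infty(s)^*\bigr)=\psi(t)\qquad\text{for all } s,t\in\mathbb R .$$ -/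

import Mathlib

open MeasureTheory ProbabilityTheory Filter Topology Set Matrix
open scoped NNReal ENNReal

noncomputable section

/-! ### Deterministic notions -/

/-- All entries of the matrix function `γ` are absolutely integrable on `(0, ∞)`,
i.e. `γ ∈ L¹(ℝ⁺)`. -/
def MemL1Pos {d : ℕ} (γ : ℝ → Matrix (Fin d) (Fin d) ℝ) : Prop :=
  ∀ i j, IntegrableOn (fun t => γ t i j) (Ioi 0) volume

/-- All entries of the matrix function `φ` belong to `L²(ℝ)`. -/
def MemL2 {d : ℕ} (φ : ℝ → Matrix (Fin d) (Fin d) ℝ) : Prop :=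
  ∀ i j, MemLp (fun t => φ t i j) 2 volume

/-- `r` is the differential resolvent of the pair `(D, γ)`: `r(0) = I` and
`r'(t) = - D r(t) - ∫₀ᵗ γ(t-s) r(s) ds` for all `t ≥ 0` (one-sided derivative at `t = 0`). -/
structure IsDifferentialResolvent {d : ℕ} (D : Matrix (Fin d) (Fin d) ℝ)
    (γ r : ℝ → Matrix (Fin d) (Fin d) ℝ) : Prop where
  init : r 0 = 1
  deriv : ∀ t, 0 ≤ t → ∀ i j, HasDerivWithinAt (fun u => r u i j)
    (-(D * r t) i j - ∫ s in (0 : ℝ)..t, (γ (t - s) * r s) i j) (Ici 0) t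

/-- `g` is a weak derivative of `f` on `ℝ` (tested against smooth functions of compact support). -/
def HasWeakDeriv (f g : ℝ → ℝ) : Prop :=
  ∀ η : ℝ → ℝ, ContDiff ℝ ((⊤ : ℕ∞) : WithTop ℕ∞) η → HasCompactSupport η →
    ∫ t, f t * deriv η t = -∫ t, g t * η t

/-- `f` belongs to the Sobolev space `H^k(ℝ)`: it has `k` successive weak derivatives, and `f` and
all of them are in `L²(ℝ)`. -/
def MemSobolevH : ℕ → (ℝ → ℝ) → Prop
  | 0, f => MemLp f 2 volume
  | k + 1, f => MemLp f 2 volume ∧ ∃ g, HasWeakDeriv f g ∧ MemSobolevH k g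

/-- A matrix function of positive type: for all `t₁, …, tₙ` the block matrix with blocks
`ψ(tₖ - tₗ)` is symmetric and positive semidefinite. (For real matrices this is the same as
`∑ xₖ^* ψ(tₖ - tₗ) xₗ ≥ 0` for all complex vectors `xₖ`.) -/
def IsPositiveType {d : ℕ} (ψ : ℝ → Matrix (Fin d) (Fin d) ℝ) : Prop :=
  ∀ (n : ℕ) (t : Fin n → ℝ),
    (Matrix.of fun p q : Fin n × Fin d => ψ (t p.1 - t q.1) p.2 q.2).PosSemidef

/-! ### Stochastic processes -/

/-- A two-sided `d`-dimensional (standard) Brownian motion: it starts at `0`, has independent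
increments, `W(t) - W(s) ∼ N(0, (t-s) I)` for `s ≤ t`, and almost surely continuous paths. -/
structure IsTwoSidedBrownianMotion {d : ℕ} {Ω : Type*} [MeasurableSpace Ω]
    (W : ℝ → Ω → Fin d → ℝ) (P : Measure Ω) : Prop where
  zero : ∀ᵐ ω ∂P, W 0 ω = 0
  indep : HasIndepIncrements W P
  law : ∀ s t, s ≤ t → HasLaw (fun ω => W t ω - W s ω)
    (Measure.pi fun _ : Fin d => gaussianReal 0 (t - s).toNNReal) P
  cont : ∀ᵐ ω ∂P, Continuous fun t => W t ω

/-- A matrix-valued step function `∑ₖ cₖ 1_{(aₖ, bₖ]}`, given by finitely many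
intervals and coefficients. -/
structure MatrixStep (d : ℕ) where
  /-- number of terms -/
  n : ℕ
  /-- left end points -/
  lo : Fin n → ℝ
  /-- right end points -/
  hi : Fin n → ℝ
  lo_le_hi : ∀ k, lo k ≤ hi k
  /-- coefficients -/
  coef : Fin n → Matrix (Fin d) (Fin d) ℝ

/-- The function on `ℝ` given by a `MatrixStep`. -/
def MatrixStep.toFun {d : ℕ} (g : MatrixStep d) (s : ℝ) : Matrix (Fin d) (Fin d) ℝ :=
  ∑ k, (Ioc (g.lo k) (g.hi k)).indicator (fun _ => g.coef k) s

/-- The elementary stochastic integral `∫ g dW = ∑ₖ cₖ (W(bₖ) - W(aₖ))`. -/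
def MatrixStep.integral {d : ℕ} {Ω : Type*} (g : MatrixStep d)
    (W : ℝ → Ω → Fin d → ℝ) (ω : Ω) : Fin d → ℝ :=
  ∑ k, g.coef k *ᵥ (W (g.hi k) ω - W (g.lo k) ω)

/-- `X = ∫ f(s) dW(s)` over `ℝ` (Wiener integral of a deterministic matrix function): `X` is the
mean-square limit of elementary integrals of step functions that converge to `f` in `L²(ℝ)`. -/
def IsWienerIntegral {d : ℕ} {Ω : Type*} [MeasurableSpace Ω]
    (f : ℝ → Matrix (Fin d) (Fin d) ℝ) (W : ℝ → Ω → Fin d → ℝ) (X : Ω → Fin d → ℝ)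
    (P : Measure Ω) : Prop :=
  ∃ g : ℕ → MatrixStep d,
    (∀ i j, Tendsto (fun n => eLpNorm (fun s => (g n).toFun s i j - f s i j) 2 volume)
      atTop (𝓝 0)) ∧
    Tendsto (fun n => eLpNorm (fun ω => (g n).integral W ω - X ω) 2 P) atTop (𝓝 0)

/-- The process `F(t) = ∫ φ(t-s) dW(s)`, `t ∈ ℝ`, in a version that is jointly measurable in
`(t, ω)`. -/
structure IsMovingAverage {d : ℕ} {Ω : Type*} [MeasurableSpace Ω]
    (φ : ℝ → Matrix (Fin d) (Fin d) ℝ) (W F : ℝ → Ω → Fin d → ℝ) (P : Measure Ω) : Prop where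
  meas : Measurable (Function.uncurry F)
  eq_integral : ∀ t, IsWienerIntegral (fun s => φ (t - s)) W (F t) P

/-- A (centered) stationary Gaussian process: the finite-dimensional distributions are Gaussian,
centered and invariant under time shifts. -/
structure IsStationaryGaussian {d : ℕ} {Ω : Type*} [MeasurableSpace Ω]
    (X : ℝ → Ω → Fin d → ℝ) (P : Measure Ω) : Prop where
  gaussian : IsGaussianProcess X P
  centered : ∀ t, ∫ ω, X t ω ∂P = 0
  shift : ∀ (h : ℝ) (I : Finset ℝ),
    P.map (fun ω (t : I) => X ((t : ℝ) + h) ω) = P.map (fun ω (t : I) => X (t : ℝ) ω)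

/-- `X` is square integrable and has autocorrelation function `C`:
`E (X(s+t) X(s)^*) = C(t)` for all `s, t ∈ ℝ`. -/
structure HasAutocorrelation {d : ℕ} {Ω : Type*} [MeasurableSpace Ω]
    (X : ℝ → Ω → Fin d → ℝ) (C : ℝ → Matrix (Fin d) (Fin d) ℝ) (P : Measure Ω) : Prop where
  memLp : ∀ t, MemLp (X t) 2 P
  eq : ∀ s t i j, ∫ ω, X (s + t) ω i * X s ω j ∂P = C t i j

/-- The memory term `∫_{-∞}^t γ(t-s) V(s) ds` along the path `ω`. -/
def memoryTerm {d : ℕ} {Ω : Type*} (γ : ℝ → Matrix (Fin d) (Fin d) ℝ)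
    (V : ℝ → Ω → Fin d → ℝ) (ω : Ω) (t : ℝ) : Fin d → ℝ :=
  ∫ s in Iic t, γ (t - s) *ᵥ V s ω

/-- `V` is a strong solution of the generalized Langevin equation with infinite time horizon
`V'(t) = - D V(t) - ∫_{-∞}^t γ(t-s) V(s) ds + F(t)`, `t ∈ ℝ`:
it is jointly measurable and satisfies, almost surely, the equation integrated over any bounded
interval `[t₁, t₂]`, where all integrals converge absolutely. -/
structure IsStrongSolution {d : ℕ} {Ω : Type*} [MeasurableSpace Ω]
    (D : Matrix (Fin d) (Fin d) ℝ) (γ : ℝ → Matrix (Fin d) (Fin d) ℝ)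
    (F V : ℝ → Ω → Fin d → ℝ) (P : Measure Ω) : Prop where
  meas : Measurable (Function.uncurry V)
  memory_integrable : ∀ᵐ ω ∂P, ∀ᵐ t, IntegrableOn (fun s => γ (t - s) *ᵥ V s ω) (Iic t) volume
  integrable : ∀ t₁ t₂, t₁ ≤ t₂ → ∀ᵐ ω ∂P,
    IntervalIntegrable (fun t => V t ω) volume t₁ t₂ ∧
    IntervalIntegrable (memoryTerm γ V ω) volume t₁ t₂ ∧
    IntervalIntegrable (fun t => F t ω) volume t₁ t₂
  eq : ∀ t₁ t₂, t₁ ≤ t₂ → ∀ᵐ ω ∂P,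
    V t₂ ω - V t₁ ω = -(D *ᵥ ∫ t in t₁..t₂, V t ω) - (∫ t in t₁..t₂, memoryTerm γ V ω t)
      + ∫ t in t₁..t₂, F t ω

/-- A strong solution that is bounded in the mean-square sense. -/
structure IsBoundedStrongSolution {d : ℕ} {Ω : Type*} [MeasurableSpace Ω]
    (D : Matrix (Fin d) (Fin d) ℝ) (γ : ℝ → Matrix (Fin d) (Fin d) ℝ)
    (F V : ℝ → Ω → Fin d → ℝ) (P : Measure Ω) : Prop extends IsStrongSolution D γ F V P where
  bounded : ∃ C : ℝ≥0, ∀ t, eLpNorm (V t) 2 P ≤ C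

end

/-! Existence is a construction in the deterministic Hilbert space `L2Vec d`, that is `L²(ℝ; ℝᵈ)`,
transported to `L²(P)` by the Wiener isometry `J`. For any vectors `h`, the curves `t ↦ J (shiftVec
t h)` are jointly centered, stationary and Gaussian, with covariances `⟨shiftVec t h, g⟩`. So it
suffices to find vectors `σ i` with `⟨shiftVec t (σ i), σ j⟩ = ψ t i j` whose translation curves
have derivatives `shiftVec t (κ i)`. Then `V = J (shiftVec t σ)` has autocorrelation `ψ`, and the
forcing is read off from the equation: derivative plus memory term, `F₀ = J (shiftVec t (κ +
memoryVector k σ))`. Reflecting these vectors gives `φ`.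

The vectors come from the Fourier side. Averaging the positivity condition over independent Gaussian
sample points shows that the Fourier transform of `ψ` is positive semidefinite almost everywhere
(`IsPositiveType.ae_posSemidef_fourierMatrix`). A square root of it, arranged to have Hermitian
symmetry, is the transform of the real vectors `σ` (`IsPositiveType.exists_stationary_family`).
Three weak derivatives of `ψ` make `(1 + w²)|ψ̂(w)|` integrable, which is what is needed for `w
σ̂(w)` to be square integrable, hence for `κ` to exist.

The resolvent enters only in uniqueness. Pairing the difference of two solutions with a square
integrable `Z` gives a bounded deterministic solution `u` of `u' = -γ * u` on the whole line.
Integrating the derivative of `s ↦ r(s) u(T - s)` over `(0, ∞)` yields `u(T) = 0`, because `r` tends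
to zero and `γ * r = r * γ` (`IsDifferentialResolvent.eq_zero_of_bounded`). The commutation holds
since the Fourier transform of `r` is a right inverse of `γ̂(w) + 2πiw I`, hence also a left
inverse. -/

noncomputable section

/-! ### Pathwise integrals and measurable versions of curves in `L²(P)` -/

section ParametricIntegrals

variable {S Ω : Type*} [MeasurableSpace S] [MeasurableSpace Ω] {μ : Measure S} {P : Measure Ω}

lemma integrable_prod_weight [SFinite μ] [SFinite P] {k : S → ℝ} (hk : Integrable k μ)
    {X : S → Ω → ℝ} (hX : Measurable (Function.uncurry X)) {Z : Ω → ℝ}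
    (hZ : AEStronglyMeasurable Z P) {C : ℝ≥0} (hC : ∀ s, ∫⁻ ω, ‖Z ω * X s ω‖ₑ ∂P ≤ C) :
    Integrable (fun p : S × Ω => Z p.2 * (k p.1 * X p.1 p.2)) (μ.prod P) := by
  have hm : AEStronglyMeasurable (fun p : S × Ω => Z p.2 * (k p.1 * X p.1 p.2)) (μ.prod P) :=
    hZ.comp_snd.mul (hk.1.comp_fst.mul hX.aestronglyMeasurable)
  refine ⟨hm, ?_⟩
  rw [HasFiniteIntegral, lintegral_prod _ hm.enorm]
  calc ∫⁻ s, ∫⁻ ω, ‖Z ω * (k s * X s ω)‖ₑ ∂P ∂μ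
      ≤ ∫⁻ s, ‖k s‖ₑ * C ∂μ := by
        refine lintegral_mono fun s => ?_
        simp only
        calc ∫⁻ ω, ‖Z ω * (k s * X s ω)‖ₑ ∂P = ∫⁻ ω, ‖k s‖ₑ * ‖Z ω * X s ω‖ₑ ∂P := by
              refine lintegral_congr fun ω => ?_
              rw [← enorm_mul]; congr 1; ring
          _ = ‖k s‖ₑ * ∫⁻ ω, ‖Z ω * X s ω‖ₑ ∂P := lintegral_const_mul' _ _ (by simp)
          _ ≤ _ := by gcongr; exact hC s
    _ = (∫⁻ s, ‖k s‖ₑ ∂μ) * C := lintegral_mul_const' _ _ (by simp)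
    _ < ∞ := ENNReal.mul_lt_top hk.2 (by simp)

lemma lintegral_enorm_mul_le_of_eLpNorm_le {Z Y : Ω → ℝ}
    (hZ : AEStronglyMeasurable Z P) (hY : AEStronglyMeasurable Y P) :
    ∫⁻ ω, ‖Z ω * Y ω‖ₑ ∂P ≤ eLpNorm Z 2 P * eLpNorm Y 2 P := by
  have := eLpNorm_smul_le_mul_eLpNorm (p := 2) (q := 2) (r := 1) hY hZ
  rw [eLpNorm_one_eq_lintegral_enorm] at this
  simpa [smul_eq_mul] using this

/-- Integration in the time variable commutes with taking the mixed moment with `Z`. -/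
lemma integral_mul_weight_integral [SFinite μ] [SFinite P] {k : S → ℝ} {X : S → Ω → ℝ} {Z : Ω → ℝ}
    (h : Integrable (fun p : S × Ω => Z p.2 * (k p.1 * X p.1 p.2)) (μ.prod P)) :
    ∫ ω, Z ω * ∫ s, k s * X s ω ∂μ ∂P = ∫ s, k s * ∫ ω, Z ω * X s ω ∂P ∂μ := by
  simp_rw [← integral_const_mul]
  rw [← integral_integral_swap (f := fun s ω => Z ω * (k s * X s ω)) h]
  refine integral_congr_ae (.of_forall fun s => integral_congr_ae (.of_forall fun ω => ?_))
  simp only; ring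

/-- If `X s` is a representative of `Y s ∈ L²(P)`, then the pathwise integral of `k s * X s`
is a representative of the `L²(P)`-valued integral. -/
lemma ae_integrable_weight_and_integral_ae_eq [SFinite μ] [IsProbabilityMeasure P] {k : S → ℝ}
    (hk : Integrable k μ) {X : S → Ω → ℝ} (hX : Measurable (Function.uncurry X))
    {Y : S → Lp ℝ 2 P} (hXY : ∀ s, X s =ᵐ[P] Y s) {C : ℝ≥0} (hC : ∀ s, ‖Y s‖₊ ≤ C)
    (hY : Integrable (fun s => k s • Y s) μ) :
    (∀ᵐ ω ∂P, Integrable (fun s => k s * X s ω) μ) ∧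
    (fun ω => ∫ s, k s * X s ω ∂μ) =ᵐ[P] (∫ s, k s • Y s ∂μ : Lp ℝ 2 P) := by
  have hXm : ∀ s, Measurable (X s) := fun s => hX.of_uncurry_left
  have hXn : ∀ s, eLpNorm (X s) 2 P ≤ C := fun s => by
    rw [eLpNorm_congr_ae (hXY s), ← Lp.enorm_def]
    exact_mod_cast hC s
  have key : ∀ Z : Ω → ℝ, MemLp Z 2 P →
      Integrable (fun p : S × Ω => Z p.2 * (k p.1 * X p.1 p.2)) (μ.prod P) := by
    intro Z hZ
    refine integrable_prod_weight (C := (eLpNorm Z 2 P).toNNReal * C) hk hX hZ.1 fun s => ?_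
    refine (lintegral_enorm_mul_le_of_eLpNorm_le hZ.1 (hXm s).aestronglyMeasurable).trans ?_
    rw [ENNReal.coe_mul, ENNReal.coe_toNNReal hZ.2.ne]
    gcongr
    exact hXn s
  have h1 := key (fun _ => 1) (memLp_const _)
  simp only [one_mul] at h1
  refine ⟨h1.prod_left_ae, ?_⟩
  -- Integrals over events `A` are compared. With `Z = 1_A`, Fubini moves the pathwise integral
  -- outside the expectation, and the inner product with `1_A` moves inside the Bochner integral.
  refine Integrable.ae_eq_of_forall_setIntegral_eq _ _ h1.integral_prod_right
    ((Lp.memLp _).integrable (by norm_num)) fun A hA hPA => ?_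
  have h2 := integral_mul_weight_integral (key (A.indicator fun _ => 1)
    ((memLp_const 1).indicator hA))
  rw [← L2.inner_indicatorConstLp_one (𝕜 := ℝ) hA hPA.ne, ← integral_inner hY]
  have h3 : ∀ f : Ω → ℝ, ∀ ω, A.indicator (fun _ => (1 : ℝ)) ω * f ω = A.indicator f ω := by
    intro f ω; by_cases h : ω ∈ A <;> simp [h]
  have h4 : ∀ f : Ω → ℝ, ∫ ω, A.indicator (fun _ => (1 : ℝ)) ω * f ω ∂P = ∫ ω in A, f ω ∂P := by
    intro f; simp_rw [h3]; exact integral_indicator hA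
  rw [← h4 (fun ω => ∫ s, k s * X s ω ∂μ), h2]
  refine integral_congr_ae (.of_forall fun s => ?_)
  simp only
  rw [inner_smul_right, L2.inner_indicatorConstLp_one (𝕜 := ℝ) hA hPA.ne, h4]
  congr 1
  exact setIntegral_congr_ae hA ((hXY s).mono fun ω h _ => h)

end ParametricIntegrals

/-- A uniformly continuous curve in `L²(P)` has a jointly measurable version. -/
lemma exists_measurable_version {Ω : Type*} [MeasurableSpace Ω] {P : Measure Ω}
    [IsProbabilityMeasure P] {Y : ℝ → Lp ℝ 2 P} (hY : UniformContinuous Y) :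
    ∃ X : ℝ → Ω → ℝ, Measurable (Function.uncurry X) ∧ ∀ t, X t =ᵐ[P] Y t := by
  choose δ hδ0 hδ using fun n : ℕ =>
    Metric.uniformContinuous_iff.1 hY ((1 / 2) ^ n) (by positivity)
  -- Sampling on a grid of mesh `δ n / 2` gives jointly measurable processes with `L²` error at most
  -- `2⁻ⁿ`. The errors are summable, so the samples converge almost surely for each `t`; the upper
  -- limit is measurable without any convergence requirement.
  let G : ℕ → ℝ → Ω → ℝ := fun n t => ⇑(Y (δ n / 2 * ⌊t / (δ n / 2)⌋))
  have hG : ∀ n, Measurable (Function.uncurry (G n)) := by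
    intro n
    have : Function.uncurry (G n) =
        (fun p : ℤ × Ω => (Y (δ n / 2 * p.1) : Ω → ℝ) p.2) ∘
          fun p : ℝ × Ω => (⌊p.1 / (δ n / 2)⌋, p.2) := by
      ext p; rfl
    rw [this]
    have h : Measurable fun p : ℤ × Ω => (Y (δ n / 2 * p.1) : Ω → ℝ) p.2 :=
      measurable_from_prod_countable_right fun m => (Lp.stronglyMeasurable (Y (δ n / 2 * m))).measurable
    exact h.comp ((Int.measurable_floor.comp (measurable_fst.div_const _)).prodMk measurable_snd)
  refine ⟨fun t ω => limsup (fun n => G n t ω) atTop,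
    Measurable.limsup (f := fun n p => Function.uncurry (G n) p) hG, fun t => ?_⟩
  have hd : ∀ n, ∫⁻ ω, ‖G n t ω - Y t ω‖ₑ ∂P ≤ ENNReal.ofReal ((1 / 2) ^ n) := by
    intro n
    have h0 : 0 < δ n / 2 := half_pos (hδ0 n)
    have h1 : dist (δ n / 2 * ⌊t / (δ n / 2)⌋) t < δ n := by
      rw [Real.dist_eq, abs_lt]
      have h2 := Int.floor_le (t / (δ n / 2))
      have h3 := Int.lt_floor_add_one (t / (δ n / 2))
      rw [le_div_iff₀ h0] at h2
      rw [div_lt_iff₀ h0] at h3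
      constructor <;> nlinarith
    have h2 : ‖Y (δ n / 2 * ⌊t / (δ n / 2)⌋) - Y t‖ₑ ≤ ENNReal.ofReal ((1 / 2) ^ n) := by
      rw [← ofReal_norm, ← dist_eq_norm]
      exact ENNReal.ofReal_le_ofReal (hδ n h1).le
    rw [Lp.enorm_def, eLpNorm_congr_ae (Lp.coeFn_sub _ _)] at h2
    rw [← eLpNorm_one_eq_lintegral_enorm]
    exact (eLpNorm_le_eLpNorm_of_exponent_le (q := 2) (by norm_num)
      ((Lp.stronglyMeasurable _).sub (Lp.stronglyMeasurable _)).aestronglyMeasurable).trans h2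
  have hm : ∀ n, Measurable fun ω => ‖G n t ω - Y t ω‖ₑ := fun n =>
    ((hG n).of_uncurry_left.sub (Lp.stronglyMeasurable _).measurable).enorm
  have hsum : ∫⁻ ω, ∑' n, ‖G n t ω - Y t ω‖ₑ ∂P ≠ ∞ := by
    rw [lintegral_tsum fun n => (hm n).aemeasurable]
    refine ne_top_of_le_ne_top ?_ (ENNReal.tsum_le_tsum hd)
    rw [← ENNReal.ofReal_tsum_of_nonneg (fun n => by positivity)
      (summable_geometric_of_lt_one (by norm_num) (by norm_num))]
    exact ENNReal.ofReal_ne_top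
  filter_upwards [ae_lt_top (.tsum hm) hsum] with ω hω
  have h1 := ENNReal.tendsto_atTop_zero_of_tsum_ne_top hω.ne
  have h2 : Tendsto (fun n => G n t ω) atTop (𝓝 (Y t ω)) := by
    rw [tendsto_iff_edist_tendsto_0]
    simpa [edist_eq_enorm_sub] using h1
  exact h2.limsup_eq

end

/-! ### The Wiener integral as an isometry -/

noncomputable section

section InnerExtension

variable {ι H K : Type*} [NormedAddCommGroup H] [InnerProductSpace ℝ H]
  [NormedAddCommGroup K] [InnerProductSpace ℝ K]

/-- Equality of norms makes the assignment `e i ↦ x i` well defined on the span, since relations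
among the `e i` also hold among the `x i`. -/
lemma norm_linearCombination_eq_of_inner_eq {e : ι → H} {x : ι → K}
    (h : ∀ i j, inner ℝ (x i) (x j) = inner ℝ (e i) (e j)) (c : ι →₀ ℝ) :
    ‖Finsupp.linearCombination ℝ x c‖ = ‖Finsupp.linearCombination ℝ e c‖ := by
  have : inner ℝ (Finsupp.linearCombination ℝ x c) (Finsupp.linearCombination ℝ x c) =
      inner ℝ (Finsupp.linearCombination ℝ e c) (Finsupp.linearCombination ℝ e c) := by
    simp only [Finsupp.linearCombination_apply, Finsupp.sum, sum_inner, inner_sum,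
      real_inner_smul_left, real_inner_smul_right, h]
  rw [real_inner_self_eq_norm_sq, real_inner_self_eq_norm_sq] at this
  exact (sq_eq_sq₀ (norm_nonneg _) (norm_nonneg _)).1 this

lemma denseRange_linearCombination [CompleteSpace H] {e : ι → H}
    (h : ∀ f : H, (∀ i, inner ℝ (e i) f = 0) → f = 0) :
    DenseRange (Finsupp.linearCombination ℝ e) := by
  have h1 : (Submodule.span ℝ (range e))ᗮ = ⊥ := by
    rw [eq_bot_iff]
    intro f hf
    exact h f fun i => (Submodule.mem_orthogonal _ _).1 hf _ (Submodule.subset_span ⟨i, rfl⟩)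
  rw [← Submodule.topologicalClosure_eq_top_iff] at h1
  rw [DenseRange, ← LinearMap.coe_range, Finsupp.range_linearCombination]
  exact Submodule.dense_iff_topologicalClosure_eq_top.2 h1

/-- A map defined on a total family of vectors that preserves inner products extends to a
linear isometry. -/
lemma exists_linearIsometry_of_inner_eq [CompleteSpace H] [CompleteSpace K] {e : ι → H} {x : ι → K}
    (h : ∀ i j, inner ℝ (x i) (x j) = inner ℝ (e i) (e j))
    (hd : ∀ f : H, (∀ i, inner ℝ (e i) f = 0) → f = 0) :
    ∃ J : H →ₗᵢ[ℝ] K, ∀ i, J (e i) = x i := by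
  have hdense := denseRange_linearCombination hd
  have hn := norm_linearCombination_eq_of_inner_eq h
  let J := (Finsupp.linearCombination ℝ x).extendOfNorm (Finsupp.linearCombination ℝ e)
  have hJ : ∀ c, J (Finsupp.linearCombination ℝ e c) = Finsupp.linearCombination ℝ x c :=
    LinearMap.extendOfNorm_eq hdense ⟨1, fun c => by rw [one_mul]; exact (hn c).le⟩
  refine ⟨⟨J.toLinearMap, fun f => ?_⟩, fun i => ?_⟩
  · refine hdense.induction_on (p := fun f => ‖J f‖ = ‖f‖) f
      (isClosed_eq (by fun_prop) (by fun_prop)) fun c => ?_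
    rw [hJ, hn]
  · simpa using hJ (Finsupp.single i 1)

end InnerExtension

/-- The Hilbert space `L²(ℝ; ℝᵈ)`, as a product of `d` copies of `L²(ℝ)`. -/
abbrev L2Vec (d : ℕ) : Type := PiLp 2 fun _ : Fin d => Lp ℝ 2 (volume : Measure ℝ)

/-- The indicator of `(a, b]` in `L²(ℝ)`. -/
def iocL2 (a b : ℝ) : Lp ℝ 2 (volume : Measure ℝ) :=
  indicatorConstLp 2 (measurableSet_Ioc (a := a) (b := b)) (by simp) (1 : ℝ)

lemma iocL2_coeFn (a b : ℝ) : iocL2 a b =ᵐ[volume] (Ioc a b).indicator fun _ => (1 : ℝ) :=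
  indicatorConstLp_coeFn

lemma inner_iocL2 (a b c e : ℝ) :
    inner ℝ (iocL2 a b) (iocL2 c e) = volume.real (Ioc a b ∩ Ioc c e) :=
  L2.real_inner_indicatorConstLp_one_indicatorConstLp_one measurableSet_Ioc measurableSet_Ioc
    (by simp) (by simp)

lemma iocL2_eq_sub {t a b : ℝ} (hta : t ≤ a) (hab : a ≤ b) :
    iocL2 a b = iocL2 t b - iocL2 t a := by
  refine Lp.ext ?_
  filter_upwards [iocL2_coeFn a b, iocL2_coeFn t b, iocL2_coeFn t a,
    Lp.coeFn_sub (iocL2 t b) (iocL2 t a)] with s h1 h2 h3 h4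
  rw [h4, Pi.sub_apply, h1, h2, h3]
  simp only [indicator_apply, mem_Ioc]
  grind

lemma inner_iocL2_same {t a b : ℝ} (hta : t ≤ a) (htb : t ≤ b) :
    inner ℝ (iocL2 t a) (iocL2 t b) = min a b - t := by
  rw [inner_iocL2, Ioc_inter_Ioc, sup_idem]
  simp [Measure.real, Real.volume_Ioc, hta, htb]

/-- The primitive of `f` vanishes identically, so `f` vanishes almost everywhere by Lebesgue
differentiation. -/
lemma eq_zero_of_inner_iocL2 {f : Lp ℝ 2 (volume : Measure ℝ)}
    (h : ∀ a b, a ≤ b → inner ℝ (iocL2 a b) f = 0) : f = 0 := by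
  have hloc : LocallyIntegrable f volume := (Lp.memLp f).locallyIntegrable (by norm_num)
  have h0 : ∀ a b, ∫ s in a..b, f s = 0 := by
    have : ∀ a b, a ≤ b → ∫ s in a..b, f s = 0 := fun a b hab => by
      rw [intervalIntegral.integral_of_le hab, ← L2.inner_indicatorConstLp_one (𝕜 := ℝ)
        measurableSet_Ioc (by simp)]
      exact h a b hab
    intro a b
    rcases le_total a b with hab | hab
    · exact this a b hab
    · rw [intervalIntegral.integral_symm, this b a hab, neg_zero]
  refine Lp.ext ?_
  filter_upwards [LocallyIntegrable.ae_hasDerivAt_integral hloc, Lp.coeFn_zero ℝ 2 (volume : Measure ℝ)] with x hx h2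
  have h1 := hx 0
  simp only [h0] at h1
  rw [h2]
  exact h1.unique (hasDerivAt_const _ _)

/-- Index of an elementary vector-valued indicator: a coordinate and an interval. -/
abbrev StepIndex (d : ℕ) : Type := Fin d × {p : ℝ × ℝ // p.1 ≤ p.2}

/-- The function `1_{(a, b]}` in the coordinate `k`. -/
def stepVec {d : ℕ} (i : StepIndex d) : L2Vec d := PiLp.single 2 i.1 (iocL2 i.2.1.1 i.2.1.2)

lemma inner_stepVec_left {d : ℕ} (i : StepIndex d) (f : L2Vec d) :
    inner ℝ (stepVec i) f = inner ℝ (iocL2 i.2.1.1 i.2.1.2) (f i.1) := by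
  rw [PiLp.inner_apply, Finset.sum_eq_single i.1]
  · simp [stepVec]
  · intro k _ hk; simp [stepVec, hk]
  · simp

lemma eq_zero_of_inner_stepVec {d : ℕ} {f : L2Vec d} (h : ∀ i, inner ℝ (stepVec i) f = 0) :
    f = 0 := by
  ext1 k
  exact eq_zero_of_inner_iocL2 fun a b hab => by
    simpa [inner_stepVec_left] using h (k, ⟨(a, b), hab⟩)

namespace IsTwoSidedBrownianMotion

variable {d : ℕ} {Ω : Type*} [MeasurableSpace Ω] {P : Measure Ω}
  {W : ℝ → Ω → Fin d → ℝ}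

lemma hasLaw_apply (hW : IsTwoSidedBrownianMotion W P) {s t : ℝ} (h : s ≤ t) (k : Fin d) :
    HasLaw (fun ω => (W t ω - W s ω) k) (gaussianReal 0 (t - s).toNNReal) P :=
  (measurePreserving_eval (fun _ : Fin d => gaussianReal 0 (t - s).toNNReal) k).hasLaw.comp
    (hW.law s t h)

lemma memLp_increment (hW : IsTwoSidedBrownianMotion W P) {s t : ℝ} (h : s ≤ t) (k : Fin d) :
    MemLp (fun ω => (W t ω - W s ω) k) 2 P := by
  have h1 := hW.hasLaw_apply h k
  have h2 : MemLp id 2 (P.map fun ω => (W t ω - W s ω) k) := by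
    rw [h1.map_eq]; exact memLp_id_gaussianReal 2
  exact (memLp_map_measure_iff h2.1 h1.aemeasurable).1 h2

lemma integral_increment (hW : IsTwoSidedBrownianMotion W P) {s t : ℝ} (h : s ≤ t) (k : Fin d) :
    ∫ ω, (W t ω - W s ω) k ∂P = 0 := by
  have := (hW.hasLaw_apply h k).integral_comp (f := id) aestronglyMeasurable_id
  simpa [integral_id_gaussianReal] using this

lemma integral_increment_mul_self (hW : IsTwoSidedBrownianMotion W P) {s t : ℝ} (h : s ≤ t)
    (k l : Fin d) :
    ∫ ω, (W t ω - W s ω) k * (W t ω - W s ω) l ∂P = if k = l then t - s else 0 := by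
  split_ifs with hkl
  · subst hkl
    have h1 := (hW.hasLaw_apply h k).integral_comp (f := fun x => x * x)
      (by fun_prop : Continuous fun x : ℝ => x * x).aestronglyMeasurable
    have h2 := variance_id_gaussianReal (μ := 0) (v := (t - s).toNNReal)
    rw [variance_eq_integral aemeasurable_id] at h2
    simp only [id, integral_id_gaussianReal, sub_zero] at h2
    simp only [Function.comp_def] at h1
    rw [h1]
    simp only [← sq]
    rw [h2, Real.coe_toNNReal _ (sub_nonneg.2 h)]
  · have h1 := (hW.law s t h).integral_comp (f := fun x => x k * x l)
      (by fun_prop : Continuous fun x : Fin d → ℝ => x k * x l).aestronglyMeasurable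
    simp only [Function.comp_def] at h1
    rw [h1]
    have h2 := (iIndepFun_pi (μ := fun _ : Fin d => gaussianReal 0 (t - s).toNNReal)
      (X := fun _ x => x) fun _ => aemeasurable_id).indepFun hkl
    rw [h2.integral_fun_mul_eq_mul_integral (measurable_pi_apply k).aestronglyMeasurable
      (measurable_pi_apply l).aestronglyMeasurable]
    have h3 := (measurePreserving_eval (fun _ : Fin d => gaussianReal 0 (t - s).toNNReal)
      k).hasLaw.integral_comp (f := id) aestronglyMeasurable_id
    simp only [id, Function.comp_def, integral_id_gaussianReal, Function.eval] at h3
    rw [h3, zero_mul]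

lemma integral_increment_mul_of_le (hW : IsTwoSidedBrownianMotion W P) {r s t : ℝ}
    (hrs : r ≤ s) (hst : s ≤ t) (k l : Fin d) :
    ∫ ω, (W s ω - W r ω) k * (W t ω - W s ω) l ∂P = 0 := by
  have h := (hW.indep.indepFun_sub_sub hrs hst).comp (measurable_pi_apply k) (measurable_pi_apply l)
  have h1 := h.integral_fun_mul_eq_mul_integral (hW.memLp_increment hrs k).1
    (hW.memLp_increment hst l).1
  simp only [Function.comp_apply, Pi.sub_apply] at h1 ⊢
  rw [h1]
  have := hW.integral_increment hrs k
  simp only [Pi.sub_apply] at this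
  rw [this, zero_mul]

lemma integral_increment_mul_from (hW : IsTwoSidedBrownianMotion W P) {r s t : ℝ}
    (hrs : r ≤ s) (hrt : r ≤ t) (k l : Fin d) :
    ∫ ω, (W s ω - W r ω) k * (W t ω - W r ω) l ∂P = if k = l then min s t - r else 0 := by
  have key : ∀ {s t : ℝ} (k l : Fin d), r ≤ s → s ≤ t →
      ∫ ω, (W s ω - W r ω) k * (W t ω - W r ω) l ∂P = if k = l then s - r else 0 := by
    intro s t k l hrs hst
    have : ∀ ω, (W s ω - W r ω) k * (W t ω - W r ω) l = (W s ω - W r ω) k * (W s ω - W r ω) l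
        + (W s ω - W r ω) k * (W t ω - W s ω) l := fun ω => by simp only [Pi.sub_apply]; ring
    simp_rw [this]
    have h1 : Integrable (fun ω => (W s ω - W r ω) k * (W s ω - W r ω) l) P :=
      (hW.memLp_increment hrs k).integrable_mul (hW.memLp_increment hrs l)
    have h2 : Integrable (fun ω => (W s ω - W r ω) k * (W t ω - W s ω) l) P :=
      (hW.memLp_increment hrs k).integrable_mul (hW.memLp_increment hst l)
    rw [integral_add h1 h2,
      hW.integral_increment_mul_of_le hrs hst, hW.integral_increment_mul_self hrs, add_zero]
  rcases le_total s t with h | h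
  · rw [min_eq_left h, key k l hrs h]
  · rw [min_eq_right h]
    simp_rw [mul_comm _ ((W t _ - W r _) l)]
    rw [key l k hrt h]
    simp only [eq_comm]

/-- The increment of the coordinate `k` over `(a, b]` as an element of `L²(P)`. -/
def incrementLp (hW : IsTwoSidedBrownianMotion W P) (i : StepIndex d) : Lp ℝ 2 P :=
  (hW.memLp_increment i.2.2 i.1).toLp

lemma incrementLp_coeFn (hW : IsTwoSidedBrownianMotion W P) (i : StepIndex d) :
    hW.incrementLp i =ᵐ[P] fun ω => (W i.2.1.2 ω - W i.2.1.1 ω) i.1 :=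
  MemLp.coeFn_toLp _

/-- Both sides are additive in the intervals, so each increment is split as a difference of
increments from the common base point `r = min a a'`. For those, both sides equal `min s t - r` if
the coordinates agree and zero otherwise. -/
lemma inner_incrementLp (hW : IsTwoSidedBrownianMotion W P) (i j : StepIndex d) :
    inner ℝ (hW.incrementLp i) (hW.incrementLp j) = inner ℝ (stepVec i) (stepVec j) := by
  obtain ⟨k, ⟨a, b⟩, hab⟩ := i
  obtain ⟨l, ⟨a', b'⟩, hab'⟩ := j
  simp only at hab hab'
  let r := min a a'
  have hra : r ≤ a := min_le_left _ _
  have hra' : r ≤ a' := min_le_right _ _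
  have key : ∀ s t : ℝ, ∀ hs : r ≤ s, ∀ ht : r ≤ t,
      inner ℝ (hW.incrementLp (k, ⟨(r, s), hs⟩)) (hW.incrementLp (l, ⟨(r, t), ht⟩)) =
      inner ℝ (stepVec (k, ⟨(r, s), hs⟩)) (stepVec (l, ⟨(r, t), ht⟩)) := by
    intro s t hs ht
    rw [L2.inner_def, inner_stepVec_left]
    trans ∫ ω, (W s ω - W r ω) k * (W t ω - W r ω) l ∂P
    · refine integral_congr_ae ?_
      filter_upwards [hW.incrementLp_coeFn (k, ⟨(r, s), hs⟩),
        hW.incrementLp_coeFn (l, ⟨(r, t), ht⟩)] with ω h1 h2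
      rw [h1, h2]
      simp [mul_comm]
    · rw [hW.integral_increment_mul_from hs ht]
      by_cases hkl : k = l
      · subst hkl; simp [stepVec, inner_iocL2_same hs ht]
      · simp [stepVec, hkl]
  have hx : ∀ (k : Fin d) (a b : ℝ) (hra : r ≤ a) (hab : a ≤ b),
      hW.incrementLp (k, ⟨(a, b), hab⟩) = hW.incrementLp (k, ⟨(r, b), hra.trans hab⟩)
        - hW.incrementLp (k, ⟨(r, a), hra⟩) := by
    intro k a b hra hab
    rw [incrementLp, incrementLp, incrementLp, ← MemLp.toLp_sub]
    congr 1
    ext ω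
    simp
  have he : ∀ (k : Fin d) (a b : ℝ) (hra : r ≤ a) (hab : a ≤ b),
      stepVec (k, ⟨(a, b), hab⟩) = stepVec (k, ⟨(r, b), hra.trans hab⟩)
        - stepVec (k, ⟨(r, a), hra⟩) := by
    intro k a b hra hab
    ext1 m
    by_cases hm : m = k
    · subst hm; simp [stepVec, iocL2_eq_sub hra hab]
    · simp [stepVec, hm]
  rw [hx k a b hra hab, hx l a' b' hra' hab', he k a b hra hab, he l a' b' hra' hab']
  simp only [inner_sub_left, inner_sub_right, key]

lemma exists_wienerIsometry (hW : IsTwoSidedBrownianMotion W P) :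
    ∃ J : L2Vec d →ₗᵢ[ℝ] Lp ℝ 2 P, ∀ i, J (stepVec i) = hW.incrementLp i :=
  exists_linearIsometry_of_inner_eq hW.inner_incrementLp fun _ => eq_zero_of_inner_stepVec

/-- The Wiener integral as a linear isometry `L²(ℝ; ℝᵈ) → L²(P)`. -/
def wiener (hW : IsTwoSidedBrownianMotion W P) : L2Vec d →ₗᵢ[ℝ] Lp ℝ 2 P :=
  hW.exists_wienerIsometry.choose

lemma wiener_stepVec (hW : IsTwoSidedBrownianMotion W P) (i : StepIndex d) :
    hW.wiener (stepVec i) = hW.incrementLp i :=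
  hW.exists_wienerIsometry.choose_spec i

end IsTwoSidedBrownianMotion

end

/-! ### Gaussian laws of Wiener integrals -/

noncomputable section

section CharFun

variable {Ω : Type*} [MeasurableSpace Ω] {P : Measure Ω}

lemma integrable_cexp_mul_I [IsProbabilityMeasure P] (u : ℝ) {Y : Ω → ℝ}
    (hY : AEStronglyMeasurable Y P) :
    Integrable (fun ω => Complex.exp (u * Y ω * Complex.I)) P := by
  refine Integrable.of_bound (C := 1) ?_ (.of_forall fun ω => ?_)
  · exact Complex.continuous_exp.comp_aestronglyMeasurable
      (((Complex.continuous_ofReal.comp_aestronglyMeasurable hY).const_mul _).mul_const _)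
  · rw [← Complex.ofReal_mul, Complex.norm_exp_ofReal_mul_I]

lemma norm_cexp_mul_I_sub_le (u x y : ℝ) :
    ‖Complex.exp (u * x * Complex.I) - Complex.exp (u * y * Complex.I)‖ ≤ |u| * |x - y| := by
  have h : Complex.exp (u * x * Complex.I) - Complex.exp (u * y * Complex.I) =
      Complex.exp ((u * y : ℝ) * Complex.I) *
        (Complex.exp (Complex.I * ((u * (x - y) : ℝ) : ℂ)) - 1) := by
    rw [mul_sub, ← Complex.exp_add, mul_one]
    congr 2 <;> push_cast <;> ring
  rw [h, norm_mul, Complex.norm_exp_ofReal_mul_I, one_mul, ← abs_mul]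
  exact Real.norm_exp_I_mul_ofReal_sub_one_le

/-- Lipschitz continuity, through the `L¹` norm, which is below the `L²` norm under a probability
measure. It carries the Gaussian characteristic function from step functions to all of `L²`. -/
lemma continuous_integral_cexp_mul_I [IsProbabilityMeasure P] (u : ℝ) :
    Continuous fun Y : Lp ℝ 2 P => ∫ ω, Complex.exp (u * Y ω * Complex.I) ∂P := by
  refine (LipschitzWith.of_dist_le_mul (K := ‖u‖₊) fun Y Y' => ?_).continuous
  rw [dist_eq_norm, dist_eq_norm, ← integral_sub (integrable_cexp_mul_I u (Lp.aestronglyMeasurable Y))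
    (integrable_cexp_mul_I u (Lp.aestronglyMeasurable Y'))]
  have hsub : Integrable (fun ω => |Y ω - Y' ω|) P :=
    (((Lp.memLp Y).integrable (by norm_num)).sub ((Lp.memLp Y').integrable (by norm_num))).norm
  calc _ ≤ ∫ ω, |u| * |Y ω - Y' ω| ∂P :=
        norm_integral_le_of_norm_le (hsub.const_mul _)
          (.of_forall fun ω => norm_cexp_mul_I_sub_le u (Y ω) (Y' ω))
    _ = |u| * ∫ ω, ‖(Y - Y') ω‖ ∂P := by
        rw [integral_const_mul]
        congr 1
        refine integral_congr_ae ?_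
        filter_upwards [Lp.coeFn_sub Y Y'] with ω h
        rw [h]; rfl
    _ ≤ _ := by
        rw [coe_nnnorm, Real.norm_eq_abs]
        gcongr
        rw [integral_norm_eq_lintegral_enorm (Lp.aestronglyMeasurable _),
          ← eLpNorm_one_eq_lintegral_enorm, Lp.norm_def]
        exact ENNReal.toReal_mono (Lp.eLpNorm_ne_top _)
          (eLpNorm_le_eLpNorm_of_exponent_le (by norm_num) (Lp.aestronglyMeasurable _))

end CharFun

namespace IsTwoSidedBrownianMotion

variable {d : ℕ} {Ω : Type*} [MeasurableSpace Ω] {P : Measure Ω}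
  {W : ℝ → Ω → Fin d → ℝ}

/-- Independent Gaussian increments give a Gaussian process once there is a first time at which the
process vanishes; restarting at `r` provides one on `Ici r`. -/
lemma isGaussianProcess_sub (hW : IsTwoSidedBrownianMotion W P) (r : ℝ) :
    IsGaussianProcess (fun (t : Ici r) ω => W t ω - W r ω) P := by
  refine HasIndepIncrements.isGaussianProcess (fun t => ?_) (.of_forall fun ω => ?_)
    fun n t ht => ?_
  · have h1 : ∀ i : Fin d, HasGaussianLaw (fun x : Fin d → ℝ => x i)
        (Measure.pi fun _ : Fin d => gaussianReal 0 ((t : ℝ) - r).toNNReal) := fun i =>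
      (measurePreserving_eval (fun _ : Fin d => gaussianReal 0 ((t : ℝ) - r).toNNReal)
        i).hasLaw.hasGaussianLaw
    have h2 := (iIndepFun_pi (μ := fun _ : Fin d => gaussianReal 0 ((t : ℝ) - r).toNNReal)
      (X := fun _ x => x) fun _ => aemeasurable_id).hasGaussianLaw h1
    have h3 : IsGaussian (Measure.pi fun _ : Fin d => gaussianReal 0 ((t : ℝ) - r).toNNReal) := by
      simpa using! h2.isGaussian_map
    exact (hW.law r t t.2).hasGaussianLaw
  · exact sub_self _
  · simpa using hW.indep n (fun i => (t i : ℝ)) fun i j hij => ht hij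

/-- With `r` below all left end points that occur, the combination is a linear image of finitely
many values of the restarted process. -/
lemma hasGaussianLaw_linearCombination (hW : IsTwoSidedBrownianMotion W P)
    (c : StepIndex d →₀ ℝ) :
    HasGaussianLaw (Finsupp.linearCombination ℝ hW.incrementLp c) P := by
  obtain ⟨r, hr⟩ : ∃ r : ℝ, ∀ i ∈ c.support, r ≤ i.2.1.1 := by
    obtain ⟨r, hr⟩ := (c.support.image fun i => i.2.1.1).bddBelow
    exact ⟨r, fun i hi => hr (Finset.mem_coe.2 (Finset.mem_image_of_mem _ hi))⟩
  let a : c.support → Ici r := fun i => ⟨i.1.2.1.1, hr i i.2⟩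
  let b : c.support → Ici r := fun i => ⟨i.1.2.1.2, (hr i i.2).trans i.1.2.2⟩
  let I : Finset (Ici r) := Finset.univ.image a ∪ Finset.univ.image b
  have ha : ∀ i, a i ∈ I := fun i =>
    Finset.mem_union_left _ (Finset.mem_image_of_mem a (Finset.mem_univ i))
  have hb : ∀ i, b i ∈ I := fun i =>
    Finset.mem_union_right _ (Finset.mem_image_of_mem b (Finset.mem_univ i))
  let L : (I → Fin d → ℝ) →L[ℝ] ℝ := ∑ i : c.support, c i •
    (ContinuousLinearMap.proj (R := ℝ) (φ := fun _ : Fin d => ℝ) i.1.1 ∘L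
      (ContinuousLinearMap.proj (R := ℝ) (φ := fun _ => Fin d → ℝ) (⟨b i, hb i⟩ : I)
        - ContinuousLinearMap.proj (R := ℝ) (φ := fun _ => Fin d → ℝ) (⟨a i, ha i⟩ : I)))
  have h1 : HasGaussianLaw (fun ω => ∑ i : c.support, c i *
      (W i.1.2.1.2 ω - W i.1.2.1.1 ω) i.1.1) P := by
    refine (((hW.isGaussianProcess_sub r).hasGaussianLaw I).map L).congr (.of_forall fun ω => ?_)
    simp [L, a, b]
  refine h1.congr ?_
  have h2 : ∀ᵐ ω ∂P, ∀ i : c.support,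
      hW.incrementLp i ω = (W i.1.2.1.2 ω - W i.1.2.1.1 ω) i.1.1 :=
    ae_all_iff.2 fun i => hW.incrementLp_coeFn i.1
  have h3 : ∀ᵐ ω ∂P, ∀ i : c.support,
      (c i • hW.incrementLp i : Lp ℝ 2 P) ω = c i * hW.incrementLp i ω :=
    ae_all_iff.2 fun i => Lp.coeFn_smul _ _
  have h4 : (Finsupp.linearCombination ℝ hW.incrementLp c : Ω → ℝ) =ᵐ[P]
      ∑ i : c.support, (c i • hW.incrementLp i : Lp ℝ 2 P) := by
    rw [Finsupp.linearCombination_apply, Finsupp.sum, ← Finset.sum_coe_sort]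
    exact Lp.coeFn_finsetSum _ _
  filter_upwards [h2, h3, h4] with ω h2 h3 h4
  rw [h4, Finset.sum_apply]
  exact Finset.sum_congr rfl fun i _ => by rw [h3, h2]

lemma integral_wiener_mul (hW : IsTwoSidedBrownianMotion W P) (h g : L2Vec d) :
    ∫ ω, hW.wiener h ω * hW.wiener g ω ∂P = inner ℝ h g := by
  rw [← hW.wiener.inner_map_map, L2.inner_def]
  simp [mul_comm]

variable [IsProbabilityMeasure P]

/-- The mean is the inner product with the constant `1`, hence continuous, and it vanishes on
increments. -/
lemma integral_wiener (hW : IsTwoSidedBrownianMotion W P) (h : L2Vec d) :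
    ∫ ω, hW.wiener h ω ∂P = 0 := by
  have h1 : ∀ Y : Lp ℝ 2 P, ∫ ω, Y ω ∂P =
      inner ℝ (indicatorConstLp 2 MeasurableSet.univ (measure_ne_top P _) (1 : ℝ)) Y := fun Y => by
    rw [L2.inner_indicatorConstLp_one, Measure.restrict_univ]
  rw [h1]
  refine (denseRange_linearCombination fun _ => eq_zero_of_inner_stepVec).induction_on
    (p := fun h => inner ℝ _ (hW.wiener h) = (0 : ℝ)) h
    (isClosed_eq (by fun_prop) (by fun_prop)) fun c => ?_
  simp only [Finsupp.linearCombination_apply, Finsupp.sum, map_sum, map_smul, inner_sum,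
    inner_smul_right]
  refine Finset.sum_eq_zero fun i _ => ?_
  rw [wiener_stepVec, ← h1, integral_congr_ae (hW.incrementLp_coeFn i), hW.integral_increment i.2.2,
    mul_zero]

/-- Both sides are continuous in `h`. On step functions the law is Gaussian with mean zero, and the
isometry identifies its variance as `‖h‖²`. -/
lemma integral_cexp_wiener (hW : IsTwoSidedBrownianMotion W P) (h : L2Vec d) (u : ℝ) :
    ∫ ω, Complex.exp (u * hW.wiener h ω * Complex.I) ∂P =
      Complex.exp (-(‖h‖ ^ 2 : ℝ) * u ^ 2 / 2) := by
  refine (denseRange_linearCombination fun _ => eq_zero_of_inner_stepVec).induction_on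
    (p := fun h => ∫ ω, Complex.exp (u * hW.wiener h ω * Complex.I) ∂P =
      Complex.exp (-(‖h‖ ^ 2 : ℝ) * u ^ 2 / 2)) h
    (isClosed_eq ((continuous_integral_cexp_mul_I u).comp hW.wiener.continuous)
      (by fun_prop)) fun c => ?_
  set y := Finsupp.linearCombination ℝ stepVec c with hy
  have h1 : hW.wiener y = Finsupp.linearCombination ℝ hW.incrementLp c := by
    simp [hy, Finsupp.linearCombination_apply, Finsupp.sum, map_sum, wiener_stepVec]
  have h2 : HasGaussianLaw (hW.wiener y) P := h1 ▸ hW.hasGaussianLaw_linearCombination c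
  have h3 : Var[hW.wiener y; P] = ‖y‖ ^ 2 := by
    rw [variance_eq_integral (Lp.aestronglyMeasurable _).aemeasurable, hW.integral_wiener]
    simp only [sub_zero, sq, hW.integral_wiener_mul, real_inner_self_eq_norm_mul_norm]
  have h4 : charFun (P.map (hW.wiener y)) u = _ := charFun_apply_real u
  rw [integral_map h2.aemeasurable (by fun_prop)] at h4
  rw [← h4, h2.map_eq_gaussianReal, h3, hW.integral_wiener, charFun_gaussianReal]
  congr 1
  rw [Real.coe_toNNReal _ (by positivity)]
  push_cast
  ring

lemma map_wiener (hW : IsTwoSidedBrownianMotion W P) (h : L2Vec d) :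
    P.map (hW.wiener h) = gaussianReal 0 (‖h‖₊ ^ 2) := by
  have hm := (Lp.aestronglyMeasurable (hW.wiener h)).aemeasurable
  have := Measure.isProbabilityMeasure_map hm
  refine Measure.ext_of_charFun (funext fun u => ?_)
  rw [charFun_apply_real, integral_map hm (by fun_prop), hW.integral_cexp_wiener,
    charFun_gaussianReal]
  congr 1
  push_cast
  ring

end IsTwoSidedBrownianMotion

end

/-! ### Matrix-valued Wiener integrals and stationary Gaussian processes -/

noncomputable section

lemma eLpNorm_pi_le_sum {d : ℕ} {Ω : Type*} [MeasurableSpace Ω] {P : Measure Ω}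
    {V : Ω → Fin d → ℝ} (hV : ∀ i, AEStronglyMeasurable (fun ω => V ω i) P) :
    eLpNorm V 2 P ≤ ∑ i, eLpNorm (fun ω => V ω i) 2 P := by
  calc eLpNorm V 2 P ≤ eLpNorm (∑ i, fun ω => ‖V ω i‖) 2 P := by
        refine eLpNorm_mono fun ω => ?_
        rw [Finset.sum_apply, Real.norm_of_nonneg (Finset.sum_nonneg fun i _ => norm_nonneg _)]
        exact pi_norm_le_iff_of_nonneg (Finset.sum_nonneg fun i _ => norm_nonneg _) |>.2
          fun i => Finset.single_le_sum (f := fun i => ‖V ω i‖)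
            (fun i _ => norm_nonneg _) (Finset.mem_univ i)
    _ ≤ ∑ i, eLpNorm (fun ω => ‖V ω i‖) 2 P :=
        eLpNorm_sum_le (fun i _ => (hV i).norm) (by norm_num)
    _ = _ := by simp only [eLpNorm_norm]

lemma tendsto_eLpNorm_pi {d : ℕ} {Ω ι : Type*} [MeasurableSpace Ω] {P : Measure Ω} {l : Filter ι}
    {V : ι → Ω → Fin d → ℝ} (hV : ∀ n i, AEStronglyMeasurable (fun ω => V n ω i) P) :
    Tendsto (fun n => eLpNorm (V n) 2 P) l (𝓝 0) ↔
      ∀ i, Tendsto (fun n => eLpNorm (fun ω => V n ω i) 2 P) l (𝓝 0) := by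
  constructor
  · intro h i
    exact tendsto_of_tendsto_of_tendsto_of_le_of_le tendsto_const_nhds h (fun _ => zero_le)
      fun n => eLpNorm_mono fun ω => norm_le_pi_norm _ i
  · intro h
    have h1 : Tendsto (fun n => ∑ i, eLpNorm (fun ω => V n ω i) 2 P) l (𝓝 0) := by
      simpa using tendsto_finsetSum Finset.univ fun i _ => h i
    refine tendsto_of_tendsto_of_tendsto_of_le_of_le tendsto_const_nhds h1 (fun _ => zero_le)
      fun n => ?_
    exact eLpNorm_pi_le_sum (hV n)

/-- The rows of an `L²` matrix function as elements of `L²(ℝ; ℝᵈ)`. -/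
def MemL2.row {d : ℕ} {f : ℝ → Matrix (Fin d) (Fin d) ℝ} (hf : MemL2 f) (i : Fin d) : L2Vec d :=
  WithLp.toLp 2 fun k => (hf i k).toLp

lemma MemL2.tendsto_row_iff {d : ℕ} {ι : Type*} {l : Filter ι}
    {f : ι → ℝ → Matrix (Fin d) (Fin d) ℝ} {f₀ : ℝ → Matrix (Fin d) (Fin d) ℝ}
    (hf : ∀ n, MemL2 (f n)) (hf₀ : MemL2 f₀) :
    (∀ i, Tendsto (fun n => (hf n).row i) l (𝓝 (hf₀.row i))) ↔
      ∀ i j, Tendsto (fun n => eLpNorm (fun s => f n s i j - f₀ s i j) 2 volume) l (𝓝 0) := by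
  refine forall_congr' fun i => ?_
  have h1 : Tendsto (fun n => (hf n).row i) l (𝓝 (hf₀.row i)) ↔
      ∀ j, Tendsto (fun n => (hf n i j).toLp) l (𝓝 (hf₀ i j).toLp) := by
    rw [(PiLp.homeomorph 2 fun _ : Fin d => Lp ℝ 2 (volume : Measure ℝ)).isEmbedding.tendsto_nhds_iff,
      tendsto_pi_nhds]
    rfl
  rw [h1]
  refine forall_congr' fun j => ?_
  exact Lp.tendsto_Lp_iff_tendsto_eLpNorm'' _ _ _ _

namespace MatrixStep

variable {d : ℕ}

lemma toFun_apply (g : MatrixStep d) (s : ℝ) (i j : Fin d) :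
    g.toFun s i j = ∑ k, g.coef k i j * (Ioc (g.lo k) (g.hi k)).indicator (fun _ => (1 : ℝ)) s := by
  rw [toFun, Matrix.sum_apply]
  refine Finset.sum_congr rfl fun k _ => ?_
  by_cases h : s ∈ Ioc (g.lo k) (g.hi k) <;> simp [h]

lemma memL2 (g : MatrixStep d) : MemL2 g.toFun := by
  intro i j
  simp only [toFun_apply]
  refine memLp_finsetSum _ fun k _ => MemLp.const_mul ?_ _
  exact memLp_indicator_const 2 measurableSet_Ioc _ (Or.inr (by simp))

lemma row_eq (g : MatrixStep d) (i : Fin d) :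
    g.memL2.row i = ∑ k, ∑ j, g.coef k i j • stepVec (j, ⟨(g.lo k, g.hi k), g.lo_le_hi k⟩) := by
  ext1 j
  have h1 : (∑ k, ∑ j, g.coef k i j • stepVec (j, ⟨(g.lo k, g.hi k), g.lo_le_hi k⟩) :
      L2Vec d) j = ∑ k, g.coef k i j • iocL2 (g.lo k) (g.hi k) := by
    rw [WithLp.ofLp_sum, Finset.sum_apply]
    refine Finset.sum_congr rfl fun k _ => ?_
    rw [WithLp.ofLp_sum, Finset.sum_apply, Finset.sum_eq_single j]
    · simp [stepVec]
    · intro l _ hl; simp [stepVec, hl.symm]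
    · simp
  rw [h1]
  refine Lp.ext ?_
  have h2 : ∀ᵐ s, ∀ k, (g.coef k i j • iocL2 (g.lo k) (g.hi k) : Lp ℝ 2 (volume : Measure ℝ)) s =
      g.coef k i j * (Ioc (g.lo k) (g.hi k)).indicator (fun _ => (1 : ℝ)) s := by
    refine ae_all_iff.2 fun k => ?_
    filter_upwards [Lp.coeFn_smul (g.coef k i j) (iocL2 (g.lo k) (g.hi k)),
      iocL2_coeFn (g.lo k) (g.hi k)] with s h1 h2
    rw [h1, Pi.smul_apply, h2, smul_eq_mul]
  filter_upwards [h2, Lp.coeFn_finsetSum (Finset.univ)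
    fun k => g.coef k i j • iocL2 (g.lo k) (g.hi k), MemLp.coeFn_toLp (g.memL2 i j)] with s h2 h3 h4
  rw [h3, Finset.sum_apply]
  simp only [h2]
  rw [← toFun_apply, ← h4]
  rfl

/-- A step function with terms indexed by an arbitrary finite type. -/
def ofFintype {N : Type*} [Fintype N] (lo hi : N → ℝ) (h : ∀ k, lo k ≤ hi k)
    (coef : N → Matrix (Fin d) (Fin d) ℝ) : MatrixStep d where
  n := Fintype.card N
  lo k := lo ((Fintype.equivFin N).symm k)
  hi k := hi ((Fintype.equivFin N).symm k)
  lo_le_hi _ := h _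
  coef k := coef ((Fintype.equivFin N).symm k)

lemma row_ofFintype {N : Type*} [Fintype N] (lo hi : N → ℝ) (h : ∀ k, lo k ≤ hi k)
    (coef : N → Matrix (Fin d) (Fin d) ℝ) (i : Fin d) :
    (ofFintype lo hi h coef).memL2.row i =
      ∑ k, ∑ j, coef k i j • stepVec (j, ⟨(lo k, hi k), h k⟩) := by
  rw [row_eq]
  exact Equiv.sum_comp (Fintype.equivFin N).symm
    fun k => (∑ j, coef k i j • stepVec (j, ⟨(lo k, hi k), h k⟩) : L2Vec d)

/-- The terms are indexed by the disjoint union of the supports, each with a coefficient matrix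
having a single entry, so it reaches only its own row. Rows can therefore be approximated
independently. -/
lemma exists_row_eq (c : Fin d → StepIndex d →₀ ℝ) :
    ∃ g : MatrixStep d, ∀ i, g.memL2.row i = Finsupp.linearCombination ℝ stepVec (c i) := by
  refine ⟨ofFintype (N := Σ i, (c i).support) (fun x => x.2.1.2.1.1) (fun x => x.2.1.2.1.2)
    (fun x => x.2.1.2.2) (fun x => Matrix.single x.1 x.2.1.1 (c x.1 x.2)), fun i => ?_⟩
  rw [row_ofFintype, Fintype.sum_sigma]
  refine (Fintype.sum_eq_single i fun k hk => ?_).trans ?_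
  · refine Finset.sum_eq_zero fun x _ => Finset.sum_eq_zero fun j _ => ?_
    simp [hk]
  · rw [Finsupp.linearCombination_apply, Finsupp.sum, ← Finset.sum_coe_sort (c i).support]
    refine Fintype.sum_congr _ _ fun x => ?_
    refine (Fintype.sum_eq_single x.1.1 fun j hj => ?_).trans ?_
    · simp [hj.symm]
    · simp

end MatrixStep

namespace IsTwoSidedBrownianMotion

variable {d : ℕ} {Ω : Type*} [MeasurableSpace Ω] {P : Measure Ω} {W : ℝ → Ω → Fin d → ℝ}

lemma wiener_matrixStep (hW : IsTwoSidedBrownianMotion W P) (g : MatrixStep d) (i : Fin d) :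
    hW.wiener (g.memL2.row i) =ᵐ[P] fun ω => g.integral W ω i := by
  rw [g.row_eq]
  simp only [map_sum, map_smul, wiener_stepVec]
  have h1 : ∀ᵐ ω ∂P, ∀ k, (∑ j, g.coef k i j • hW.incrementLp (j, ⟨(g.lo k, g.hi k), g.lo_le_hi k⟩) :
      Lp ℝ 2 P) ω = ∑ j, g.coef k i j * (W (g.hi k) ω - W (g.lo k) ω) j := by
    refine ae_all_iff.2 fun k => ?_
    have h2 : ∀ᵐ ω ∂P, ∀ j,
        (g.coef k i j • hW.incrementLp (j, ⟨(g.lo k, g.hi k), g.lo_le_hi k⟩) : Lp ℝ 2 P) ω =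
          g.coef k i j * (W (g.hi k) ω - W (g.lo k) ω) j := by
      refine ae_all_iff.2 fun j => ?_
      filter_upwards [Lp.coeFn_smul (g.coef k i j)
        (hW.incrementLp (j, ⟨(g.lo k, g.hi k), g.lo_le_hi k⟩)),
        hW.incrementLp_coeFn (j, ⟨(g.lo k, g.hi k), g.lo_le_hi k⟩)] with ω h1 h2
      rw [h1, Pi.smul_apply, h2, smul_eq_mul]
    filter_upwards [h2, Lp.coeFn_finsetSum Finset.univ fun j =>
      g.coef k i j • hW.incrementLp (j, ⟨(g.lo k, g.hi k), g.lo_le_hi k⟩)] with ω h2 h3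
    rw [h3, Finset.sum_apply]
    simp only [h2]
  filter_upwards [h1, Lp.coeFn_finsetSum Finset.univ fun k => ∑ j, g.coef k i j •
    hW.incrementLp (j, ⟨(g.lo k, g.hi k), g.lo_le_hi k⟩)] with ω h1 h2
  rw [h2, Finset.sum_apply, MatrixStep.integral, Finset.sum_apply]
  simp only [h1, Matrix.mulVec, dotProduct]

/-- Wiener integrals of matrix functions are given row by row by the isometry `wiener`. -/
lemma isWienerIntegral_iff (hW : IsTwoSidedBrownianMotion W P)
    {f : ℝ → Matrix (Fin d) (Fin d) ℝ} (hf : MemL2 f) {X : Ω → Fin d → ℝ} (hX : Measurable X) :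
    IsWienerIntegral f W X P ↔ ∀ i, (fun ω => X ω i) =ᵐ[P] hW.wiener (hf.row i) := by
  have hXi : ∀ i, AEStronglyMeasurable (fun ω => X ω i) P := fun i =>
    (measurable_pi_iff.1 hX i).aestronglyMeasurable
  have hg : ∀ (g : MatrixStep d) i, AEStronglyMeasurable (fun ω => g.integral W ω i) P :=
    fun g i => (Lp.aestronglyMeasurable _).congr (hW.wiener_matrixStep g i)
  have hgX : ∀ (g : ℕ → MatrixStep d), Tendsto (fun n => eLpNorm
      (fun ω => (g n).integral W ω - X ω) 2 P) atTop (𝓝 0) ↔ ∀ i, Tendsto (fun n => eLpNorm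
      ((hW.wiener ((g n).memL2.row i) : Ω → ℝ) - fun ω => X ω i) 2 P) atTop (𝓝 0) := by
    intro g
    rw [tendsto_eLpNorm_pi (V := fun n ω => (g n).integral W ω - X ω) fun n i => (hg (g n) i).sub (hXi i)]
    refine forall_congr' fun i => iff_of_eq ?_
    congr 1
    ext n
    refine eLpNorm_congr_ae ?_
    filter_upwards [hW.wiener_matrixStep (g n) i] with ω h
    rw [Pi.sub_apply, Pi.sub_apply, h]
  constructor
  · rintro ⟨g, hgf, hgX'⟩ i
    have h1 := ((MemL2.tendsto_row_iff (fun n => (g n).memL2) hf).2 hgf) i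
    have h2 := (hW.wiener.continuous.tendsto _).comp h1
    rw [Lp.tendsto_Lp_iff_tendsto_eLpNorm'] at h2
    have h3 := (hgX g).1 hgX' i
    -- The same sequence converges in mean square to both candidates; limits in measure are unique,
    -- and no integrability of `X` is needed.
    have h4 := tendstoInMeasure_of_tendsto_eLpNorm (by norm_num)
      (fun n => Lp.aestronglyMeasurable _) (Lp.aestronglyMeasurable _) h2
    have h5 := tendstoInMeasure_of_tendsto_eLpNorm (by norm_num)
      (fun n => Lp.aestronglyMeasurable _) (hXi i) h3
    exact tendstoInMeasure_ae_unique h5 h4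
  · intro h
    have hdense := denseRange_linearCombination fun _ => eq_zero_of_inner_stepVec (d := d)
    have h1 : ∀ i, ∃ c : ℕ → StepIndex d →₀ ℝ, Tendsto
        (fun n => Finsupp.linearCombination ℝ stepVec (c n)) atTop (𝓝 (hf.row i)) := by
      intro i
      obtain ⟨y, hy, hyt⟩ := mem_closure_iff_seq_limit.1 (hdense (hf.row i))
      choose c hc using hy
      exact ⟨c, by simpa only [hc] using hyt⟩
    choose c hc using h1
    choose g hg using fun n => MatrixStep.exists_row_eq fun i => c i n
    have h2 : ∀ i, Tendsto (fun n => (g n).memL2.row i) atTop (𝓝 (hf.row i)) := by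
      simpa only [hg] using hc
    refine ⟨g, (MemL2.tendsto_row_iff (fun n => (g n).memL2) hf).1 h2, (hgX g).2 fun i => ?_⟩
    have h3 := (hW.wiener.continuous.tendsto _).comp (h2 i)
    rw [Lp.tendsto_Lp_iff_tendsto_eLpNorm'] at h3
    refine h3.congr fun n => eLpNorm_congr_ae ?_
    filter_upwards [h i] with ω h
    simp only [Pi.sub_apply, h, Function.comp_apply]

variable [IsProbabilityMeasure P]

/-- A process whose coordinates are Wiener integrals of a stationary curve in `L²(ℝ; ℝᵈ)` is a
stationary Gaussian process. -/
lemma isStationaryGaussian (hW : IsTwoSidedBrownianMotion W P) {X : ℝ → Ω → Fin d → ℝ}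
    (hX : ∀ t, Measurable (X t)) {T : ℝ → L2Vec d →ₗᵢ[ℝ] L2Vec d}
    (hT : ∀ s t h, T (s + t) h = T s (T t h)) {σ : Fin d → L2Vec d}
    (hXσ : ∀ t i, (fun ω => X t ω i) =ᵐ[P] hW.wiener (T t (σ i))) :
    IsStationaryGaussian X P := by
  -- Any linear functional of finitely many values, shifted by `h`, is the Wiener integral of `T h
  -- y` with `y` independent of `h`. Its law is thus centered Gaussian with variance `‖y‖²` for
  -- every `h`; as linear functionals determine the joint law, this gives both Gaussianity and
  -- stationarity.
  have key : ∀ (I : Finset ℝ) (L : (I → Fin d → ℝ) →L[ℝ] ℝ), ∃ y : L2Vec d, ∀ h : ℝ,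
      (fun ω => L fun t : I => X (t + h) ω) =ᵐ[P] hW.wiener (T h y) := by
    intro I L
    refine ⟨∑ t : I, ∑ i, L (Pi.single t (Pi.single i 1)) • T t (σ i), fun h => ?_⟩
    have hL : ∀ v : I → Fin d → ℝ,
        L v = ∑ t : I, ∑ i, L (Pi.single t (Pi.single i 1)) * v t i := by
      intro v
      conv_lhs => rw [← Finset.univ_sum_single v]
      rw [map_sum]
      refine Finset.sum_congr rfl fun t _ => ?_
      have h1 : Pi.single (M := fun _ : I => Fin d → ℝ) t (v t) =
          ∑ i, v t i • Pi.single t (Pi.single i 1) := by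
        ext t' i'
        by_cases ht : t' = t
        · subst ht; simp [Finset.sum_apply, Pi.single_apply]
        · simp [Finset.sum_apply, ht]
      rw [h1, map_sum]
      refine Finset.sum_congr rfl fun i _ => ?_
      rw [map_smul, smul_eq_mul, mul_comm]
    simp only [map_sum, map_smul, ← hT]
    have h1 : ∀ᵐ ω ∂P, ∀ t : I, ∀ i, X (t + h) ω i = hW.wiener (T (h + t) (σ i)) ω :=
      ae_all_iff.2 fun t => ae_all_iff.2 fun i => by
        rw [add_comm]; exact hXσ (h + t) i
    have h2 : ∀ (c : I → Fin d → ℝ) (Y : I → Fin d → Lp ℝ 2 P),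
        (fun ω => ∑ t, ∑ i, c t i * Y t i ω) =ᵐ[P] (∑ t, ∑ i, c t i • Y t i : Lp ℝ 2 P) := by
      intro c Y
      have h3 : ∀ᵐ ω ∂P, ∀ t i, (c t i • Y t i : Lp ℝ 2 P) ω = c t i * Y t i ω :=
        ae_all_iff.2 fun t => ae_all_iff.2 fun i => Lp.coeFn_smul _ _
      have h4 : ∀ᵐ ω ∂P, ∀ t, (∑ i, c t i • Y t i : Lp ℝ 2 P) ω =
          ∑ i, (c t i • Y t i : Lp ℝ 2 P) ω :=
        ae_all_iff.2 fun t => by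
          filter_upwards [Lp.coeFn_finsetSum Finset.univ fun i => c t i • Y t i] with ω h
          rw [h, Finset.sum_apply]
      filter_upwards [h3, h4, Lp.coeFn_finsetSum Finset.univ fun t => ∑ i, c t i • Y t i]
        with ω h3 h4 h5
      rw [h5, Finset.sum_apply]
      simp only [h4, h3]
    filter_upwards [h1, h2 (fun t i => L (Pi.single t (Pi.single i 1)))
      fun t i => hW.wiener (T (h + t) (σ i))] with ω h1 h2
    rw [← h2, hL]
    simp only [h1]
  have hmeas : ∀ (I : Finset ℝ) (h : ℝ), Measurable fun ω (t : I) => X (t + h) ω :=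
    fun I h => measurable_pi_iff.2 fun t => hX _
  have hmap : ∀ (I : Finset ℝ) (L : (I → Fin d → ℝ) →L[ℝ] ℝ), ∃ v : ℝ≥0, ∀ h : ℝ,
      (P.map fun ω (t : I) => X (t + h) ω).map L = gaussianReal 0 v := by
    intro I L
    obtain ⟨y, hy⟩ := key I L
    refine ⟨‖y‖₊ ^ 2, fun h => ?_⟩
    rw [Measure.map_map L.measurable (hmeas I h), ← (T h).nnnorm_map y, ← hW.map_wiener]
    exact Measure.map_congr (hy h)
  refine ⟨⟨fun I => ⟨?_⟩⟩, fun t => ?_, fun h I => ?_⟩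
  · refine isGaussian_of_map_eq_gaussianReal fun L => ?_
    obtain ⟨v, hv⟩ := hmap I L
    exact ⟨0, v, by simpa using! hv 0⟩
  · have hint : ∀ i, Integrable (fun ω => X t ω i) P := fun i =>
      ((Lp.memLp (hW.wiener (T t (σ i)))).integrable (by norm_num)).congr (hXσ t i).symm
    ext i
    rw [eval_integral hint, integral_congr_ae (hXσ t i), hW.integral_wiener]
    rfl
  · have := Measure.isProbabilityMeasure_map (μ := P) (hmeas I h).aemeasurable
    have h0 : Measurable fun ω (t : I) => X t ω := measurable_pi_iff.2 fun t => hX _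
    have := Measure.isProbabilityMeasure_map (μ := P) h0.aemeasurable
    refine Measure.ext_of_charFunDual (funext fun L => ?_)
    obtain ⟨v, hv⟩ := hmap I L
    have h1 := hv 0
    simp only [add_zero] at h1
    rw [charFunDual_eq_charFun_map_one, charFunDual_eq_charFun_map_one, hv h, h1]

end IsTwoSidedBrownianMotion

end

/-! ### The Fourier transform of real square integrable functions -/

noncomputable section

open FourierTransform SchwartzMap Real
open scoped ComplexConjugate ContDiff

section FourierL2

/-- The `L²` transform agrees with the distributional one. This duality reduces identities between
`L²` transforms to pointwise identities for test functions. -/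
lemma integral_mul_fourier_Lp (g : 𝓢(ℝ, ℂ)) (F : Lp ℂ 2 (volume : Measure ℝ)) :
    ∫ x, g x * (𝓕 F : Lp ℂ 2 (volume : Measure ℝ)) x = ∫ x, 𝓕 (g : ℝ → ℂ) x * F x := by
  have h := congrArg (fun T => T g) (Lp.fourier_toTemperedDistribution_eq F)
  simp only [TemperedDistribution.fourier_apply, Lp.toTemperedDistribution_apply,
    smul_eq_mul] at h
  exact h.symm

/-- Compactly supported test functions suffice, and they stay Schwartz after multiplication by any
smooth function. -/
lemma ae_eq_of_integral_schwartz_mul_eq {F G : ℝ → ℂ} (hF : LocallyIntegrable F)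
    (hG : LocallyIntegrable G)
    (h : ∀ g : 𝓢(ℝ, ℂ), HasCompactSupport g → ∫ x, g x * F x = ∫ x, g x * G x) :
    F =ᵐ[volume] G := by
  refine ae_eq_of_integral_contDiff_smul_eq hF hG fun g hg hgc => ?_
  have h1 : HasCompactSupport fun x => (g x : ℂ) := hgc.comp_left Complex.ofReal_zero
  have h2 : ContDiff ℝ ∞ fun x => (g x : ℂ) := Complex.ofRealCLM.contDiff.comp hg
  simpa using! h (h1.toSchwartzMap h2) h1

lemma locallyIntegrable_Lp (F : Lp ℂ 2 (volume : Measure ℝ)) : LocallyIntegrable F :=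
  (Lp.memLp F).locallyIntegrable (by norm_num)

lemma integral_fourier_mul_eq_of_integrable {f g : ℝ → ℂ} (hf : Integrable f) (hg : Integrable g) :
    ∫ x, 𝓕 f x * g x = ∫ x, f x * 𝓕 g x := by
  simpa using! VectorFourier.integral_fourierIntegral_smul_eq_flip (L := innerₗ ℝ)
    Real.continuous_fourierChar continuous_inner hf hg

lemma integral_fourierInv_mul_eq_of_integrable {f g : ℝ → ℂ} (hf : Integrable f)
    (hg : Integrable g) : ∫ x, 𝓕⁻ f x * g x = ∫ x, f x * 𝓕⁻ g x := by
  rw [fourierInv_eq_fourier_comp_neg]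
  rw [integral_fourier_mul_eq_of_integrable hf.comp_neg hg, ← integral_neg_eq_self]
  simp only [neg_neg, fourierInv_eq_fourier_neg]

lemma continuous_fourier_of_integrable {f : ℝ → ℂ} (hf : Integrable f) : Continuous (𝓕 f) :=
  VectorFourier.fourierIntegral_continuous Real.continuous_fourierChar
    (L := innerₗ ℝ) continuous_inner hf

/-- The Fourier transforms on `L²` and on `L¹` agree on the intersection. -/
lemma fourier_toLp_ae_eq {f : ℝ → ℂ} (hf : Integrable f) (hf2 : MemLp f 2) :
    (𝓕 (hf2.toLp f) : Lp ℂ 2 (volume : Measure ℝ)) =ᵐ[volume] 𝓕 f := by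
  refine ae_eq_of_integral_schwartz_mul_eq (locallyIntegrable_Lp _)
    (continuous_fourier_of_integrable hf).locallyIntegrable fun g _ => ?_
  rw [integral_mul_fourier_Lp, ← integral_fourier_mul_eq_of_integrable g.integrable hf]
  refine integral_congr_ae ?_
  filter_upwards [hf2.coeFn_toLp] with x hx
  rw [hx]

/-- Fourier inversion for a continuous square integrable function with integrable Fourier
transform. -/
lemma eq_fourierInv_of_integrable {f : ℝ → ℂ} (hf : Continuous f) (hf2 : MemLp f 2)
    (hi : Integrable (𝓕 (hf2.toLp f) : Lp ℂ 2 (volume : Measure ℝ))) :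
    f = 𝓕⁻ ((𝓕 (hf2.toLp f) : Lp ℂ 2 (volume : Measure ℝ)) : ℝ → ℂ) := by
  set θ : ℝ → ℂ := ⇑(𝓕 (hf2.toLp f) : Lp ℂ 2 (volume : Measure ℝ)) with hθ
  have hc : Continuous (𝓕⁻ θ) := by
    have : 𝓕⁻ θ = fun x => 𝓕 θ (-x) := funext fun x => fourierInv_eq_fourier_neg _ _
    rw [this]
    exact (continuous_fourier_of_integrable hi).comp continuous_neg
  refine (Continuous.ae_eq_iff_eq volume hf hc).1 ?_
  refine ae_eq_of_integral_schwartz_mul_eq hf.locallyIntegrable hc.locallyIntegrable fun g _ => ?_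
  have h1 := integral_mul_fourier_Lp (𝓕⁻ g) (hf2.toLp f)
  have h2 : 𝓕 ((𝓕⁻ g : 𝓢(ℝ, ℂ)) : ℝ → ℂ) = g := by
    rw [← fourier_coe, FourierTransform.fourier_fourierInv_eq]
  rw [h2, ← hθ, fourierInv_coe] at h1
  rw [← integral_fourierInv_mul_eq_of_integrable g.integrable hi, h1]
  refine integral_congr_ae ?_
  filter_upwards [hf2.coeFn_toLp] with x hx
  rw [hx]

/-- Translation by `t` on real `L²(ℝ)`. -/
def shiftL2 (t : ℝ) : Lp ℝ 2 (volume : Measure ℝ) →ₗᵢ[ℝ] Lp ℝ 2 (volume : Measure ℝ) :=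
  Lp.compMeasurePreservingₗᵢ ℝ (fun x => x - t) (measurePreserving_sub_right volume t)

lemma shiftL2_coeFn (t : ℝ) (f : Lp ℝ 2 (volume : Measure ℝ)) :
    shiftL2 t f =ᵐ[volume] fun x => f (x - t) :=
  Lp.coeFn_compMeasurePreserving f (measurePreserving_sub_right volume t)

lemma shiftL2_add (s t : ℝ) (f : Lp ℝ 2 (volume : Measure ℝ)) :
    shiftL2 (s + t) f = shiftL2 s (shiftL2 t f) := by
  refine Lp.ext ?_
  filter_upwards [shiftL2_coeFn (s + t) f, shiftL2_coeFn s (shiftL2 t f),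
    (measurePreserving_sub_right volume s).quasiMeasurePreserving.ae_eq_comp (shiftL2_coeFn t f)]
    with x h1 h2 h3
  simp only [Function.comp_apply] at h3
  rw [h1, h2, h3]
  congr 1
  ring

lemma continuous_shiftL2 (f : Lp ℝ 2 (volume : Measure ℝ)) : Continuous fun t => shiftL2 t f := by
  let g : ℝ → C(ℝ, ℝ) := fun t => ⟨fun x => x - t, by fun_prop⟩
  have hg : Continuous g := ContinuousMap.continuous_of_continuous_uncurry _
    (by simp only [g, ContinuousMap.coe_mk]; fun_prop)
  exact (continuous_const (y := f)).compMeasurePreservingLp hg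
    (fun t => measurePreserving_sub_right volume t) (by norm_num)

/-- The Fourier transform of a real `L²` function. -/
def fourierReal (f : Lp ℝ 2 (volume : Measure ℝ)) : Lp ℂ 2 (volume : Measure ℝ) :=
  𝓕 (Complex.ofRealCLM.compLp f)

lemma ofRealCLM_compLp_coeFn (f : Lp ℝ 2 (volume : Measure ℝ)) :
    Complex.ofRealCLM.compLp f =ᵐ[volume] fun x => (f x : ℂ) :=
  Complex.ofRealCLM.coeFn_compLp' f

lemma integral_mul_fourierReal (g : 𝓢(ℝ, ℂ)) (f : Lp ℝ 2 (volume : Measure ℝ)) :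
    ∫ x, g x * fourierReal f x = ∫ x, 𝓕 (g : ℝ → ℂ) x * f x := by
  rw [fourierReal, integral_mul_fourier_Lp]
  refine integral_congr_ae ?_
  filter_upwards [ofRealCLM_compLp_coeFn f] with x hx
  rw [hx]

lemma ofReal_inner_eq_integral_fourierReal (f g : Lp ℝ 2 (volume : Measure ℝ)) :
    ((inner ℝ f g : ℝ) : ℂ) = ∫ w, conj (fourierReal f w) * fourierReal g w := by
  have h1 := Lp.inner_fourier_eq (Complex.ofRealCLM.compLp f) (Complex.ofRealCLM.compLp g)
  rw [L2.inner_def, L2.inner_def] at h1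
  have h2 : ∫ w, conj (fourierReal f w) * fourierReal g w =
      ∫ w, inner ℂ (fourierReal f w) (fourierReal g w) :=
    integral_congr_ae (.of_forall fun w => by simp [mul_comm])
  rw [h2, fourierReal, fourierReal, h1, L2.inner_def, ← integral_complex_ofReal]
  refine integral_congr_ae ?_
  filter_upwards [ofRealCLM_compLp_coeFn f, ofRealCLM_compLp_coeFn g] with x h3 h4
  rw [h3, h4]
  simp

/-- By duality: modulating the test function translates its Fourier transform. -/
lemma fourierReal_shiftL2 (t : ℝ) (f : Lp ℝ 2 (volume : Measure ℝ)) :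
    fourierReal (shiftL2 t f) =ᵐ[volume] fun w =>
      Complex.exp (↑(-2 * π * t * w) * Complex.I) * fourierReal f w := by
  have hsm : ContDiff ℝ ∞ fun w : ℝ => Complex.exp (↑(-2 * π * t * w) * Complex.I) :=
    ((Complex.ofRealCLM.contDiff.comp (by fun_prop : ContDiff ℝ ∞ fun w : ℝ => -2 * π * t * w)).mul
      contDiff_const).cexp
  have hloc := (locallyIntegrable_Lp (fourierReal f)).continuous_mul hsm.continuous
  refine ae_eq_of_integral_schwartz_mul_eq (locallyIntegrable_Lp _) hloc fun g hg => ?_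
  have hg' : HasCompactSupport fun w => Complex.exp (↑(-2 * π * t * w) * Complex.I) * g w :=
    hg.mul_left
  let g' : 𝓢(ℝ, ℂ) := hg'.toSchwartzMap (hsm.mul g.smooth')
  have hg'_apply : ∀ w, g' w = Complex.exp (↑(-2 * π * t * w) * Complex.I) * g w := fun _ => rfl
  have h1 : ∀ x, 𝓕 (g' : ℝ → ℂ) x = 𝓕 (g : ℝ → ℂ) (x + t) := by
    intro x
    rw [fourier_real_eq_integral_exp_smul, fourier_real_eq_integral_exp_smul]
    refine integral_congr_ae (.of_forall fun w => ?_)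
    simp only [hg'_apply, smul_eq_mul]
    rw [← mul_assoc, ← Complex.exp_add]
    congr 2
    push_cast
    ring
  have h2 := integral_mul_fourierReal g' f
  rw [integral_mul_fourierReal]
  trans ∫ x, 𝓕 (g' : ℝ → ℂ) x * f x
  · rw [← integral_sub_right_eq_self (fun x => 𝓕 (g' : ℝ → ℂ) x * f x) t]
    simp only [h1, sub_add_cancel]
    refine integral_congr_ae ?_
    filter_upwards [shiftL2_coeFn t f] with x hx
    rw [hx]
  · rw [← h2]
    refine integral_congr_ae (.of_forall fun w => ?_)
    simp only [hg'_apply]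
    ring

/-- An `L²` function with Hermitian symmetry is the Fourier transform of a real function. -/
lemma exists_fourierReal_eq {θ : ℝ → ℂ} (hθ : MemLp θ 2) (hs : ∀ w, θ (-w) = conj (θ w)) :
    ∃ f : Lp ℝ 2 (volume : Measure ℝ), fourierReal f =ᵐ[volume] θ := by
  let z : Lp ℂ 2 (volume : Measure ℝ) := 𝓕⁻ (hθ.toLp θ)
  have hz : 𝓕 z = hθ.toLp θ := FourierTransform.fourier_fourierInv_eq _
  -- The conjugate of `z` has transform `w ↦ conj (θ (-w))`, which is `θ` by symmetry; injectivity
  -- then shows that `z` is real.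
  let zc : Lp ℂ 2 (volume : Measure ℝ) := Complex.conjCLE.toContinuousLinearMap.compLp z
  have hzc : zc =ᵐ[volume] fun x => conj (z x) :=
    Complex.conjCLE.toContinuousLinearMap.coeFn_compLp' z
  have h1 : 𝓕 zc = 𝓕 z := by
    refine Lp.ext (ae_eq_of_integral_schwartz_mul_eq (locallyIntegrable_Lp _)
      (locallyIntegrable_Lp _) fun g hg => ?_)
    have hg' : HasCompactSupport fun w => conj (g (-w)) :=
      (hg.comp_homeomorph (Homeomorph.neg ℝ)).comp_left (map_zero _)
    let g' : 𝓢(ℝ, ℂ) := hg'.toSchwartzMap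
      (Complex.conjCLE.contDiff.comp (g.smooth'.comp contDiff_neg))
    have h2 : ∀ x, conj (𝓕 (g' : ℝ → ℂ) x) = 𝓕 (g : ℝ → ℂ) x := by
      intro x
      rw [fourier_real_eq_integral_exp_smul, fourier_real_eq_integral_exp_smul, ← integral_conj,
        ← integral_neg_eq_self]
      refine integral_congr_ae (.of_forall fun w => ?_)
      change conj (_ • conj (g (-(-w)))) = _
      simp [← Complex.exp_conj, map_ofNat]
    have h3 := integral_mul_fourier_Lp g' z
    rw [integral_mul_fourier_Lp]
    trans conj (∫ x, 𝓕 (g' : ℝ → ℂ) x * z x)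
    · rw [← integral_conj]
      refine integral_congr_ae ?_
      filter_upwards [hzc] with x hx
      rw [hx, map_mul, h2]
    · rw [← h3, hz, ← integral_conj, ← integral_neg_eq_self]
      refine integral_congr_ae ?_
      filter_upwards [hθ.coeFn_toLp, (Measure.measurePreserving_neg (volume : Measure ℝ)).quasiMeasurePreserving.ae_eq_comp
        hθ.coeFn_toLp] with w h4 h5
      simp only [Function.comp_apply] at h5
      rw [h4, h5, hs, map_mul]
      change conj (conj (g (- -w))) * _ = _
      simp
  have h2 : zc = z := by
    have := congrArg (𝓕⁻ : Lp ℂ 2 (volume : Measure ℝ) → Lp ℂ 2 (volume : Measure ℝ)) h1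
    rwa [FourierTransform.fourierInv_fourier_eq, FourierTransform.fourierInv_fourier_eq] at this
  refine ⟨Complex.reCLM.compLp z, ?_⟩
  have h3 : Complex.ofRealCLM.compLp (Complex.reCLM.compLp z) = z := by
    refine Lp.ext ?_
    rw [h2] at hzc
    filter_upwards [hzc, ofRealCLM_compLp_coeFn (Complex.reCLM.compLp z),
      Complex.reCLM.coeFn_compLp' z] with x h4 h5 h6
    rw [h5, h6]
    exact Complex.conj_eq_iff_re.1 h4.symm
  rw [fourierReal, h3, hz]
  exact hθ.coeFn_toLp

lemma fourierReal_neg (f : Lp ℝ 2 (volume : Measure ℝ)) :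
    ∀ᵐ w, fourierReal f (-w) = conj (fourierReal f w) := by
  have hm : MemLp (fun w => fourierReal f (-w)) 2 volume :=
    (Lp.memLp (fourierReal f)).comp_measurePreserving (Measure.measurePreserving_neg volume)
  have hm' : MemLp (fun w => conj (fourierReal f w)) 2 volume := (Lp.memLp (fourierReal f)).star
  refine ae_eq_of_integral_schwartz_mul_eq (hm.locallyIntegrable (by norm_num))
    (hm'.locallyIntegrable (by norm_num)) fun g hg => ?_
  have hgc : HasCompactSupport fun w => conj (g w) := hg.comp_left (map_zero _)
  have hgn : HasCompactSupport fun w => g (-w) := hg.comp_homeomorph (Homeomorph.neg ℝ)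
  let gc : 𝓢(ℝ, ℂ) := hgc.toSchwartzMap (Complex.conjCLE.contDiff.comp g.smooth')
  let gn : 𝓢(ℝ, ℂ) := hgn.toSchwartzMap (g.smooth'.comp contDiff_neg)
  have h1 := integral_mul_fourierReal gc f
  have h2 := integral_mul_fourierReal gn f
  have h3 : ∀ x, conj (𝓕 (gc : ℝ → ℂ) x) = 𝓕 (gn : ℝ → ℂ) x := by
    intro x
    rw [fourier_real_eq_integral_exp_smul, fourier_real_eq_integral_exp_smul, ← integral_conj,
      ← integral_neg_eq_self]
    refine integral_congr_ae (.of_forall fun w => ?_)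
    change conj (_ • conj (g (-w))) = _ • g (-w)
    simp [← Complex.exp_conj, map_ofNat]
  trans ∫ x, gn x * fourierReal f x
  · rw [← integral_neg_eq_self]
    refine integral_congr_ae (.of_forall fun w => ?_)
    simp only [neg_neg]
    rfl
  · rw [h2]
    simp_rw [← h3]
    trans conj (∫ x, 𝓕 (gc : ℝ → ℂ) x * f x)
    · rw [← integral_conj]; simp
    · rw [← h1, ← integral_conj]
      refine integral_congr_ae (.of_forall fun w => ?_)
      change conj (conj (g w) * _) = _
      simp

end FourierL2

end

/-! ### Weak derivatives and decay of the Fourier transform -/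

noncomputable section

open FourierTransform SchwartzMap Real
open scoped ComplexConjugate ContDiff

section WeakDeriv

lemma MeasureTheory.MemLp.integrable_mul_real {f g : ℝ → ℝ} (hf : MemLp f 2) (hg : MemLp g 2) :
    Integrable fun t => f t * g t := hf.integrable_mul hg

/-- A weak derivative may be tested against smooth functions that are square integrable together
with their derivative. -/
lemma HasWeakDeriv.integral_mul_deriv {f g : ℝ → ℝ} (h : HasWeakDeriv f g) (hf : MemLp f 2)
    (hg : MemLp g 2) {η : ℝ → ℝ} (hη : ContDiff ℝ ∞ η) (hη2 : MemLp η 2) (hη' : MemLp (deriv η) 2) :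
    ∫ t, f t * deriv η t = -∫ t, g t * η t := by
  -- The test function is cut off by `b (ε x)` with `ε → 0`. The derivative of the cutoff
  -- contributes `ε` times a bounded function times the integrable `f η`, which vanishes in the
  -- limit.
  let b : ContDiffBump (0 : ℝ) := ⟨1, 2, one_pos, one_lt_two⟩
  have hb : ContDiff ℝ ∞ b := b.contDiff
  have hbd : Differentiable ℝ b := hb.differentiable (by simp)
  obtain ⟨C, hC⟩ : ∃ C, ∀ x, ‖deriv b x‖ ≤ C :=
    (hb.continuous_deriv (by simp)).bounded_above_of_compact_support b.hasCompactSupport.deriv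
  have hb1 : ∀ x, ‖b x‖ ≤ 1 := fun x => by
    rw [Real.norm_of_nonneg b.nonneg]; exact b.le_one
  let ε : ℕ → ℝ := fun n => 1 / ((n : ℝ) + 1)
  have hε0 : ∀ n, 0 < ε n := fun n => by positivity
  have hε : Tendsto ε atTop (𝓝 0) := tendsto_one_div_add_atTop_nhds_zero_nat
  have hεx : ∀ x : ℝ, Tendsto (fun n => ε n * x) atTop (𝓝 0) := fun x => by
    simpa using hε.mul_const x
  have hbt : ∀ x : ℝ, Tendsto (fun n => b (ε n * x)) atTop (𝓝 1) := fun x => by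
    have := (b.continuous.tendsto 0).comp (hεx x)
    rwa [b.one_of_mem_closedBall (by simp [b.rIn_pos.le])] at this
  have hbm : ∀ n, Continuous fun x => b (ε n * x) := fun n => b.continuous.comp (by fun_prop)
  have hbm' : ∀ n, Continuous fun x => deriv b (ε n * x) := fun n =>
    (hb.continuous_deriv (by simp)).comp (by fun_prop)
  have hder : ∀ n x, deriv (fun x => b (ε n * x) * η x) x =
      b (ε n * x) * deriv η x + ε n * (deriv b (ε n * x) * η x) := by
    intro n x
    have h1 : HasDerivAt (fun x => b (ε n * x)) (ε n * deriv b (ε n * x)) x := by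
      have := (hbd (ε n * x)).hasDerivAt.comp x ((hasDerivAt_id x).const_mul (ε n))
      simpa only [Function.comp_def, mul_one, one_mul, mul_comm, id] using! this
    have h2 := (hη.differentiable (by simp) x).hasDerivAt
    rw [show (fun x => b (ε n * x) * η x) = (fun x => b (ε n * x)) * η from rfl, (h1.mul h2).deriv]
    ring
  have key : ∀ n, (∫ t, b (ε n * t) * (f t * deriv η t)) +
      ε n * (∫ t, deriv b (ε n * t) * (f t * η t)) = -∫ t, b (ε n * t) * (g t * η t) := by
    intro n
    have h0 := h (fun x => b (ε n * x) * η x) ((hb.comp (by fun_prop)).mul hη)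
      ((b.hasCompactSupport.comp_homeomorph (Homeomorph.mulLeft₀ (ε n) (hε0 n).ne')).mul_right)
    simp only [hder] at h0
    rw [← integral_const_mul, ← integral_add]
    · refine Eq.trans (integral_congr_ae (.of_forall fun t => ?_)) (h0.trans (congrArg _
        (integral_congr_ae (.of_forall fun t => ?_))))
      · simp only; ring
      · simp only; ring
    · exact (hf.integrable_mul_real hη').bdd_mul (hbm n).aestronglyMeasurable
        (.of_forall fun x => hb1 _)
    · exact ((hf.integrable_mul_real hη2).bdd_mul (hbm' n).aestronglyMeasurable
        (.of_forall fun x => hC _)).const_mul _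
  have hlim : ∀ F : ℝ → ℝ, Integrable F →
      Tendsto (fun n => ∫ t, b (ε n * t) * F t) atTop (𝓝 (∫ t, F t)) := by
    intro F hF
    refine tendsto_integral_of_dominated_convergence (fun t => ‖F t‖)
      (fun n => (hbm n).aestronglyMeasurable.mul hF.1) hF.norm (fun n => .of_forall fun t => ?_)
      (.of_forall fun t => ?_)
    · rw [norm_mul]
      exact mul_le_of_le_one_left (norm_nonneg _) (hb1 _)
    · simpa using (hbt t).mul_const (F t)
  have hlim0 : Tendsto (fun n => ε n * (∫ t, deriv b (ε n * t) * (f t * η t))) atTop (𝓝 0) := by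
    refine squeeze_zero_norm (a := fun n => ε n * (∫ t, C * ‖f t * η t‖)) (fun n => ?_) ?_
    · rw [norm_mul, Real.norm_of_nonneg (hε0 n).le]
      refine mul_le_mul_of_nonneg_left ?_ (hε0 n).le
      refine norm_integral_le_of_norm_le ((hf.integrable_mul_real hη2).norm.const_mul C)
        (.of_forall fun t => ?_)
      rw [norm_mul]
      exact mul_le_mul_of_nonneg_right (hC _) (norm_nonneg _)
    · simpa using hε.mul_const _
  have h1 := ((hlim _ (hf.integrable_mul_real hη')).add hlim0).congr key
  rw [add_zero] at h1
  exact tendsto_nhds_unique h1 (hlim _ (hg.integrable_mul_real hη2)).neg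

lemma HasWeakDeriv.integral_mul_deriv_complex {f g : ℝ → ℝ} (h : HasWeakDeriv f g)
    (hf : MemLp f 2) (hg : MemLp g 2) {η : ℝ → ℂ} (hη : ContDiff ℝ ∞ η) (hη2 : MemLp η 2)
    (hη' : MemLp (deriv η) 2) :
    ∫ t, deriv η t * f t = -∫ t, η t * g t := by
  have hd : ∀ t, HasDerivAt η (deriv η t) t := fun t =>
    (hη.differentiable (by simp) t).hasDerivAt
  have hre : ∀ t, deriv (fun t => (η t).re) t = (deriv η t).re := fun t =>
    (Complex.reCLM.hasFDerivAt.comp_hasDerivAt t (hd t)).deriv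
  have him : ∀ t, deriv (fun t => (η t).im) t = (deriv η t).im := fun t =>
    (Complex.imCLM.hasFDerivAt.comp_hasDerivAt t (hd t)).deriv
  have h1 := h.integral_mul_deriv hf hg (Complex.reCLM.contDiff.comp hη) hη2.re
    (by have := hη'.re; simpa only [Function.comp_def, Complex.reCLM_apply, funext hre] using! this)
  have h2 := h.integral_mul_deriv hf hg (Complex.imCLM.contDiff.comp hη) hη2.im
    (by have := hη'.im; simpa only [Function.comp_def, Complex.imCLM_apply, funext him] using! this)
  simp only [Function.comp_def, Complex.reCLM_apply, Complex.imCLM_apply, hre, him] at h1 h2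
  have hi : ∀ (ζ : ℝ → ℂ) (k : ℝ → ℝ), MemLp ζ 2 → MemLp k 2 → Integrable fun t => ζ t * k t :=
    fun ζ k hζ hk => hζ.integrable_mul hk.ofReal
  have hsplit : ∀ (ζ : ℝ → ℂ) (k : ℝ → ℝ), MemLp ζ 2 → MemLp k 2 →
      ∫ t, ζ t * k t = ((∫ t, k t * (ζ t).re : ℝ) : ℂ) + (∫ t, k t * (ζ t).im : ℝ) * Complex.I := by
    intro ζ k hζ hk
    rw [← integral_re_add_im (hi ζ k hζ hk)]
    simp [mul_comm]
  rw [hsplit _ f hη' hf, hsplit _ g hη2 hg, h1, h2]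
  push_cast
  ring

/-- The weak derivative is tested against `𝓕 k`, which is Schwartz but in general not compactly
supported; this is why the class of test functions was enlarged. Its derivative is the transform of
`-2πiw k`. -/
lemma fourierReal_of_hasWeakDeriv {f g : ℝ → ℝ} (h : HasWeakDeriv f g) (hf : MemLp f 2)
    (hg : MemLp g 2) :
    fourierReal hg.toLp =ᵐ[volume] fun w => 2 * π * Complex.I * w * fourierReal hf.toLp w := by
  have hc : Continuous fun w : ℝ => 2 * π * Complex.I * w := by fun_prop
  have hloc := (locallyIntegrable_Lp (fourierReal hf.toLp)).continuous_mul hc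
  refine ae_eq_of_integral_schwartz_mul_eq (locallyIntegrable_Lp _) hloc fun k hk => ?_
  have hsm : ContDiff ℝ ∞ fun w : ℝ => -2 * π * Complex.I * w :=
    contDiff_const.mul Complex.ofRealCLM.contDiff
  have hk' : HasCompactSupport fun w => (-2 * π * Complex.I * w) * k w := hk.mul_left
  let k' : 𝓢(ℝ, ℂ) := hk'.toSchwartzMap (hsm.mul k.smooth')
  have hk'_apply : ∀ w, k' w = (-2 * π * Complex.I * w) * k w := fun _ => rfl
  have hxk : Integrable fun x : ℝ => x • k x := by
    have := (k'.integrable (μ := volume)).const_mul (-2 * π * Complex.I)⁻¹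
    refine this.congr (.of_forall fun x => ?_)
    simp only [hk'_apply, Complex.real_smul]
    field_simp
  have hF : ∀ u : 𝓢(ℝ, ℂ), MemLp (𝓕 (u : ℝ → ℂ)) 2 volume := fun u => by
    rw [← fourier_coe]; exact (𝓕 u).memLp 2 volume
  have hderiv : deriv (𝓕 (k : ℝ → ℂ)) = 𝓕 (k' : ℝ → ℂ) := funext fun w =>
    (Real.hasDerivAt_fourier k.integrable hxk w).deriv
  have h1 := h.integral_mul_deriv_complex hf hg (η := 𝓕 (k : ℝ → ℂ)) (𝓕 k).smooth'
    (hF k) (by rw [hderiv]; exact hF k')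
  rw [hderiv] at h1
  have h2 := integral_mul_fourierReal k hg.toLp
  have h3 := integral_mul_fourierReal k' hf.toLp
  have h4 : ∀ {u : ℝ → ℝ} (hu : MemLp u 2) (ζ : ℝ → ℂ),
      ∫ x, ζ x * (hu.toLp u x : ℝ) = ∫ x, ζ x * u x := by
    intro u hu ζ
    refine integral_congr_ae ?_
    filter_upwards [hu.coeFn_toLp] with x hx
    rw [hx]
  rw [h4] at h2 h3
  rw [h2, ← neg_eq_iff_eq_neg.2 h1, ← h3, ← integral_neg]
  refine integral_congr_ae (.of_forall fun w => ?_)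
  simp only [hk'_apply]
  ring

lemma MemSobolevH.memLp {k : ℕ} {f : ℝ → ℝ} (h : MemSobolevH k f) : MemLp f 2 := by
  cases k with
  | zero => exact h
  | succ k => exact h.1

lemma memLp_pow_mul_fourierReal (k : ℕ) : ∀ {f : ℝ → ℝ} (h : MemSobolevH k f) (hf : MemLp f 2),
    MemLp (fun w : ℝ => (w : ℂ) ^ k * fourierReal hf.toLp w) 2 := by
  induction k with
  | zero => intro f h hf; simpa using Lp.memLp (fourierReal hf.toLp)
  | succ k ih =>
    rintro f ⟨-, g, hfg, hg⟩ hf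
    have h1 := (ih hg hg.memLp).const_mul (2 * π * Complex.I)⁻¹
    refine h1.ae_eq ?_
    filter_upwards [fourierReal_of_hasWeakDeriv hfg hf hg.memLp] with w hw
    rw [hw]
    field_simp
    ring

/-- Functions in `H³` have Fourier transforms with integrable second moment. -/
lemma integrable_one_add_sq_mul_fourierReal {f : ℝ → ℝ} (h : MemSobolevH 3 f) (hf : MemLp f 2) :
    Integrable fun w : ℝ => (1 + w ^ 2) * ‖fourierReal hf.toLp w‖ := by
  have h3 := (memLp_pow_mul_fourierReal 3 h hf).norm
  have h0 := (Lp.memLp (fourierReal hf.toLp)).norm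
  -- Cauchy–Schwarz: the square integrable weight `(1 + w²)^(-1/2)` is paired with the square
  -- integrable `(1 + |w|³) |f̂(w)|`.
  have hk : MemLp (fun w : ℝ => (1 + ‖w‖ ^ 2) ^ (-(1 : ℝ) / 2)) 2 := by
    have hcont : Continuous fun w : ℝ => (1 + ‖w‖ ^ 2) ^ (-(1 : ℝ) / 2) :=
      Continuous.rpow_const (by fun_prop) fun w => Or.inl (by positivity)
    rw [memLp_two_iff_integrable_sq hcont.aestronglyMeasurable]
    refine (integrable_rpow_neg_one_add_norm_sq (μ := (volume : Measure ℝ)) (r := 2)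
      (by simp)).congr (.of_forall fun w => ?_)
    simp only
    rw [← Real.rpow_natCast (_ ^ _) 2, ← Real.rpow_mul (by positivity)]
    norm_num
  have h1 := (hk.integrable_mul (h0.add h3)).const_mul 4
  refine h1.mono' ?_ (.of_forall fun w => ?_)
  · exact (by fun_prop : Continuous fun w : ℝ => 1 + w ^ 2).aestronglyMeasurable.mul h0.1
  · simp only [Pi.mul_apply, Pi.add_apply, norm_mul, norm_pow, Complex.norm_real, norm_norm]
    set a := ‖w‖ with ha
    have ha0 : 0 ≤ a := norm_nonneg _
    rw [Real.norm_of_nonneg (by positivity : (0 : ℝ) ≤ 1 + w ^ 2), ← sq_abs, ← Real.norm_eq_abs, ← ha]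
    set c := (1 + a ^ 2) ^ (-(1 : ℝ) / 2) with hc
    have hc0 : 0 < c := by positivity
    have hc2 : c ^ 2 * (1 + a ^ 2) = 1 := by
      rw [hc, ← Real.rpow_natCast, ← Real.rpow_mul (by positivity)]
      norm_num
      rw [Real.rpow_neg_one, inv_mul_cancel₀ (by positivity)]
    -- Since `(1 + a)² ≥ 1 + a²`, one has `1 ≤ c (1 + a)`; the factor `4` generously bounds `1 + a +
    -- a² + a³` by `1 + a³`.
    have hca : 1 + a ^ 2 ≤ 4 * (c * (1 + a ^ 3)) := by
      have h5 : 1 ≤ c * (1 + a) := by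
        by_contra hlt
        push Not at hlt
        have : (c * (1 + a)) ^ 2 < 1 := by
          have : 0 ≤ c * (1 + a) := by positivity
          nlinarith
        nlinarith [mul_nonneg (sq_nonneg c) ha0]
      have h6 : (1 + a ^ 2) * (1 + a) ≤ 4 * (1 + a ^ 3) := by nlinarith [sq_nonneg (a - 1), mul_nonneg ha0 (sq_nonneg (a - 1))]
      calc 1 + a ^ 2 ≤ (1 + a ^ 2) * (c * (1 + a)) := le_mul_of_one_le_right (by positivity) h5
        _ = c * ((1 + a ^ 2) * (1 + a)) := by ring
        _ ≤ c * (4 * (1 + a ^ 3)) := by gcongr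
        _ = _ := by ring
    set m := ‖fourierReal hf.toLp w‖ with hm
    have hm0 : 0 ≤ m := norm_nonneg _
    calc (1 + a ^ 2) * m ≤ 4 * (c * (1 + a ^ 3)) * m := by gcongr
      _ = _ := by ring

end WeakDeriv

end

/-! ### Positivity of the spectral density -/

noncomputable section

open FourierTransform SchwartzMap Real
open scoped ComplexConjugate ContDiff ComplexOrder

section Bochner

/-- A function of positive type has nonnegative mean under a centered Gaussian law. -/
lemma integral_gaussianReal_nonneg_of_sum_nonneg {G : ℝ → ℝ} (hG : Continuous G) {C : ℝ}
    (hC : ∀ u, ‖G u‖ ≤ C) (hpos : ∀ (n : ℕ) (t : Fin n → ℝ), 0 ≤ ∑ k, ∑ l, G (t k - t l))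
    (v : ℝ≥0) : 0 ≤ ∫ u, G u ∂gaussianReal 0 (v + v) := by
  set J := ∫ u, G u ∂gaussianReal 0 (v + v) with hJ
  -- The points `t k` are independent with law `N(0, v)`. The `n` diagonal terms have mean `G 0`,
  -- and the `n (n - 1)` others have mean `J`, because differences have law `N(0, 2v)`. Large `n`
  -- then excludes `J < 0`.
  have key : ∀ n : ℕ, 0 ≤ (n : ℝ) * G 0 + n * (n - 1) * J := by
    intro n
    let μ := Measure.pi fun _ : Fin n => gaussianReal 0 v
    have hint : ∀ k l, Integrable (fun t : Fin n → ℝ => G (t k - t l)) μ := fun k l =>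
      (integrable_const C).mono' (hG.comp (by fun_prop)).aestronglyMeasurable
        (.of_forall fun t => hC _)
    have hI : ∀ k l, ∫ t, G (t k - t l) ∂μ = if k = l then G 0 else J := by
      intro k l
      split_ifs with h
      · simp [h]
      · have hlaw : ∀ k, μ.map (fun t : Fin n → ℝ => t k) = gaussianReal 0 v := fun k =>
          (measurePreserving_eval (fun _ : Fin n => gaussianReal 0 v) k).map_eq
        have hind : IndepFun (fun t : Fin n → ℝ => t k) (fun t => -t l) μ :=
          ((iIndepFun_pi (μ := fun _ : Fin n => gaussianReal 0 v) (X := fun _ x => x)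
            fun i => aemeasurable_id).indepFun h).comp measurable_id measurable_neg
        have hneg : μ.map (fun t : Fin n → ℝ => -t l) = gaussianReal 0 v := by
          have : HasLaw (fun t : Fin n → ℝ => t l) (gaussianReal 0 v) μ :=
            ⟨(measurable_pi_apply l).aemeasurable, hlaw l⟩
          simpa using! (gaussianReal_neg this).map_eq
        have hsum := gaussianReal_add_gaussianReal_of_indepFun hind (hlaw k) hneg
        rw [add_zero] at hsum
        rw [hJ, ← hsum, integral_map (by fun_prop) hG.aestronglyMeasurable]
        simp [sub_eq_add_neg]
    have h0 : 0 ≤ ∫ t, ∑ k, ∑ l, G (t k - t l) ∂μ := integral_nonneg fun t => hpos n t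
    rw [integral_finsetSum _ fun k _ => integrable_finsetSum _ fun l _ => hint k l] at h0
    simp_rw [integral_finsetSum _ fun l _ => hint _ l, hI] at h0
    have h1 : ∀ k : Fin n, ∑ l, (if k = l then G 0 else J) = G 0 + (n - 1) * J := by
      intro k
      have : ∀ l, (if k = l then G 0 else J) = J + if k = l then G 0 - J else 0 := by
        intro l; split_ifs <;> ring
      simp_rw [this, Finset.sum_add_distrib]
      simp
      ring
    simp_rw [h1] at h0
    simp at h0
    linarith
  by_contra hneg
  push Not at hneg
  obtain ⟨n, hn⟩ := exists_nat_gt (G 0 / (-J))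
  have h1 := key (n + 1)
  rw [div_lt_iff₀ (by linarith)] at hn
  push_cast at h1
  nlinarith [(Nat.cast_nonneg n : (0 : ℝ) ≤ n)]

/-- The weight is a positive multiple of the `N(0, 2v)` density, which settles the real part; the
imaginary part vanishes by the symmetry `hs`. -/
lemma integral_gaussian_mul_nonneg {q : ℝ → ℂ} (hq : Continuous q) {C : ℝ} (hC : ∀ u, ‖q u‖ ≤ C)
    (hs : ∀ u, q (-u) = conj (q u))
    (hpos : ∀ (n : ℕ) (t : Fin n → ℝ), 0 ≤ ∑ k, ∑ l, (q (t k - t l)).re) {v : ℝ≥0} (hv : v ≠ 0) :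
    0 ≤ ∫ u, (Real.exp (-u ^ 2 / (2 * (v + v))) : ℂ) * q u := by
  have hv2 : v + v ≠ 0 := by simpa using hv
  have hE : Integrable fun u : ℝ => Real.exp (-u ^ 2 / (2 * (v + v))) := by
    have := integrable_exp_neg_mul_sq (b := 1 / (2 * ((v : ℝ) + v))) (by positivity)
    refine this.congr (.of_forall fun u => ?_)
    simp only
    congr 1
    ring
  have hint : Integrable fun u : ℝ => (Real.exp (-u ^ 2 / (2 * (v + v))) : ℂ) * q u :=
    hE.ofReal.mul_bdd hq.aestronglyMeasurable (.of_forall hC)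
  rw [Complex.nonneg_iff]
  constructor
  · have h1 := integral_gaussianReal_nonneg_of_sum_nonneg (Complex.continuous_re.comp hq)
      (fun u => (Complex.abs_re_le_norm _).trans (hC u)) hpos v
    rw [integral_gaussianReal_eq_integral_smul hv2] at h1
    simp only [gaussianPDFReal_def, sub_zero, smul_eq_mul, mul_assoc, Function.comp_apply] at h1
    rw [integral_const_mul] at h1
    have h2 := nonneg_of_mul_nonneg_right h1 (by positivity)
    rw [← RCLike.re_eq_complex_re, ← integral_re hint]
    refine h2.trans_eq (integral_congr_ae (.of_forall fun u => ?_))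
    simp only [RCLike.re_eq_complex_re, Complex.re_ofReal_mul]
    push_cast
    rfl
  · symm
    rw [← Complex.conj_eq_iff_im, ← integral_conj, ← integral_neg_eq_self]
    refine integral_congr_ae (.of_forall fun u => ?_)
    simp only [neg_sq, map_mul, Complex.conj_ofReal, hs, Complex.conj_conj]

lemma ofRealCLM_compLp_toLp {f : ℝ → ℝ} (hf2 : MemLp f 2) :
    Complex.ofRealCLM.compLp hf2.toLp = hf2.ofReal.toLp (fun x => (f x : ℂ)) := by
  refine Lp.ext ?_
  filter_upwards [ofRealCLM_compLp_coeFn hf2.toLp, hf2.coeFn_toLp, (MemLp.ofReal (K := ℂ) hf2).coeFn_toLp]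
    with x h1 h2 h3
  rw [h1, h2]
  exact h3.symm

lemma fourierReal_toLp_ae_eq {f : ℝ → ℝ} (hf : Integrable f) (hf2 : MemLp f 2) :
    fourierReal hf2.toLp =ᵐ[volume] 𝓕 fun x => (f x : ℂ) := by
  rw [fourierReal, ofRealCLM_compLp_toLp hf2]
  exact fourier_toLp_ae_eq hf.ofReal hf2.ofReal

lemma ofReal_eq_integral_fourierReal {f : ℝ → ℝ} (hf : Continuous f) (hf2 : MemLp f 2)
    (hi : Integrable (fourierReal hf2.toLp)) (t : ℝ) :
    (f t : ℂ) = ∫ w, Complex.exp (↑(2 * π * t * w) * Complex.I) * fourierReal hf2.toLp w := by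
  rw [fourierReal, ofRealCLM_compLp_toLp hf2] at hi ⊢
  have h1 := congrFun (eq_fourierInv_of_integrable (Complex.continuous_ofReal.comp hf)
    hf2.ofReal hi) t
  simp only [Function.comp_apply] at h1
  rw [h1, Real.fourierInv_eq_fourier_neg, fourier_real_eq_integral_exp_smul]
  refine integral_congr_ae (.of_forall fun w => ?_)
  simp only [smul_eq_mul]
  congr 3
  push_cast
  ring

lemma norm_le_integral_norm_fourierReal {f : ℝ → ℝ} (hf : Continuous f) (hf2 : MemLp f 2)
    (hi : Integrable (fourierReal hf2.toLp)) (t : ℝ) :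
    ‖f t‖ ≤ ∫ w, ‖fourierReal hf2.toLp w‖ := by
  rw [← Complex.norm_real, ofReal_eq_integral_fourierReal hf hf2 hi]
  refine (norm_integral_le_integral_norm _).trans_eq
    (integral_congr_ae (.of_forall fun w => ?_))
  simp only [norm_mul, Complex.norm_exp_ofReal_mul_I, one_mul]

lemma continuous_fourierReal : Continuous fourierReal :=
  (Lp.fourierTransformₗᵢ ℝ ℂ).continuous.comp (Complex.ofRealCLM.compLpL 2 volume).continuous

/-- The real part separates into the quadratic forms of the real and of the imaginary parts of `c`.
-/
lemma Matrix.PosSemidef.re_sum_nonneg {n : Type*} [Fintype n] {M : Matrix n n ℝ}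
    (hM : M.PosSemidef) (c : n → ℂ) : 0 ≤ (∑ p, ∑ q, conj (c p) * c q * M p q).re := by
  have h1 := (posSemidef_iff_dotProduct_mulVec.1 hM).2 fun p => (c p).re
  have h2 := (posSemidef_iff_dotProduct_mulVec.1 hM).2 fun p => (c p).im
  refine (add_nonneg h1 h2).trans_eq ?_
  simp only [dotProduct, mulVec, Finset.mul_sum, ← Finset.sum_add_distrib, Complex.re_sum,
    Pi.star_apply, star_trivial]
  refine Finset.sum_congr rfl fun p _ => Finset.sum_congr rfl fun q _ => ?_
  simp
  ring

lemma IsPositiveType.apply_neg {d : ℕ} {ψ : ℝ → Matrix (Fin d) (Fin d) ℝ} (h : IsPositiveType ψ)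
    (u : ℝ) (i j : Fin d) : ψ (-u) i j = ψ u j i := by
  have := (h 2 ![0, u]).1.apply (0, i) (1, j)
  simpa using! this.symm

/-- The Gaussian weight `exp (-u² / (4 (n + 1)))`. -/
def gaussianWeight (n : ℕ) (u : ℝ) : ℝ := Real.exp (-u ^ 2 / (2 * (((n + 1 : ℕ) : ℝ≥0) + ((n + 1 : ℕ) : ℝ≥0))))

lemma continuous_gaussianWeight (n : ℕ) : Continuous (gaussianWeight n) := by
  unfold gaussianWeight; fun_prop

lemma gaussianWeight_nonneg (n : ℕ) (u : ℝ) : 0 ≤ gaussianWeight n u := (Real.exp_pos _).le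

lemma gaussianWeight_le_one (n : ℕ) (u : ℝ) : gaussianWeight n u ≤ 1 := by
  rw [gaussianWeight, Real.exp_le_one_iff, neg_div]
  exact neg_nonpos.2 (by positivity)

lemma norm_gaussianWeight_le_one (n : ℕ) (u : ℝ) : ‖gaussianWeight n u‖ ≤ 1 := by
  rw [Real.norm_of_nonneg (gaussianWeight_nonneg n u)]; exact gaussianWeight_le_one n u

lemma tendsto_gaussianWeight (u : ℝ) : Tendsto (fun n => gaussianWeight n u) atTop (𝓝 1) := by
  rw [← Real.exp_zero]
  refine (Real.continuous_exp.tendsto _).comp ?_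
  have h : Tendsto (fun n : ℕ => (-u ^ 2 / 4) * (1 / ((n : ℝ) + 1))) atTop (𝓝 0) := by
    simpa using (tendsto_one_div_add_atTop_nhds_zero_nat (𝕜 := ℝ)).const_mul (-u ^ 2 / 4)
  refine h.congr fun n => ?_
  push_cast
  field_simp
  ring

lemma memLp_gaussianWeight (n : ℕ) : MemLp (gaussianWeight n) 2 := by
  rw [memLp_two_iff_integrable_sq (continuous_gaussianWeight n).aestronglyMeasurable]
  have := integrable_exp_neg_mul_sq (b := 1 / (2 * ((n : ℝ) + 1))) (by positivity)
  refine this.congr (.of_forall fun u => ?_)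
  simp only [gaussianWeight]
  rw [← Real.exp_nat_mul]
  congr 1
  push_cast
  field_simp
  ring

lemma memLp_gaussianWeight_mul (n : ℕ) {f : ℝ → ℝ} (hf : MemLp f 2) :
    MemLp (fun u => gaussianWeight n u * f u) 2 :=
  hf.of_le ((continuous_gaussianWeight n).aestronglyMeasurable.mul hf.1) (.of_forall fun u => by
    rw [norm_mul]
    exact mul_le_of_le_one_left (norm_nonneg _) (norm_gaussianWeight_le_one n u))

lemma tendsto_gaussianWeight_mul {f : ℝ → ℝ} (hf : MemLp f 2) :
    Tendsto (fun n => (memLp_gaussianWeight_mul n hf).toLp) atTop (𝓝 hf.toLp) := by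
  rw [Lp.tendsto_Lp_iff_tendsto_eLpNorm'']
  have h := tendsto_lintegral_of_dominated_convergence' (μ := volume) (fun u => ‖f u‖ₑ ^ (2 : ℝ))
    (F := fun n u => ‖gaussianWeight n u * f u - f u‖ₑ ^ (2 : ℝ)) (f := fun _ => 0)
    (fun n => ((memLp_gaussianWeight_mul n hf).1.sub hf.1).enorm.pow_const _)
    (fun n => .of_forall fun u => by
      refine ENNReal.rpow_le_rpow (enorm_le_iff_norm_le.2 ?_) (by norm_num)
      rw [← sub_one_mul, norm_mul]
      refine mul_le_of_le_one_left (norm_nonneg _) ?_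
      rw [Real.norm_eq_abs, abs_le]
      constructor <;> linarith [gaussianWeight_nonneg n u, gaussianWeight_le_one n u])
    (by
      have := (lintegral_rpow_enorm_lt_top_of_eLpNorm_lt_top (by norm_num) (by norm_num) hf.2).ne
      simpa using this)
    (.of_forall fun u => by
      have h1 := ((tendsto_gaussianWeight u).mul_const (f u)).sub_const (f u)
      rw [one_mul, sub_self] at h1
      have h2 := (ENNReal.continuous_rpow_const (y := 2)).tendsto _ |>.comp h1.enorm
      simpa using! h2)
  simp only [lintegral_zero] at h
  have h2 := (ENNReal.continuous_rpow_const (y := 1 / 2)).tendsto _ |>.comp h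
  simp only [ENNReal.zero_rpow_of_pos (by norm_num : (0 : ℝ) < 1 / 2)] at h2
  refine h2.congr fun n => ?_
  rw [eLpNorm_eq_lintegral_rpow_enorm_toReal (by norm_num) (by norm_num)]
  simp

variable {d : ℕ} {ψ : ℝ → Matrix (Fin d) (Fin d) ℝ}

/-- The matrix of Fourier transforms of the entries of `ψ`. -/
def fourierMatrix (hψ : MemL2 ψ) (w : ℝ) : Matrix (Fin d) (Fin d) ℂ :=
  Matrix.of fun i j => fourierReal (hψ i j).toLp w

/-- The modulated quadratic form `∑ conj xᵢ xⱼ ψᵢⱼ(u) exp (-2πiwu)`. -/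
def modulatedForm (ψ : ℝ → Matrix (Fin d) (Fin d) ℝ) (x : Fin d → ℂ) (w u : ℝ) : ℂ :=
  ∑ i, ∑ j, conj (x i) * x j * (Complex.exp (↑(-2 * π * u * w) * Complex.I) * ψ u i j)

/-- The modulation factors as `conj (e k) * e l` with `e k = exp (2πi w t k)`, so it is absorbed
into the complex test vector. -/
lemma IsPositiveType.sum_modulatedForm_nonneg (h : IsPositiveType ψ) (x : Fin d → ℂ) (w : ℝ)
    (n : ℕ) (t : Fin n → ℝ) : 0 ≤ ∑ k, ∑ l, (modulatedForm ψ x w (t k - t l)).re := by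
  have := (h n t).re_sum_nonneg fun p =>
    x p.2 * Complex.exp (↑(2 * π * t p.1 * w) * Complex.I)
  simp_rw [← Complex.re_sum]
  refine this.trans_eq (congrArg Complex.re ?_)
  simp only [Fintype.sum_prod_type, modulatedForm]
  refine Finset.sum_congr rfl fun k _ => ?_
  rw [Finset.sum_comm]
  refine Finset.sum_congr rfl fun l _ => Finset.sum_congr rfl fun i _ =>
    Finset.sum_congr rfl fun j _ => ?_
  rw [map_mul, ← Complex.exp_conj, map_mul, Complex.conj_I, Complex.conj_ofReal]
  have : Complex.exp (↑(-2 * π * (t k - t l) * w) * Complex.I) =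
    Complex.exp (↑(2 * π * t k * w) * -Complex.I) * Complex.exp (↑(2 * π * t l * w) * Complex.I) := by
    rw [← Complex.exp_add]; congr 1; push_cast; ring
  rw [this]
  simp only [Matrix.of_apply]
  ring

lemma IsPositiveType.modulatedForm_neg (h : IsPositiveType ψ) (x : Fin d → ℂ) (w u : ℝ) :
    modulatedForm ψ x w (-u) = conj (modulatedForm ψ x w u) := by
  simp only [modulatedForm, map_sum, map_mul, Complex.conj_conj, Complex.conj_ofReal,
    ← Complex.exp_conj, Complex.conj_I, h.apply_neg]
  rw [Finset.sum_comm]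
  refine Finset.sum_congr rfl fun i _ => Finset.sum_congr rfl fun j _ => ?_
  rw [mul_comm (x i)]
  congr 3
  push_cast
  ring

lemma IsPositiveType.integral_gaussianWeight_mul_modulatedForm_nonneg (h : IsPositiveType ψ)
    (hc : Continuous ψ) {C : ℝ} (hC : ∀ i j u, ‖ψ u i j‖ ≤ C) (x : Fin d → ℂ) (w : ℝ) (n : ℕ) :
    0 ≤ ∫ u, (gaussianWeight n u : ℂ) * modulatedForm ψ x w u := by
  refine integral_gaussian_mul_nonneg (q := modulatedForm ψ x w)
    (C := ∑ i, ∑ j, ‖x i‖ * ‖x j‖ * C) ?_ (fun u => ?_) (h.modulatedForm_neg x w)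
    (h.sum_modulatedForm_nonneg x w) (by positivity)
  · have : ∀ i j, Continuous fun u => ψ u i j := fun i j => (continuous_apply_apply i j).comp hc
    unfold modulatedForm
    fun_prop
  · refine (norm_sum_le _ _).trans (Finset.sum_le_sum fun i _ => (norm_sum_le _ _).trans
      (Finset.sum_le_sum fun j _ => ?_))
    simp only [norm_mul, RCLike.norm_conj, Complex.norm_exp_ofReal_mul_I, one_mul,
      Complex.norm_real]
    gcongr
    exact hC i j u

/-- Since `ψ` need not be integrable here, it is first multiplied by a Gaussian weight. The
transform is then an honest integral, nonnegative by the averaging argument, and nonnegativity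
survives the `L²` limit as the weights increase to `1`. -/
lemma IsPositiveType.ae_dotProduct_fourierMatrix_nonneg (h : IsPositiveType ψ) (hc : Continuous ψ)
    {C : ℝ} (hC : ∀ i j u, ‖ψ u i j‖ ≤ C) (hψ : MemL2 ψ) (x : Fin d → ℂ) :
    ∀ᵐ w, 0 ≤ ∑ i, ∑ j, conj (x i) * x j * fourierMatrix hψ w i j := by
  have hcoe : ∀ F : Fin d → Fin d → Lp ℂ 2 (volume : Measure ℝ),
      ⇑(∑ i, ∑ j, (conj (x i) * x j) • F i j) =ᵐ[volume]
        fun w => ∑ i, ∑ j, conj (x i) * x j * F i j w := by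
    intro F
    have h1 : ∀ᵐ w, ∀ i j, ((conj (x i) * x j) • F i j : Lp ℂ 2 (volume : Measure ℝ)) w =
        conj (x i) * x j * F i j w := by
      refine ae_all_iff.2 fun i => ae_all_iff.2 fun j => ?_
      filter_upwards [Lp.coeFn_smul (conj (x i) * x j) (F i j)] with w hw
      rw [hw]; rfl
    have h2 : ∀ᵐ w, ∀ i, (∑ j, (conj (x i) * x j) • F i j : Lp ℂ 2 (volume : Measure ℝ)) w =
        ∑ j, ((conj (x i) * x j) • F i j : Lp ℂ 2 (volume : Measure ℝ)) w := by
      refine ae_all_iff.2 fun i => ?_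
      filter_upwards [Lp.coeFn_finsetSum Finset.univ fun j => (conj (x i) * x j) • F i j] with w hw
      simpa using hw
    filter_upwards [h1, h2,
      Lp.coeFn_finsetSum Finset.univ fun i => ∑ j, (conj (x i) * x j) • F i j] with w h1 h2 h3
    rw [h3, Finset.sum_apply]
    exact Finset.sum_congr rfl fun i _ => (h2 i).trans (Finset.sum_congr rfl fun j _ => h1 i j)
  have hlim : Tendsto (fun n => ∑ i, ∑ j, (conj (x i) * x j) •
      fourierReal (memLp_gaussianWeight_mul n (hψ i j)).toLp) atTop
      (𝓝 (∑ i, ∑ j, (conj (x i) * x j) • fourierReal (hψ i j).toLp)) :=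
    tendsto_finsetSum _ fun i _ => tendsto_finsetSum _ fun j _ =>
      ((continuous_fourierReal.tendsto _).comp (tendsto_gaussianWeight_mul (hψ i j))).const_smul _
  have hnn : ∀ n, 0 ≤ ∑ i, ∑ j, (conj (x i) * x j) •
      fourierReal (memLp_gaussianWeight_mul n (hψ i j)).toLp := by
    intro n
    rw [← Lp.coeFn_nonneg]
    have hint : ∀ i j, Integrable fun u => gaussianWeight n u * ψ u i j := fun i j =>
      (memLp_gaussianWeight n).integrable_mul (hψ i j)
    have h1 : ∀ᵐ w, ∀ i j, fourierReal (memLp_gaussianWeight_mul n (hψ i j)).toLp w =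
        𝓕 (fun u => ((gaussianWeight n u * ψ u i j : ℝ) : ℂ)) w :=
      ae_all_iff.2 fun i => ae_all_iff.2 fun j => fourierReal_toLp_ae_eq (hint i j) _
    filter_upwards [hcoe _, h1] with w h2 h1
    rw [h2, Pi.zero_apply]
    refine (h.integral_gaussianWeight_mul_modulatedForm_nonneg hc hC x w n).trans_eq ?_
    simp only [h1, fourier_real_eq_integral_exp_smul, modulatedForm, smul_eq_mul]
    have hint2 : ∀ i j, Integrable fun u => Complex.exp (↑(-2 * π * u * w) * Complex.I) *
        ((gaussianWeight n u * ψ u i j : ℝ) : ℂ) := fun i j =>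
      (hint i j).ofReal.bdd_mul (c := 1) (by fun_prop)
        (.of_forall fun u => (Complex.norm_exp_ofReal_mul_I _).le)
    simp_rw [← integral_const_mul]
    simp_rw [← integral_finsetSum _ fun j _ => (hint2 _ j).const_mul _]
    rw [← integral_finsetSum _ fun i _ => integrable_finsetSum _ fun j _ =>
      (hint2 i j).const_mul _]
    refine integral_congr_ae (.of_forall fun u => ?_)
    simp only [Finset.mul_sum]
    refine Finset.sum_congr rfl fun i _ => Finset.sum_congr rfl fun j _ => ?_
    push_cast
    ring
  have h0 := ge_of_tendsto' hlim hnn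
  rw [← Lp.coeFn_nonneg] at h0
  filter_upwards [h0, hcoe _] with w h1 h2
  rw [h2] at h1
  exact h1

/-- The Fourier transform of a function of positive type is positive semidefinite. -/
lemma IsPositiveType.ae_posSemidef_fourierMatrix (h : IsPositiveType ψ) (hc : Continuous ψ)
    {C : ℝ} (hC : ∀ i j u, ‖ψ u i j‖ ≤ C) (hψ : MemL2 ψ) :
    ∀ᵐ w, (fourierMatrix hψ w).PosSemidef := by
  -- The exceptional null set depends on the vector, so only a countable dense set of vectors is
  -- used; continuity of the form gives the rest.
  have h1 : ∀ᵐ w, ∀ n, 0 ≤ ∑ i, ∑ j, conj (TopologicalSpace.denseSeq (Fin d → ℂ) n i) *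
      TopologicalSpace.denseSeq (Fin d → ℂ) n j * fourierMatrix hψ w i j :=
    ae_all_iff.2 fun n => h.ae_dotProduct_fourierMatrix_nonneg hc hC hψ _
  filter_upwards [h1] with w hw
  have h2 : ∀ x : Fin d → ℂ, 0 ≤ ∑ i, ∑ j, conj (x i) * x j * fourierMatrix hψ w i j := by
    intro x
    refine (TopologicalSpace.denseRange_denseSeq (Fin d → ℂ)).induction_on x ?_ hw
    exact isClosed_le continuous_const (by fun_prop)
  rw [← Matrix.isPositive_toEuclideanLin_iff, LinearMap.isPositive_iff_complex]
  intro x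
  have h3 := h2 x
  have h4 : inner ℂ (Matrix.toEuclideanLin (fourierMatrix hψ w) x) x =
      conj (∑ i, ∑ j, conj (x i) * x j * fourierMatrix hψ w i j) := by
    simp only [EuclideanSpace.inner_eq_star_dotProduct, Matrix.ofLp_toLpLin, Matrix.toLin'_apply,
      dotProduct, mulVec, map_sum, map_mul, Complex.conj_conj, Finset.mul_sum, Pi.star_apply,
      star_sum, star_mul', RCLike.star_def]
    refine Finset.sum_congr rfl fun i _ => Finset.sum_congr rfl fun j _ => ?_
    ring
  rw [h4]
  obtain ⟨h5, h6⟩ := Complex.nonneg_iff.1 h3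
  rw [Complex.conj_eq_iff_im.2 h6.symm]
  exact ⟨Complex.conj_eq_iff_re.1 (Complex.conj_eq_iff_im.2 h6.symm), h5⟩

end Bochner

end

/-! ### Spectral factorization and differentiable stationary families -/

noncomputable section

open FourierTransform SchwartzMap Real
open scoped ComplexConjugate ContDiff

section SpectralFactor

section
open scoped Matrix.Norms.L2Operator MatrixOrder ComplexOrder

/-- Symmetrizing the argument makes the functional calculus continuous on all matrices. Continuity
is wanted so that the square root of the spectral density is measurable in the frequency. -/
lemma Matrix.exists_continuous_sqrt (d : ℕ) :
    ∃ S : Matrix (Fin d) (Fin d) ℂ → Matrix (Fin d) (Fin d) ℂ, Continuous S ∧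
      ∀ A, A.PosSemidef → S A * (S A)ᴴ = A := by
  have hsa : ∀ A : Matrix (Fin d) (Fin d) ℂ, IsSelfAdjoint ((1 / 2 : ℝ) • (A + Aᴴ)) := fun A =>
    (IsSelfAdjoint.all (1 / 2 : ℝ)).smul (IsSelfAdjoint.add_star_self A)
  have hc : Continuous fun A : Matrix (Fin d) (Fin d) ℂ =>
      cfc Real.sqrt ((1 / 2 : ℝ) • (A + Aᴴ)) :=
    Continuous.cfc_of_mem_nhdsSet (p := IsSelfAdjoint) (s := Set.univ) Real.sqrt (by simp)
      (by fun_prop) hsa Real.continuous_sqrt.continuousOn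
  refine ⟨fun A => cfc Real.sqrt ((1 / 2 : ℝ) • (A + Aᴴ)), hc, fun A hA => ?_⟩
  have hAA : (1 / 2 : ℝ) • (A + Aᴴ) = A := by
    rw [hA.1.eq, ← two_smul ℝ A, smul_smul]
    norm_num
  simp only [hAA]
  have h1 : IsSelfAdjoint (cfc Real.sqrt A) := cfc_predicate _ _
  rw [← star_eq_conjTranspose, h1.star_eq, ← cfc_mul ..]
  have h2 : (0 : Matrix _ _ ℂ) ≤ A := Matrix.nonneg_iff_posSemidef.2 hA
  conv_rhs => rw [← cfc_id ℝ A (ha := hA.1)]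
  refine cfc_congr fun x hx => ?_
  exact Real.mul_self_sqrt (spectrum_nonneg_of_nonneg h2 hx)

end

/-- Paired with a fixed `g`, the translation curve is the Fourier transform of `conj ĝ * f̂`. This
has an integrable first moment because `w f̂` is square integrable, so differentiation under the
integral applies. -/
lemma shiftL2_sub_eq_integral {f k : Lp ℝ 2 (volume : Measure ℝ)}
    (h : fourierReal k =ᵐ[volume] fun w : ℝ => (-2 * π * Complex.I * w) * fourierReal f w)
    (t₁ t₂ : ℝ) : shiftL2 t₂ f - shiftL2 t₁ f = ∫ t in t₁..t₂, shiftL2 t k := by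
  refine ext_inner_left ℝ fun g => ?_
  have hF : ∀ (u : Lp ℝ 2 (volume : Measure ℝ)) t, ((inner ℝ g (shiftL2 t u) : ℝ) : ℂ) =
      𝓕 (fun w => conj (fourierReal g w) * fourierReal u w) t := by
    intro u t
    rw [ofReal_inner_eq_integral_fourierReal, fourier_real_eq_integral_exp_smul]
    refine integral_congr_ae ?_
    filter_upwards [fourierReal_shiftL2 t u] with w hw
    rw [hw, smul_eq_mul]
    ring_nf
  have hint : ∀ u : Lp ℝ 2 (volume : Measure ℝ),
      Integrable fun w => conj (fourierReal g w) * fourierReal u w := fun u =>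
    (Lp.memLp (fourierReal g)).star.integrable_mul (Lp.memLp (fourierReal u))
  have hk : (fun w => conj (fourierReal g w) * fourierReal k w) =ᵐ[volume]
      fun w : ℝ => (-2 * π * Complex.I * w) • (conj (fourierReal g w) * fourierReal f w) := by
    filter_upwards [h] with w hw
    rw [hw, smul_eq_mul]
    ring
  have hint' : Integrable fun w : ℝ => w • (conj (fourierReal g w) * fourierReal f w) := by
    refine ((hint k).const_mul (-2 * π * Complex.I)⁻¹).congr ?_
    filter_upwards [hk] with w hw
    rw [hw, smul_eq_mul, Complex.real_smul]
    field_simp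
  have hderiv : ∀ t, HasDerivAt (fun t => inner ℝ g (shiftL2 t f)) (inner ℝ g (shiftL2 t k)) t := by
    intro t
    have h1 := Real.hasDerivAt_fourier (hint f) hint' t
    have h2 : 𝓕 (fun w : ℝ => (-2 * π * Complex.I * w) • (conj (fourierReal g w) * fourierReal f w)) t
        = ((inner ℝ g (shiftL2 t k) : ℝ) : ℂ) := by
      rw [hF k, fourier_real_eq_integral_exp_smul, fourier_real_eq_integral_exp_smul]
      refine integral_congr_ae ?_
      filter_upwards [hk] with w hw
      rw [hw]
    rw [h2] at h1
    have h3 := Complex.reCLM.hasFDerivAt.comp_hasDerivAt t h1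
    simp only [Function.comp_def, Complex.reCLM_apply, ← hF f, Complex.ofReal_re] at h3
    exact h3
  have h1 := (innerSL ℝ g).intervalIntegral_comp_comm
    ((continuous_shiftL2 k).intervalIntegrable (μ := volume) t₁ t₂)
  simp only [innerSL_apply_apply] at h1
  rw [← h1, intervalIntegral.integral_eq_sub_of_hasDerivAt (fun t _ => hderiv t)
    ((continuous_const.inner (continuous_shiftL2 k)).intervalIntegrable _ _), inner_sub_right]

variable {d : ℕ}

/-- Translation by `t` on `L²(ℝ; ℝᵈ)`. -/
def shiftVec (t : ℝ) : L2Vec d →ₗᵢ[ℝ] L2Vec d where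
  toFun h := WithLp.toLp 2 fun k => shiftL2 t (h k)
  map_add' f g := by ext1 k; simp
  map_smul' c f := by ext1 k; simp
  norm_map' f := by simp [PiLp.norm_eq_of_L2]

@[simp] lemma shiftVec_apply (t : ℝ) (h : L2Vec d) (k : Fin d) :
    shiftVec t h k = shiftL2 t (h k) := rfl

lemma shiftVec_add (s t : ℝ) (h : L2Vec d) : shiftVec (s + t) h = shiftVec s (shiftVec t h) := by
  ext1 k
  simp [shiftL2_add]

lemma shiftL2_zero (f : Lp ℝ 2 (volume : Measure ℝ)) : shiftL2 0 f = f := by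
  refine Lp.ext ?_
  filter_upwards [shiftL2_coeFn 0 f] with x hx
  rw [hx, sub_zero]

lemma shiftVec_zero (h : L2Vec d) : shiftVec 0 h = h := by
  ext1 k
  simp [shiftL2_zero]

lemma continuous_shiftVec (h : L2Vec d) : Continuous fun t => shiftVec t h :=
  (PiLp.continuous_toLp 2 _).comp (continuous_pi fun k => continuous_shiftL2 (h k))

lemma inner_shiftVec_shiftVec (s t : ℝ) (h g : L2Vec d) :
    inner ℝ (shiftVec (s + t) h) (shiftVec s g) = inner ℝ (shiftVec t h) g := by
  rw [shiftVec_add, LinearIsometry.inner_map_map]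

/-- Translations form a group of isometries, so the modulus of continuity at `0` serves everywhere.
-/
lemma uniformContinuous_shiftVec (h : L2Vec d) : UniformContinuous fun t => shiftVec t h := by
  rw [Metric.uniformContinuous_iff]
  intro ε hε
  obtain ⟨δ, hδ, hc⟩ := Metric.continuous_iff.1 (continuous_shiftVec h) 0 ε hε
  refine ⟨δ, hδ, fun {a b} hab => ?_⟩
  have h1 : shiftVec a h = shiftVec b (shiftVec (a - b) h) := by
    rw [← shiftVec_add]; congr 2; ring
  have h2 : shiftVec b h = shiftVec b (shiftVec 0 h) := by rw [shiftVec_zero]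
  rw [h1, h2, LinearIsometry.dist_map]
  refine hc (a - b) ?_
  rwa [dist_zero_right, ← dist_eq_norm]

lemma shiftVec_sub_eq_integral {f k : L2Vec d}
    (h : ∀ l, fourierReal (k l) =ᵐ[volume]
      fun w : ℝ => (-2 * π * Complex.I * w) * fourierReal (f l) w)
    (t₁ t₂ : ℝ) : shiftVec t₂ f - shiftVec t₁ f = ∫ t in t₁..t₂, shiftVec t k := by
  ext1 l
  have h1 := (PiLp.proj (𝕜 := ℝ) 2 (fun _ : Fin d => Lp ℝ 2 (volume : Measure ℝ)) l).intervalIntegral_comp_comm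
    ((continuous_shiftVec k).intervalIntegrable (μ := volume) t₁ t₂)
  simp only [PiLp.proj_apply, shiftVec_apply] at h1
  rw [← h1, ← shiftL2_sub_eq_integral (h l)]
  rfl

variable {ψ : ℝ → Matrix (Fin d) (Fin d) ℝ}

/-- Square root of the Fourier transform of a function of positive type. -/
lemma IsPositiveType.exists_factor_fourierMatrix (h : IsPositiveType ψ) (hc : Continuous ψ)
    {C : ℝ} (hC : ∀ i j u, ‖ψ u i j‖ ≤ C) (hψ : MemL2 ψ) :
    ∃ θ : Fin d → Fin d → ℝ → ℂ, (∀ i k, AEStronglyMeasurable (θ i k)) ∧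
      (∀ i k w, θ i k (-w) = conj (θ i k w)) ∧
      ∀ᵐ w, ∀ i j, ∑ k, conj (θ i k w) * θ j k w = fourierMatrix hψ w i j := by
  obtain ⟨S, hS, hSA⟩ := Matrix.exists_continuous_sqrt d
  let B : ℝ → Matrix (Fin d) (Fin d) ℂ := fun w => S (fourierMatrix hψ w)
  have hBm : ∀ i k, Measurable fun w => B w i k := by
    intro i k
    have h1 : Measurable fun w => (fun p q => fourierMatrix hψ w p q : Fin d → Fin d → ℂ) :=
      measurable_pi_lambda _ fun p => measurable_pi_lambda _ fun q =>
        (Lp.stronglyMeasurable _).measurable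
    have h2 : Continuous fun A : Fin d → Fin d → ℂ => S A i k :=
      (continuous_apply_apply i k).comp hS
    exact h2.measurable.comp h1
  have hBeq : ∀ᵐ w, ∀ i j, ∑ k, B w i k * conj (B w j k) = fourierMatrix hψ w i j := by
    filter_upwards [h.ae_posSemidef_fourierMatrix hc hC hψ] with w hw i j
    have := congrFun (congrFun (hSA _ hw) i) j
    rw [Matrix.mul_apply] at this
    simpa using! this
  -- The factor is prescribed for `w > 0` and reflected, so that Hermitian symmetry holds at every
  -- `w` and not only almost everywhere. For `w > 0` the conjugate is taken because the required
  -- product has the conjugate on the first factor.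
  let θ : Fin d → Fin d → ℝ → ℂ := fun i k w =>
    if 0 < w then conj (B w i k) else if w < 0 then B (-w) i k else 0
  refine ⟨θ, fun i k => Measurable.aestronglyMeasurable ?_, fun i k w => ?_, ?_⟩
  · refine Measurable.ite measurableSet_Ioi (Complex.continuous_conj.measurable.comp (hBm i k)) ?_
    exact Measurable.ite measurableSet_Iio ((hBm i k).comp measurable_neg) measurable_const
  · rcases lt_trichotomy w 0 with hw | rfl | hw
    · simp [θ, hw, hw.not_gt]
    · simp [θ]
    · simp [θ, hw, hw.not_gt]
  · have hneg : ∀ᵐ w, ∀ i j, ∑ k, B (-w) i k * conj (B (-w) j k) = fourierMatrix hψ (-w) i j :=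
      (Measure.measurePreserving_neg (volume : Measure ℝ)).quasiMeasurePreserving.ae hBeq
    have hsym : ∀ᵐ w, ∀ i j, fourierMatrix hψ (-w) i j = conj (fourierMatrix hψ w i j) :=
      ae_all_iff.2 fun i => ae_all_iff.2 fun j => fourierReal_neg _
    filter_upwards [hBeq, hneg, hsym, (measure_singleton (0 : ℝ) : volume {(0 : ℝ)} = 0) |> compl_mem_ae_iff.2] with w h1 h2 h3 h4 i j
    rcases lt_trichotomy w 0 with hw | rfl | hw
    · simp only [θ, hw, hw.not_gt, if_true, if_false]
      have := congrArg conj ((h2 i j).trans (h3 i j))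
      simpa [map_sum] using this
    · simp at h4
    · simp only [θ, hw, hw.not_gt, if_true, if_false, Complex.conj_conj]
      exact h1 i j

/-- Spectral representation of an autocorrelation function in `H³`: a stationary family in
`L²(ℝ; ℝᵈ)` with derivative. -/
lemma IsPositiveType.exists_stationary_family (h : IsPositiveType ψ) (hc : Continuous ψ)
    (hsob : ∀ i j, MemSobolevH 3 fun t => ψ t i j) :
    ∃ σ κ : Fin d → L2Vec d, (∀ t i j, inner ℝ (shiftVec t (σ i)) (σ j) = ψ t i j) ∧
      ∀ i t₁ t₂, shiftVec t₂ (σ i) - shiftVec t₁ (σ i) = ∫ t in t₁..t₂, shiftVec t (κ i) := by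
  have hψ : MemL2 ψ := fun i j => (hsob i j).memLp
  have hcij : ∀ i j, Continuous fun u => ψ u i j := fun i j => (continuous_apply_apply i j).comp hc
  have hi : ∀ i j, Integrable fun w : ℝ => (1 + w ^ 2) * ‖fourierReal (hψ i j).toLp w‖ :=
    fun i j => integrable_one_add_sq_mul_fourierReal (hsob i j) (hψ i j)
  have hi0 : ∀ i j, Integrable (fourierReal (hψ i j).toLp) := fun i j =>
    (hi i j).mono' (Lp.aestronglyMeasurable _) (.of_forall fun w =>
      le_mul_of_one_le_left (norm_nonneg _) (by nlinarith [sq_nonneg w]))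
  obtain ⟨C, hC⟩ : ∃ C, ∀ i j u, ‖ψ u i j‖ ≤ C := by
    refine ⟨∑ i, ∑ j, ∫ w, ‖fourierReal (hψ i j).toLp w‖, fun i j u => ?_⟩
    refine (norm_le_integral_norm_fourierReal (hcij i j) (hψ i j) (hi0 i j) u).trans ?_
    refine (Finset.single_le_sum (f := fun j => ∫ w, ‖fourierReal (hψ i j).toLp w‖)
      (fun j _ => integral_nonneg fun _ => norm_nonneg _) (Finset.mem_univ j)).trans ?_
    exact Finset.single_le_sum (f := fun i => ∑ j, ∫ w, ‖fourierReal (hψ i j).toLp w‖)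
      (fun i _ => Finset.sum_nonneg fun j _ => integral_nonneg fun _ => norm_nonneg _)
      (Finset.mem_univ i)
  obtain ⟨θ, hθm, hθs, hθ⟩ := h.exists_factor_fourierMatrix hc hC hψ
  -- The diagonal of the factorization bounds `|θ i k|²` by `|ψ̂ i i|`. Hence integrability of `(1 +
  -- w²)|ψ̂ i i|` puts both `θ` and `w θ` in `L²`.
  have hle : ∀ i k, ∀ᵐ w, ‖θ i k w‖ ^ 2 ≤ ‖fourierReal (hψ i i).toLp w‖ := by
    intro i k
    filter_upwards [hθ] with w hw
    have h1 : ((∑ k, ‖θ i k w‖ ^ 2 : ℝ) : ℂ) = fourierReal (hψ i i).toLp w := by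
      refine Eq.trans ?_ (hw i i)
      push_cast
      exact Finset.sum_congr rfl fun k _ => (Complex.conj_mul' _).symm
    rw [← h1, Complex.norm_real, Real.norm_of_nonneg (Finset.sum_nonneg fun _ _ => sq_nonneg _)]
    exact Finset.single_le_sum (f := fun k => ‖θ i k w‖ ^ 2) (fun _ _ => sq_nonneg _)
      (Finset.mem_univ k)
  have hθ0 : ∀ i k, MemLp (θ i k) 2 := by
    intro i k
    rw [memLp_two_iff_integrable_sq_norm (hθm i k)]
    refine (hi0 i i).norm.mono' ((hθm i k).norm.pow 2) ?_
    filter_upwards [hle i k] with w hw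
    rwa [Real.norm_of_nonneg (sq_nonneg _)]
  have hθ1 : ∀ i k, MemLp (fun w : ℝ => (-2 * π * Complex.I * w) * θ i k w) 2 := by
    intro i k
    have hm : AEStronglyMeasurable (fun w : ℝ => (-2 * π * Complex.I * w) * θ i k w) :=
      (by fun_prop : Continuous fun w : ℝ => -2 * π * Complex.I * w).aestronglyMeasurable.mul
        (hθm i k)
    rw [memLp_two_iff_integrable_sq_norm hm]
    refine ((hi i i).const_mul ((2 * π) ^ 2)).mono' (hm.norm.pow 2) ?_
    filter_upwards [hle i k] with w hw
    rw [Real.norm_of_nonneg (sq_nonneg _)]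
    simp only [norm_mul, norm_neg, Complex.norm_I, Complex.norm_real, mul_pow, mul_one, Complex.norm_ofNat, Real.norm_eq_abs, sq_abs]
    calc 2 ^ 2 * π ^ 2 * w ^ 2 * ‖θ i k w‖ ^ 2
        ≤ 2 ^ 2 * π ^ 2 * (1 + w ^ 2) * ‖fourierReal (hψ i i).toLp w‖ := by
          gcongr
          linarith
      _ = _ := by ring
  choose σ hσ using fun i k => exists_fourierReal_eq (hθ0 i k) (hθs i k)
  choose κ hκ using fun i k => exists_fourierReal_eq (hθ1 i k) fun w => by
    simp [hθs, Complex.conj_ofNat]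
  refine ⟨fun i => WithLp.toLp 2 (σ i), fun i => WithLp.toLp 2 (κ i), fun t i j => ?_,
    fun i t₁ t₂ => shiftVec_sub_eq_integral (fun l => ?_) t₁ t₂⟩
  · have h1 := ofReal_eq_integral_fourierReal (hcij i j) (hψ i j) (hi0 i j) t
    rw [← Complex.ofReal_inj, h1, PiLp.inner_apply]
    rw [Complex.ofReal_sum]
    simp only [shiftVec_apply, ofReal_inner_eq_integral_fourierReal]
    have hint : ∀ k, Integrable fun w =>
        conj (fourierReal (shiftL2 t (σ i k)) w) * fourierReal (σ j k) w := fun k =>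
      (Lp.memLp (fourierReal (shiftL2 t (σ i k)))).star.integrable_mul
        (Lp.memLp (fourierReal (σ j k)))
    refine (integral_finsetSum _ fun k _ => hint k).symm.trans ?_
    refine integral_congr_ae ?_
    have h2 : ∀ᵐ w, ∀ k, fourierReal (shiftL2 t (σ i k)) w =
        Complex.exp (↑(-2 * π * t * w) * Complex.I) * fourierReal (σ i k) w :=
      ae_all_iff.2 fun k => fourierReal_shiftL2 t (σ i k)
    have h3 : ∀ᵐ w, ∀ i k, fourierReal (σ i k) w = θ i k w :=
      ae_all_iff.2 fun i => ae_all_iff.2 fun k => hσ i k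
    filter_upwards [h2, h3, hθ] with w h2 h3 h4
    simp only [h2, h3, map_mul, mul_assoc, ← Finset.mul_sum, h4]
    rw [← Complex.exp_conj, map_mul, Complex.conj_I, Complex.conj_ofReal]
    congr 2
    push_cast
    ring
  · filter_upwards [hσ i l, hκ i l] with w h1 h2
    exact h2.trans (by rw [← h1])

end SpectralFactor

end

/-! ### Convolutions, the resolvent and deterministic uniqueness -/

noncomputable section

open FourierTransform SchwartzMap Real
open scoped ComplexConjugate ContDiff

section Conv

/-- The convolution of two real functions on the line. -/
def conv (f g : ℝ → ℝ) (t : ℝ) : ℝ := ∫ s, f s * g (t - s)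

variable {f g : ℝ → ℝ}

lemma integrable_conv_integrand (hf : Integrable f) (hg : Integrable g) :
    Integrable (fun p : ℝ × ℝ => f p.2 * g (p.1 - p.2)) (volume.prod volume) :=
  hf.convolution_integrand (ContinuousLinearMap.mul ℝ ℝ) hg

lemma integrable_conv (hf : Integrable f) (hg : Integrable g) : Integrable (conv f g) :=
  hf.integrable_convolution (ContinuousLinearMap.mul ℝ ℝ) hg

lemma fourier_conv (hf : Integrable f) (hg : Integrable g) (w : ℝ) :
    𝓕 (fun t => (conv f g t : ℂ)) w = 𝓕 (fun t => (f t : ℂ)) w * 𝓕 (fun t => (g t : ℂ)) w := by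
  have hf' : Integrable fun t => (f t : ℂ) := hf.ofReal
  have hg' : Integrable fun t => (g t : ℂ) := hg.ofReal
  rw [← Real.fourier_mul_convolution_eq hf' hg' w]
  refine congrFun (congrArg _ (funext fun t => ?_)) w
  rw [conv, ← integral_complex_ofReal]
  simp only [Complex.ofReal_mul]
  rfl

lemma ae_eq_of_fourier_eq (hf : Integrable f) (hg : Integrable g)
    (h : ∀ w, 𝓕 (fun t => (f t : ℂ)) w = 𝓕 (fun t => (g t : ℂ)) w) : f =ᵐ[volume] g := by
  have h1 : (fun t => (f t : ℂ)) =ᵐ[volume] fun t => (g t : ℂ) := by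
    refine ae_eq_of_integral_schwartz_mul_eq hf.ofReal.locallyIntegrable
      hg.ofReal.locallyIntegrable fun k _ => ?_
    have h2 : 𝓕 ((𝓕⁻ k : 𝓢(ℝ, ℂ)) : ℝ → ℂ) = k := by
      rw [← fourier_coe, FourierTransform.fourier_fourierInv_eq]
    have h3 : ∀ {F : ℝ → ℂ}, Integrable F → ∫ x, k x * F x = ∫ x, (𝓕⁻ k : 𝓢(ℝ, ℂ)) x * 𝓕 F x := by
      intro F hF
      rw [← integral_fourier_mul_eq_of_integrable (𝓕⁻ k : 𝓢(ℝ, ℂ)).integrable hF, h2]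
    refine (h3 hf.ofReal).trans (Eq.trans ?_ (h3 hg.ofReal).symm)
    exact integral_congr_ae (.of_forall fun w => congrArg _ (h w))
  filter_upwards [h1] with t ht
  exact_mod_cast ht

/-- Associativity `(f * g) * v = f * (g * v)` at the point `T`, by Fubini, with `v` merely bounded
and measurable. -/
lemma integral_conv_mul (hf : Integrable f) (hg : Integrable g) {v : ℝ → ℝ} (hv : Measurable v)
    {C : ℝ} (hC : ∀ x, ‖v x‖ ≤ C) (T : ℝ) :
    ∫ y, conv f g y * v (T - y) = ∫ s, f s * ∫ x, g x * v (T - s - x) := by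
  have h1 : Integrable (fun p : ℝ × ℝ => f p.2 * g (p.1 - p.2) * v (T - p.1))
      (volume.prod volume) :=
    (integrable_conv_integrand hf hg).mul_bdd (c := C)
      (hv.comp (by fun_prop)).aestronglyMeasurable (.of_forall fun p => hC _)
  simp only [conv, ← integral_mul_const]
  rw [integral_integral_swap h1]
  refine integral_congr_ae (.of_forall fun s => ?_)
  simp only
  rw [← integral_const_mul, ← integral_sub_right_eq_self (fun x => f s * (g x * v (T - s - x))) s]
  refine integral_congr_ae (.of_forall fun y => ?_)
  simp only
  rw [show T - s - (y - s) = T - y by ring]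
  ring

lemma norm_integral_mul_le (hf : Integrable f) {v : ℝ → ℝ} {C : ℝ} (hC : ∀ x, ‖v x‖ ≤ C) :
    ‖∫ x, f x * v x‖ ≤ C * ∫ x, ‖f x‖ := by
  rw [← integral_const_mul]
  refine norm_integral_le_of_norm_le (hf.norm.const_mul C) (.of_forall fun x => ?_)
  rw [norm_mul, mul_comm]
  exact mul_le_mul_of_nonneg_right (hC x) (norm_nonneg _)

lemma continuous_integral_mul_sub (hf : Integrable f) {v : ℝ → ℝ} (hv : Continuous v) {C : ℝ}
    (hC : ∀ x, ‖v x‖ ≤ C) : Continuous fun t => ∫ x, f x * v (t - x) := by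
  refine continuous_of_dominated (bound := fun x => C * ‖f x‖) (fun t => ?_) (fun t => ?_)
    (hf.norm.const_mul C) (.of_forall fun x => by fun_prop)
  · exact hf.1.mul (hv.comp (by fun_prop)).aestronglyMeasurable
  · refine .of_forall fun x => ?_
    rw [norm_mul, mul_comm]
    exact mul_le_mul_of_nonneg_right (hC _) (norm_nonneg _)

end Conv

section Resolvent

variable {d : ℕ}

/-- The entries of a matrix function, cut off to `(0, ∞)`. -/
def causal (γ : ℝ → Matrix (Fin d) (Fin d) ℝ) (i j : Fin d) : ℝ → ℝ :=
  (Ioi 0).indicator fun t => γ t i j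

lemma MemL1Pos.integrable_causal {γ : ℝ → Matrix (Fin d) (Fin d) ℝ} (hγ : MemL1Pos γ)
    (i j : Fin d) : Integrable (causal γ i j) :=
  (integrable_indicator_iff measurableSet_Ioi).2 (hγ i j)

lemma causal_of_pos (γ : ℝ → Matrix (Fin d) (Fin d) ℝ) (i j : Fin d) {t : ℝ} (ht : 0 < t) :
    causal γ i j t = γ t i j := indicator_of_mem (mem_Ioi.2 ht) _

lemma causal_of_nonpos (γ : ℝ → Matrix (Fin d) (Fin d) ℝ) (i j : Fin d) {t : ℝ} (ht : t ≤ 0) :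
    causal γ i j t = 0 := indicator_of_notMem (by simpa using ht) _

lemma integral_causal_mul (γ : ℝ → Matrix (Fin d) (Fin d) ℝ) (i j : Fin d) (v : ℝ → ℝ) :
    ∫ t, causal γ i j t * v t = ∫ t in Ioi 0, γ t i j * v t := by
  rw [← integral_indicator measurableSet_Ioi]
  refine integral_congr_ae (.of_forall fun t => ?_)
  simp only [causal, indicator_apply]
  split_ifs <;> simp

lemma conv_causal_of_nonpos (r γ : ℝ → Matrix (Fin d) (Fin d) ℝ) (i j k l : Fin d) {t : ℝ}
    (ht : t ≤ 0) : conv (causal r i j) (causal γ k l) t = 0 := by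
  rw [conv, ← integral_zero ℝ ℝ]
  refine integral_congr_ae (.of_forall fun s => ?_)
  rcases le_or_gt s 0 with hs | hs
  · simp [causal_of_nonpos r i j hs]
  · simp [causal_of_nonpos γ k l (by linarith : t - s ≤ 0)]

variable {γ r : ℝ → Matrix (Fin d) (Fin d) ℝ}

namespace IsDifferentialResolvent

lemma continuousOn (hr : IsDifferentialResolvent 0 γ r) (i j : Fin d) :
    ContinuousOn (fun t => r t i j) (Ici 0) := fun t ht =>
  (hr.deriv t ht i j).continuousWithinAt

/-- Cutting both factors off to `(0, ∞)` turns the integral over `[0, t]` into a convolution on the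
whole line, up to end points. -/
lemma hasDerivAt (hr : IsDifferentialResolvent 0 γ r) (hγ : MemL1Pos γ) {t : ℝ} (ht : 0 < t)
    (i j : Fin d) : HasDerivAt (fun t => r t i j)
      (-∑ l, conv (causal r l j) (causal γ i l) t) t := by
  have h1 := (hr.deriv t ht.le i j).hasDerivAt (Ici_mem_nhds ht)
  have hint : ∀ l, IntegrableOn (fun s => γ (t - s) i l * r s l j) (Ioo 0 t) := by
    intro l
    have h2 : IntegrableOn (fun s => causal γ i l (t - s)) (Icc 0 t) :=
      ((hγ.integrable_causal i l).comp_sub_left t).integrableOn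
    have h3 := (h2.mul_continuousOn ((hr.continuousOn l j).mono Icc_subset_Ici_self)
      isCompact_Icc).mono_set Ioo_subset_Icc_self
    refine h3.congr_fun (fun s hs => ?_) measurableSet_Ioo
    simp only
    rw [causal_of_pos γ i l (by linarith [hs.2])]
  refine h1.congr_deriv ?_
  symm
  rw [Matrix.zero_mul, Matrix.zero_apply, neg_zero, zero_sub,
    intervalIntegral.integral_of_le ht.le, integral_Ioc_eq_integral_Ioo]
  simp only [Matrix.mul_apply]
  rw [integral_finsetSum _ fun l _ => hint l]
  congr 1
  refine Finset.sum_congr rfl fun l _ => ?_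
  rw [conv, ← integral_indicator measurableSet_Ioo]
  refine integral_congr_ae (.of_forall fun s => ?_)
  simp only
  by_cases hs : s ∈ Ioo 0 t
  · rw [indicator_of_mem hs, causal_of_pos r l j hs.1, causal_of_pos γ i l (by linarith [hs.2]),
      mul_comm]
  · rw [indicator_of_notMem hs]
    rcases le_or_gt s 0 with h0 | h0
    · rw [causal_of_nonpos r l j h0, zero_mul]
    · have : t ≤ s := not_lt.1 fun h => hs ⟨h0, h⟩
      rw [causal_of_nonpos γ i l (by linarith), mul_zero]

lemma integrable_sum_conv (hγ : MemL1Pos γ) (hr1 : MemL1Pos r) (i j : Fin d) :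
    Integrable fun t => ∑ l, conv (causal r l j) (causal γ i l) t :=
  integrable_finsetSum _ fun l _ =>
    integrable_conv (hr1.integrable_causal l j) (hγ.integrable_causal i l)

/-- Both `r` and its derivative are integrable on the half line. -/
lemma tendsto_zero (hr : IsDifferentialResolvent 0 γ r) (hγ : MemL1Pos γ) (hr1 : MemL1Pos r)
    (i j : Fin d) : Tendsto (fun t => r t i j) atTop (𝓝 0) :=
  tendsto_zero_of_hasDerivAt_of_integrableOn_Ioi (fun _ ht => hr.hasDerivAt hγ ht i j)
    (integrable_sum_conv hγ hr1 i j).neg.integrableOn (hr1 i j)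

/-- The derivative of `exp (-2πiwt) r(t)` is integrated over `(0, ∞)`; the identity matrix is the
boundary term from `r 0 = 1`. -/
lemma fourier_equation (hr : IsDifferentialResolvent 0 γ r) (hγ : MemL1Pos γ) (hr1 : MemL1Pos r)
    (i j : Fin d) (w : ℝ) :
    ∑ l, 𝓕 (fun t => (causal γ i l t : ℂ)) w * 𝓕 (fun t => (causal r l j t : ℂ)) w +
      (2 * π * Complex.I * w) * 𝓕 (fun t => (causal r i j t : ℂ)) w =
      (1 : Matrix (Fin d) (Fin d) ℂ) i j := by
  let e : ℝ → ℂ := fun t => Complex.exp (↑(-2 * π * t * w) * Complex.I)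
  have hem : Continuous e := by fun_prop
  have he : ∀ t, ‖e t‖ = 1 := fun t => Complex.norm_exp_ofReal_mul_I _
  have hed : ∀ t, HasDerivAt e (e t * (-2 * π * Complex.I * w)) t := by
    intro t
    have h1 : HasDerivAt (fun t : ℝ => (↑(-2 * π * t * w) * Complex.I : ℂ))
        (-2 * π * Complex.I * w) t := by
      have := ((hasDerivAt_id (t : ℂ)).const_mul (-2 * π * Complex.I * w : ℂ)).comp_ofReal
      rw [mul_one] at this
      refine this.congr_of_eventuallyEq (.of_forall fun t => ?_)
      simp only [id]
      push_cast
      ring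
    exact h1.cexp
  let c : ℝ → ℝ := fun t => ∑ l, conv (causal r l j) (causal γ i l) t
  have hc : Integrable c := integrable_sum_conv hγ hr1 i j
  have hmul : ∀ {F : ℝ → ℝ} {s : Set ℝ}, IntegrableOn F s → IntegrableOn (fun t => e t * (F t : ℂ)) s :=
    fun hF => Integrable.bdd_mul (c := 1) (Integrable.ofReal hF) hem.aestronglyMeasurable
      (.of_forall fun t => (he t).le)
  have h1 := integral_Ioi_of_hasDerivAt_of_tendsto (a := 0) (m := 0)
    (f := fun t => e t * (r t i j : ℂ))
    (f' := fun t => (-2 * π * Complex.I * w) * (e t * (r t i j : ℂ)) + e t * ((-c t : ℝ) : ℂ))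
    (hem.continuousWithinAt.mul
      (Complex.continuous_ofReal.continuousAt.comp_continuousWithinAt
        (hr.continuousOn i j 0 self_mem_Ici)))
    (fun t ht => by
      refine ((hed t).mul (hr.hasDerivAt hγ ht i j).ofReal_comp).congr_deriv ?_
      simp only [c]
      ring)
    (((hmul (hr1 i j)).const_mul _).add (hmul (F := fun t => -c t) hc.neg.integrableOn))
    (by
      have h2 := hr.tendsto_zero hγ hr1 i j
      rw [tendsto_zero_iff_norm_tendsto_zero] at h2 ⊢
      refine h2.congr fun t => ?_
      rw [norm_mul, he, one_mul, Complex.norm_real])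
  rw [integral_add ((hmul (hr1 i j)).const_mul _) (hmul (F := fun t => -c t) hc.neg.integrableOn),
    integral_const_mul] at h1
  have h3 : 𝓕 (fun t => (causal r i j t : ℂ)) w = ∫ t in Ioi 0, e t * (r t i j : ℂ) := by
    rw [fourier_real_eq_integral_exp_smul, ← integral_indicator measurableSet_Ioi]
    refine integral_congr_ae (.of_forall fun t => ?_)
    simp only [causal, indicator_apply]
    split_ifs <;> simp [e]
  have h4 : ∫ t in Ioi 0, e t * ((-c t : ℝ) : ℂ) =
      -∑ l, 𝓕 (fun t => (causal γ i l t : ℂ)) w * 𝓕 (fun t => (causal r l j t : ℂ)) w := by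
    rw [setIntegral_eq_integral_of_forall_compl_eq_zero]
    · have h5 : ∀ l, 𝓕 (fun t => (causal γ i l t : ℂ)) w * 𝓕 (fun t => (causal r l j t : ℂ)) w =
          ∫ t, e t * (conv (causal r l j) (causal γ i l) t : ℂ) := by
        intro l
        rw [mul_comm, ← fourier_conv (hr1.integrable_causal l j) (hγ.integrable_causal i l),
          fourier_real_eq_integral_exp_smul]
        rfl
      simp_rw [h5]
      have h6 : ∀ l, Integrable fun t => e t * (conv (causal r l j) (causal γ i l) t : ℂ) :=
        fun l => Integrable.bdd_mul (c := 1)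
          (integrable_conv (hr1.integrable_causal l j) (hγ.integrable_causal i l)).ofReal
          hem.aestronglyMeasurable (.of_forall fun t => (he t).le)
      rw [← integral_finsetSum _ fun l _ => h6 l, ← integral_neg]
      refine integral_congr_ae (.of_forall fun t => ?_)
      simp [c, Finset.mul_sum]
    · intro t ht
      have : c t = 0 := Finset.sum_eq_zero fun l _ =>
        conv_causal_of_nonpos r γ l j i l (not_lt.1 ht)
      simp [this]
  rw [← h3, h4] at h1
  have h7 : e 0 * (r 0 i j : ℂ) = (1 : Matrix (Fin d) (Fin d) ℂ) i j := by
    simp only [e, hr.init, Matrix.one_apply]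
    split_ifs <;> simp
  rw [h7] at h1
  linear_combination -h1

/-- The resolvent commutes with its kernel under convolution. -/
lemma sum_conv_comm (hr : IsDifferentialResolvent 0 γ r) (hγ : MemL1Pos γ) (hr1 : MemL1Pos r)
    (i j : Fin d) : (fun t => ∑ l, conv (causal r l j) (causal γ i l) t) =ᵐ[volume]
      fun t => ∑ l, conv (causal r i l) (causal γ l j) t := by
  refine ae_eq_of_fourier_eq (integrable_sum_conv hγ hr1 i j)
    (integrable_finsetSum _ fun l _ =>
      integrable_conv (hr1.integrable_causal i l) (hγ.integrable_causal l j)) fun w => ?_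
  have hsum : ∀ F : Fin d → ℝ → ℝ, (∀ l, Integrable (F l)) →
      𝓕 (fun t => ((∑ l, F l t : ℝ) : ℂ)) w = ∑ l, 𝓕 (fun t => (F l t : ℂ)) w := by
    intro F hF
    simp only [fourier_real_eq_integral_exp_smul, smul_eq_mul]
    have hF' : ∀ l, Integrable fun t => Complex.exp (↑(-2 * π * t * w) * Complex.I) * (F l t : ℂ) :=
      fun l => Integrable.bdd_mul (c := 1) (hF l).ofReal (by fun_prop)
        (.of_forall fun t => (Complex.norm_exp_ofReal_mul_I _).le)
    rw [← integral_finsetSum _ fun l _ => hF' l]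
    refine integral_congr_ae (.of_forall fun t => ?_)
    simp [Finset.mul_sum]
  rw [hsum _ fun l => integrable_conv (hr1.integrable_causal l j) (hγ.integrable_causal i l),
    hsum _ fun l => integrable_conv (hr1.integrable_causal i l) (hγ.integrable_causal l j)]
  simp_rw [fourier_conv (hr1.integrable_causal _ _) (hγ.integrable_causal _ _)]
  let K : Matrix (Fin d) (Fin d) ℂ := .of fun i j => 𝓕 (fun t => (causal γ i j t : ℂ)) w
  let R : Matrix (Fin d) (Fin d) ℂ := .of fun i j => 𝓕 (fun t => (causal r i j t : ℂ)) w
  have h1 : (K + (2 * π * Complex.I * w) • (1 : Matrix (Fin d) (Fin d) ℂ)) * R = 1 := by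
    ext i j
    rw [add_mul, Matrix.smul_mul, Matrix.one_mul, Matrix.add_apply, Matrix.mul_apply,
      Matrix.smul_apply, smul_eq_mul]
    exact hr.fourier_equation hγ hr1 i j w
  -- A right inverse of a square matrix is a left inverse. The scalar part `2πiw` commutes with `R`,
  -- so comparing the two products leaves `K * R = R * K`.
  have h2 := mul_eq_one_comm.1 h1
  have h3 : K * R = R * K := by
    rw [add_mul, Matrix.smul_mul, Matrix.one_mul] at h1
    rw [mul_add, Matrix.mul_smul, Matrix.mul_one] at h2
    exact add_right_cancel (h1.trans h2.symm)
  have h4 := congrFun (congrFun h3 i) j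
  rw [Matrix.mul_apply, Matrix.mul_apply] at h4
  exact (Finset.sum_congr rfl fun l _ => mul_comm _ _).trans h4

/-- A bounded solution on the whole line of the homogeneous equation vanishes. -/
lemma eq_zero_of_bounded (hr : IsDifferentialResolvent 0 γ r) (hγ : MemL1Pos γ) (hr1 : MemL1Pos r)
    {u : ℝ → Fin d → ℝ} {C : ℝ} (hC : ∀ t j, ‖u t j‖ ≤ C)
    (heq : ∀ t₁ t₂, t₁ ≤ t₂ → ∀ i,
      u t₂ i - u t₁ i = -∫ t in t₁..t₂, ∑ j, ∫ x, causal γ i j x * u (t - x) j) (T : ℝ) :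
    u T = 0 := by
  let m : Fin d → ℝ → ℝ := fun i t => ∑ j, ∫ x, causal γ i j x * u (t - x) j
  have hm : ∀ i t, ‖m i t‖ ≤ ∑ j, C * ∫ x, ‖causal γ i j x‖ := fun i t =>
    (norm_sum_le _ _).trans (Finset.sum_le_sum fun j _ =>
      norm_integral_mul_le (hγ.integrable_causal i j) fun x => hC (t - x) j)
  have heq' : ∀ t₁ t₂ i, u t₂ i - u t₁ i = -∫ t in t₁..t₂, m i t := by
    intro t₁ t₂ i
    rcases le_total t₁ t₂ with h | h
    · exact heq t₁ t₂ h i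
    · rw [intervalIntegral.integral_symm, ← heq t₂ t₁ h i]
      ring
  -- No regularity of `u` is assumed. The memory term `m` is bounded in any case, so `u` is
  -- Lipschitz, hence `m` is continuous and `u` is differentiable.
  have huc : ∀ i, Continuous fun t => u t i := by
    intro i
    obtain ⟨D, hD⟩ : ∃ D, ∀ t, ‖m i t‖ ≤ D := ⟨_, hm i⟩
    have hD0 : 0 ≤ D := (norm_nonneg _).trans (hD 0)
    refine (LipschitzWith.of_dist_le_mul (K := ⟨D, hD0⟩) fun s t => ?_).continuous
    rw [Real.dist_eq, Real.dist_eq, heq' t s i, abs_neg]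
    exact intervalIntegral.norm_integral_le_of_norm_le_const fun x _ => hD x
  have hmc : ∀ i, Continuous (m i) := fun i => continuous_finsetSum _ fun j _ =>
    continuous_integral_mul_sub (hγ.integrable_causal i j) (huc j) fun t => hC t j
  have hud : ∀ i t, HasDerivAt (fun t => u t i) (-m i t) t := by
    intro i t
    have h1 := intervalIntegral.integral_hasDerivAt_right ((hmc i).intervalIntegrable 0 t)
      ((hmc i).stronglyMeasurableAtFilter _ _) (hmc i).continuousAt
    refine (h1.neg.const_add (u 0 i)).congr_of_eventuallyEq (.of_forall fun s => ?_)
    simp only [Pi.neg_apply]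
    linarith [heq' 0 s i]
  have hud' : ∀ i s, HasDerivAt (fun s => u (T - s) i) (m i (T - s)) s := by
    intro i s
    have := (hud i (T - s)).comp_const_sub T s
    simpa using this
  funext i
  let c : Fin d → ℝ → ℝ := fun j t => ∑ l, conv (causal r l j) (causal γ i l) t
  have hcint : ∀ j, Integrable (c j) := fun j => integrable_sum_conv hγ hr1 i j
  have hc1 : ∀ j, Integrable fun s => c j s * u (T - s) j := fun j =>
    (hcint j).mul_bdd (c := C) ((huc j).comp (by fun_prop)).aestronglyMeasurable
      (.of_forall fun s => hC _ j)
  have hr2 : ∀ j, Integrable fun s => causal r i j s * m j (T - s) := fun j =>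
    (hr1.integrable_causal i j).mul_bdd ((hmc j).comp (by fun_prop)).aestronglyMeasurable
      (.of_forall fun s => hm j _)
  have hr3 : ∀ j, IntegrableOn (fun s => r s i j * m j (T - s)) (Ioi 0) := fun j =>
    ((hr2 j).integrableOn (s := Ioi 0)).congr_fun (fun s hs => by
      simp only; rw [causal_of_pos r i j hs]) measurableSet_Ioi
  have hint : ∀ j, IntegrableOn (fun s => -(c j s * u (T - s) j) + r s i j * m j (T - s)) (Ioi 0) :=
    fun j => (hc1 j).integrableOn.neg.add (hr3 j)
  -- The function `s ↦ ∑ j, r s i j * u (T - s) j` starts at `u T i` and tends to zero. After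
  -- commuting `γ * r` into `r * γ`, both halves of its derivative integrate to `±(r * γ * u)(T)`
  -- and cancel.
  have h1 := integral_Ioi_of_hasDerivAt_of_tendsto (a := 0) (m := 0)
    (f := fun s => ∑ j, r s i j * u (T - s) j)
    (f' := fun s => ∑ j, (-(c j s * u (T - s) j) + r s i j * m j (T - s)))
    (tendsto_finsetSum _ fun j _ => (hr.continuousOn i j 0 self_mem_Ici).mul
      ((huc j).comp (by fun_prop : Continuous fun s => T - s)).continuousWithinAt)
    (fun s hs => HasDerivAt.fun_sum fun j _ => by
      refine ((hr.hasDerivAt hγ hs i j).mul (hud' j s)).congr_deriv ?_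
      simp only [c]
      ring)
    (integrable_finsetSum _ fun j _ => hint j)
    (by
      rw [← Finset.sum_const_zero (s := (Finset.univ : Finset (Fin d)))]
      refine tendsto_finsetSum _ fun j _ => ?_
      refine (hr.tendsto_zero hγ hr1 i j).zero_mul_isBoundedUnder_le ?_
      exact ⟨C, by simpa using ⟨0, fun b _ => hC (T - b) j⟩⟩)
  rw [integral_finsetSum _ fun j _ => hint j] at h1
  have hadd : ∀ j, ∫ s in Ioi 0, (-(c j s * u (T - s) j) + r s i j * m j (T - s)) =
      -(∫ s in Ioi 0, c j s * u (T - s) j) + ∫ s in Ioi 0, r s i j * m j (T - s) := fun j => by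
    rw [← integral_neg]
    exact integral_add (hc1 j).integrableOn.neg (hr3 j)
  simp_rw [hadd] at h1
  have h2 : ∀ j, ∫ s in Ioi 0, c j s * u (T - s) j =
      ∑ l, ∫ s, causal r i l s * ∫ x, causal γ l j x * u (T - s - x) j := by
    intro j
    rw [setIntegral_eq_integral_of_forall_compl_eq_zero fun s hs => by
      rw [show c j s = 0 from Finset.sum_eq_zero fun l _ =>
        conv_causal_of_nonpos r γ l j i l (not_lt.1 hs), zero_mul]]
    have h3 : ∀ l, Integrable fun s => conv (causal r i l) (causal γ l j) s * u (T - s) j :=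
      fun l => (integrable_conv (hr1.integrable_causal i l) (hγ.integrable_causal l j)).mul_bdd
        (c := C) ((huc j).comp (by fun_prop)).aestronglyMeasurable (.of_forall fun s => hC _ j)
    simp_rw [← integral_conv_mul (hr1.integrable_causal i _) (hγ.integrable_causal _ j)
      (huc j).measurable (fun t => hC t j) T]
    rw [← integral_finsetSum _ fun l _ => h3 l]
    refine integral_congr_ae ?_
    filter_upwards [hr.sum_conv_comm hγ hr1 i j] with s hs
    simp only [c, hs, Finset.sum_mul]
  have h4 : ∀ j, ∫ s in Ioi 0, r s i j * m j (T - s) =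
      ∑ l, ∫ s, causal r i j s * ∫ x, causal γ j l x * u (T - s - x) l := by
    intro j
    rw [← integral_causal_mul]
    have h5 : ∀ l, Integrable fun s => causal r i j s * ∫ x, causal γ j l x * u (T - s - x) l :=
      fun l => (hr1.integrable_causal i j).mul_bdd
        ((continuous_integral_mul_sub (hγ.integrable_causal j l) (huc l)
          fun t => hC t l).comp (by fun_prop : Continuous fun s => T - s)).aestronglyMeasurable
        (.of_forall fun s => norm_integral_mul_le (hγ.integrable_causal j l) fun x => hC _ l)
    rw [← integral_finsetSum _ fun l _ => h5 l]
    simp only [m, Finset.mul_sum]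
  simp_rw [h2, h4] at h1
  rw [Finset.sum_add_distrib, Finset.sum_neg_distrib, Finset.sum_comm, neg_add_cancel] at h1
  simp only [hr.init, Matrix.one_apply, sub_zero, ite_mul, one_mul, zero_mul, Finset.sum_ite_eq,
    Finset.mem_univ, if_true, zero_sub] at h1
  rw [Pi.zero_apply]
  linarith

end IsDifferentialResolvent

end Resolvent

end

/-! ### The memory term as a measurable process -/

noncomputable section

section Memory

variable {d : ℕ} {Ω : Type*} {γ : ℝ → Matrix (Fin d) (Fin d) ℝ}
  {k : Fin d → Fin d → ℝ → ℝ} {V : ℝ → Ω → Fin d → ℝ}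

/-- The integrand of the memory term after the substitution `s = t - x`. -/
def memoryIntegrand (k : Fin d → Fin d → ℝ → ℝ) (V : ℝ → Ω → Fin d → ℝ) (t : ℝ) (ω : Ω) (x : ℝ) :
    Fin d → ℝ := fun i => ∑ j, k i j x * V (t - x) ω j

/-- The kernel functions `k i j` are integrable and measurable and agree almost everywhere with
the causal part of `γ`. -/
structure IsKernelVersion (γ : ℝ → Matrix (Fin d) (Fin d) ℝ) (k : Fin d → Fin d → ℝ → ℝ) :
    Prop where
  integrable : ∀ i j, Integrable (k i j)
  measurable : ∀ i j, Measurable (k i j)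
  ae_eq : ∀ i j, k i j =ᵐ[volume] causal γ i j

/-- The kernel is only almost everywhere strongly measurable; joint measurability of the memory term
in `(t, ω)` calls for a measurable representative. -/
lemma MemL1Pos.exists_isKernelVersion (hγ : MemL1Pos γ) :
    ∃ k : Fin d → Fin d → ℝ → ℝ, IsKernelVersion γ k :=
  ⟨fun i j => (hγ.integrable_causal i j).1.mk _,
    fun i j => (hγ.integrable_causal i j).congr (hγ.integrable_causal i j).1.ae_eq_mk,
    fun i j => (hγ.integrable_causal i j).1.stronglyMeasurable_mk.measurable,
    fun i j => (hγ.integrable_causal i j).1.ae_eq_mk.symm⟩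

namespace IsKernelVersion

lemma indicator_ae_eq (hk : IsKernelVersion γ k) (V : ℝ → Ω → Fin d → ℝ) (ω : Ω) (t : ℝ) :
    (fun x => (Iic t).indicator (fun s => γ (t - s) *ᵥ V s ω) (t - x)) =ᵐ[volume]
      memoryIntegrand k V t ω := by
  have h1 : ∀ᵐ x, ∀ i j, k i j x = causal γ i j x :=
    ae_all_iff.2 fun i => ae_all_iff.2 fun j => hk.ae_eq i j
  -- At `x = 0` the two sides may differ: `Iic t` contains its end point, while the causal kernel
  -- vanishes at `0`.
  have h2 : ∀ᵐ x : ℝ, x ≠ 0 := Measure.ae_ne volume 0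
  filter_upwards [h1, h2] with x hx hx0
  funext i
  simp only [memoryIntegrand, hx]
  rcases lt_or_gt_of_ne hx0 with h | h
  · rw [indicator_of_notMem (by simpa using h)]
    simp [causal_of_nonpos γ _ _ h.le]
  · rw [indicator_of_mem (by simpa using h.le)]
    simp [mulVec, dotProduct, causal_of_pos γ _ _ h]

lemma integrableOn_iff (hk : IsKernelVersion γ k) (ω : Ω) (t : ℝ) :
    IntegrableOn (fun s => γ (t - s) *ᵥ V s ω) (Iic t) volume ↔
      Integrable (memoryIntegrand k V t ω) := by
  rw [← integrable_indicator_iff measurableSet_Iic, ← integrable_comp_sub_left _ t]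
  exact integrable_congr (hk.indicator_ae_eq V ω t)

lemma memoryTerm_eq (hk : IsKernelVersion γ k) (ω : Ω) (t : ℝ) : memoryTerm γ V ω t = ∫ x, memoryIntegrand k V t ω x := by
  rw [memoryTerm, ← integral_indicator measurableSet_Iic, ← integral_sub_left_eq_self _ _ t]
  exact integral_congr_ae (hk.indicator_ae_eq V ω t)

lemma memoryTerm_apply (hk : IsKernelVersion γ k) {ω : Ω} {t : ℝ}
    (h : ∀ i j, Integrable fun x => k i j x * V (t - x) ω j) :
    IntegrableOn (fun s => γ (t - s) *ᵥ V s ω) (Iic t) volume ∧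
      ∀ i, memoryTerm γ V ω t i = ∑ j, ∫ x, k i j x * V (t - x) ω j := by
  have h1 : Integrable (memoryIntegrand k V t ω) :=
    Integrable.of_eval fun i => integrable_finsetSum _ fun j _ => h i j
  refine ⟨(hk.integrableOn_iff ω t).2 h1, fun i => ?_⟩
  rw [hk.memoryTerm_eq, eval_integral fun i => h1.eval i]
  exact integral_finsetSum _ fun j _ => h i j

variable [MeasurableSpace Ω]

lemma measurable_memoryIntegrand (hk : IsKernelVersion γ k) (hV : Measurable (Function.uncurry V)) :
    Measurable fun p : (ℝ × Ω) × ℝ => memoryIntegrand k V p.1.1 p.1.2 p.2 := by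
  refine measurable_pi_lambda _ fun i => Finset.measurable_sum _ fun j _ => ?_
  refine ((hk.measurable i j).comp measurable_snd).mul ((measurable_pi_apply j).comp ?_)
  exact hV.comp (((measurable_fst.comp measurable_fst).sub measurable_snd).prodMk
    (measurable_snd.comp measurable_fst))

lemma measurable_memoryTerm (hk : IsKernelVersion γ k) (hV : Measurable (Function.uncurry V)) :
    Measurable (Function.uncurry fun t ω => memoryTerm γ V ω t) := by
  have h1 := (hk.measurable_memoryIntegrand hV).stronglyMeasurable.integral_prod_right'
    (ν := (volume : Measure ℝ))
  convert h1.measurable using 1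
  ext1 p
  exact hk.memoryTerm_eq p.2 p.1

lemma measurableSet_integrableOn (hk : IsKernelVersion γ k) (hV : Measurable (Function.uncurry V)) :
    MeasurableSet {p : ℝ × Ω | IntegrableOn (fun s => γ (p.1 - s) *ᵥ V s p.2) (Iic p.1) volume} := by
  simp only [hk.integrableOn_iff]
  exact measurableSet_integrable (f := fun (p : ℝ × Ω) x => memoryIntegrand k V p.1 p.2 x)
    (hk.measurable_memoryIntegrand hV).stronglyMeasurable

variable {P : Measure Ω} {C : ℝ≥0}

lemma lintegral_enorm_mul_le {X Z : Ω → ℝ} (hZ : MemLp Z 2 P) (hX : Measurable X)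
    (hC : eLpNorm X 2 P ≤ C) : ∫⁻ ω, ‖Z ω * X ω‖ₑ ∂P ≤ ((eLpNorm Z 2 P).toNNReal * C : ℝ≥0) := by
  refine (lintegral_enorm_mul_le_of_eLpNorm_le hZ.1 hX.aestronglyMeasurable).trans ?_
  rw [ENNReal.coe_mul, ENNReal.coe_toNNReal hZ.2.ne]
  gcongr

variable [IsProbabilityMeasure P]

lemma integrable_prod (hk : IsKernelVersion γ k) (hV : Measurable (Function.uncurry V))
    (hC : ∀ t j, eLpNorm (fun ω => V t ω j) 2 P ≤ C) {Z : Ω → ℝ} (hZ : MemLp Z 2 P) (t : ℝ)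
    (i j : Fin d) :
    Integrable (fun p : ℝ × Ω => Z p.2 * (k i j p.1 * V (t - p.1) p.2 j)) (volume.prod P) := by
  have hm : Measurable (Function.uncurry fun x ω => V (t - x) ω j) :=
    (measurable_pi_apply j).comp (hV.comp (by fun_prop : Measurable fun p : ℝ × Ω => (t - p.1, p.2)))
  exact integrable_prod_weight (C := (eLpNorm Z 2 P).toNNReal * C) (hk.integrable i j) hm hZ.1
    fun x => lintegral_enorm_mul_le hZ hm.of_uncurry_left (hC _ j)

lemma ae_integrable (hk : IsKernelVersion γ k) (hV : Measurable (Function.uncurry V))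
    (hC : ∀ t j, eLpNorm (fun ω => V t ω j) 2 P ≤ C) (t : ℝ) :
    ∀ᵐ ω ∂P, ∀ i j, Integrable fun x => k i j x * V (t - x) ω j := by
  refine ae_all_iff.2 fun i => ae_all_iff.2 fun j => ?_
  have := (hk.integrable_prod hV hC (memLp_const (1 : ℝ)) t i j).prod_left_ae
  simpa only [one_mul] using this

/-- For each fixed `t` integrability holds almost surely; Fubini exchanges the two quantifiers, as
the set of good pairs `(t, ω)` is measurable. -/
lemma ae_memory_integrable (hk : IsKernelVersion γ k) (hV : Measurable (Function.uncurry V))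
    (hC : ∀ t j, eLpNorm (fun ω => V t ω j) 2 P ≤ C) :
    ∀ᵐ ω ∂P, ∀ᵐ t, IntegrableOn (fun s => γ (t - s) *ᵥ V s ω) (Iic t) volume := by
  rw [← Measure.ae_ae_comm (hk.measurableSet_integrableOn hV)]
  refine .of_forall fun t => ?_
  filter_upwards [hk.ae_integrable hV hC t] with ω hω
  exact (hk.memoryTerm_apply hω).1

lemma integral_mul_memoryTerm (hk : IsKernelVersion γ k) (hV : Measurable (Function.uncurry V))
    (hC : ∀ t j, eLpNorm (fun ω => V t ω j) 2 P ≤ C) {Z : Ω → ℝ} (hZ : MemLp Z 2 P) (t : ℝ)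
    (i : Fin d) : ∫ ω, Z ω * memoryTerm γ V ω t i ∂P =
      ∑ j, ∫ x, k i j x * ∫ ω, Z ω * V (t - x) ω j ∂P := by
  have h1 : ∀ j, Integrable (fun ω => Z ω * ∫ x, k i j x * V (t - x) ω j) P := by
    intro j
    have := (hk.integrable_prod hV hC hZ t i j).integral_prod_right
    simpa only [integral_const_mul] using this
  calc ∫ ω, Z ω * memoryTerm γ V ω t i ∂P
      = ∫ ω, ∑ j, Z ω * (∫ x, k i j x * V (t - x) ω j) ∂P := by
        refine integral_congr_ae ?_
        filter_upwards [hk.ae_integrable hV hC t] with ω hω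
        rw [(hk.memoryTerm_apply hω).2 i, Finset.mul_sum]
    _ = ∑ j, ∫ ω, Z ω * (∫ x, k i j x * V (t - x) ω j) ∂P := integral_finsetSum _ fun j _ => h1 j
    _ = _ := Finset.sum_congr rfl fun j _ =>
        integral_mul_weight_integral (hk.integrable_prod hV hC hZ t i j)

/-- Uniformity in `t` is what allows Fubini for the memory term on `[t₁, t₂] × Ω`. -/
lemma exists_lintegral_memoryTerm_le (hk : IsKernelVersion γ k) (hV : Measurable (Function.uncurry V))
    (hC : ∀ t j, eLpNorm (fun ω => V t ω j) 2 P ≤ C) {Z : Ω → ℝ} (hZ : MemLp Z 2 P) (i : Fin d) :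
    ∃ D : ℝ≥0, ∀ t, ∫⁻ ω, ‖Z ω * memoryTerm γ V ω t i‖ₑ ∂P ≤ D := by
  set B : ℝ≥0 := (eLpNorm Z 2 P).toNNReal * C with hB
  have hfin : ∑ j, (∫⁻ x, ‖k i j x‖ₑ) * B ≠ ∞ := (ENNReal.sum_lt_top.2 fun j _ =>
    ENNReal.mul_lt_top (hk.integrable i j).2 (by simp)).ne
  refine ⟨(∑ j, (∫⁻ x, ‖k i j x‖ₑ) * B).toNNReal, fun t => ?_⟩
  rw [ENNReal.coe_toNNReal hfin]
  have hm : ∀ j, AEMeasurable (fun p : ℝ × Ω => ‖Z p.2 * (k i j p.1 * V (t - p.1) p.2 j)‖ₑ)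
      (volume.prod P) := fun j => (hk.integrable_prod hV hC hZ t i j).1.enorm
  calc ∫⁻ ω, ‖Z ω * memoryTerm γ V ω t i‖ₑ ∂P
      ≤ ∫⁻ ω, ∑ j, (∫⁻ x, ‖Z ω * (k i j x * V (t - x) ω j)‖ₑ) ∂P := by
        refine lintegral_mono_ae ?_
        filter_upwards [hk.ae_integrable hV hC t] with ω hω
        rw [(hk.memoryTerm_apply hω).2 i, Finset.mul_sum]
        refine (enorm_sum_le _ _).trans (Finset.sum_le_sum fun j _ => ?_)
        rw [← integral_const_mul]
        exact enorm_integral_le_lintegral_enorm _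
    _ = ∑ j, ∫⁻ ω, (∫⁻ x, ‖Z ω * (k i j x * V (t - x) ω j)‖ₑ) ∂P :=
        lintegral_finsetSum' _ fun j _ => (hm j).lintegral_prod_left'
    _ ≤ ∑ j, (∫⁻ x, ‖k i j x‖ₑ) * B := by
        refine Finset.sum_le_sum fun j _ => ?_
        rw [lintegral_lintegral_swap (hm j).prod_swap, ← lintegral_mul_const' _ _ (by simp)]
        refine lintegral_mono fun x => ?_
        have h1 : ∀ ω, ‖Z ω * (k i j x * V (t - x) ω j)‖ₑ =
            ‖k i j x‖ₑ * ‖Z ω * V (t - x) ω j‖ₑ := fun ω => by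
          rw [← enorm_mul]; congr 1; ring
        simp only [h1]
        rw [lintegral_const_mul' _ _ (by simp)]
        gcongr
        exact lintegral_enorm_mul_le hZ
          ((measurable_pi_apply j).comp hV.of_uncurry_left) (hC _ j)

end IsKernelVersion

end Memory

end

/-! ### Uniqueness through mixed moments -/

noncomputable section

section Uniqueness

variable {d : ℕ} {Ω : Type*} [MeasurableSpace Ω] {P : Measure Ω}
  {γ : ℝ → Matrix (Fin d) (Fin d) ℝ} {k : Fin d → Fin d → ℝ → ℝ} {F V : ℝ → Ω → Fin d → ℝ}

lemma intervalIntegral_apply {f : ℝ → Fin d → ℝ} {a b : ℝ} (hf : IntervalIntegrable f volume a b)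
    (i : Fin d) : (∫ t in a..b, f t) i = ∫ t in a..b, f t i :=
  ((ContinuousLinearMap.proj (R := ℝ) (φ := fun _ : Fin d => ℝ) i).intervalIntegral_comp_comm
    hf).symm

lemma IsBoundedStrongSolution.exists_eLpNorm_le
    (hV : IsBoundedStrongSolution 0 γ F V P) :
    ∃ C : ℝ≥0, ∀ t j, eLpNorm (fun ω => V t ω j) 2 P ≤ C := by
  obtain ⟨C, hC⟩ := hV.bounded
  exact ⟨C, fun t j => (eLpNorm_mono fun ω => norm_le_pi_norm _ j).trans (hC t)⟩

variable [IsProbabilityMeasure P]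

/-- The mixed moments of a bounded strong solution with a square integrable random variable solve
the deterministic integrated equation. -/
lemma IsBoundedStrongSolution.mixed_moment_equation (hk : IsKernelVersion γ k)
    (hV : IsBoundedStrongSolution 0 γ F V P) {Z : Ω → ℝ} (hZ : MemLp Z 2 P) :
    (∃ B, ∀ t j, ‖∫ ω, Z ω * V t ω j ∂P‖ ≤ B) ∧
    (∀ t i j, Integrable fun x => k i j x * ∫ ω, Z ω * V (t - x) ω j ∂P) ∧
    ∀ t₁ t₂, t₁ ≤ t₂ → ∀ i,
      IntervalIntegrable (fun t => ∑ j, ∫ x, k i j x * ∫ ω, Z ω * V (t - x) ω j ∂P) volume t₁ t₂ ∧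
      (∫ ω, Z ω * V t₂ ω i ∂P) - (∫ ω, Z ω * V t₁ ω i ∂P) =
        -(∫ t in t₁..t₂, ∑ j, ∫ x, k i j x * ∫ ω, Z ω * V (t - x) ω j ∂P) +
          ∫ ω, Z ω * (∫ t in t₁..t₂, F t ω) i ∂P := by
  obtain ⟨C, hC⟩ := hV.exists_eLpNorm_le
  have hVm : ∀ t j, Measurable fun ω => V t ω j := fun t j =>
    (measurable_pi_apply j).comp hV.meas.of_uncurry_left
  have hV2 : ∀ t j, MemLp (fun ω => V t ω j) 2 P := fun t j =>
    ⟨(hVm t j).aestronglyMeasurable, (hC t j).trans_lt ENNReal.coe_lt_top⟩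
  have hZV : ∀ t j, Integrable (fun ω => Z ω * V t ω j) P := fun t j => hZ.integrable_mul (hV2 t j)
  refine ⟨⟨((eLpNorm Z 2 P).toNNReal * C : ℝ≥0), fun t j => ?_⟩, fun t i j => ?_, fun t₁ t₂ h i => ?_⟩
  · have h1 := (enorm_integral_le_lintegral_enorm _).trans
      (IsKernelVersion.lintegral_enorm_mul_le hZ (hVm t j) (hC t j))
    rw [enorm_eq_nnnorm] at h1
    exact_mod_cast h1
  · have := (hk.integrable_prod hV.meas hC hZ t i j).integral_prod_left
    refine this.congr (.of_forall fun x => ?_)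
    simp only
    rw [← integral_const_mul]
    exact integral_congr_ae (.of_forall fun ω => by simp only; ring)
  · obtain ⟨D, hD⟩ := hk.exists_lintegral_memoryTerm_le hV.meas hC hZ i
    have hmm : Measurable (Function.uncurry fun t ω => memoryTerm γ V ω t i) :=
      (measurable_pi_apply i).comp (hk.measurable_memoryTerm hV.meas)
    have hprod := integrable_prod_weight (μ := volume.restrict (Ioc t₁ t₂)) (k := fun _ => (1 : ℝ))
      (integrable_const 1) hmm hZ.1 hD
    have h1 := integral_mul_weight_integral (k := fun _ => (1 : ℝ))
      (X := fun t ω => memoryTerm γ V ω t i) hprod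
    have h2 := hprod.integral_prod_left
    have h3 := hprod.integral_prod_right
    simp only [one_mul, integral_const_mul] at h1 h2 h3
    simp_rw [hk.integral_mul_memoryTerm hV.meas hC hZ] at h1 h2
    rw [← intervalIntegral.integral_of_le h] at h1
    refine ⟨(intervalIntegrable_iff_integrableOn_Ioc_of_le h).2 h2, ?_⟩
    -- Nothing is assumed about moments of the integrated forcing, so it is expressed through the
    -- other terms of the equation, which are integrable against `Z`.
    have h4 : ∫ ω, Z ω * (∫ t in t₁..t₂, F t ω) i ∂P = ∫ ω, (Z ω * V t₂ ω i - Z ω * V t₁ ω i) +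
        Z ω * (∫ t in Ioc t₁ t₂, memoryTerm γ V ω t i) ∂P := by
      refine integral_congr_ae ?_
      filter_upwards [hV.eq t₁ t₂ h, hV.integrable t₁ t₂ h] with ω h5 h6
      have h7 := congrFun h5 i
      simp only [Pi.sub_apply, Pi.add_apply, Matrix.zero_mulVec, neg_zero, zero_sub, Pi.neg_apply,
        intervalIntegral_apply h6.2.1] at h7
      rw [intervalIntegral.integral_of_le h] at h7
      linear_combination -Z ω * h7
    have h5 : Integrable (fun ω => Z ω * V t₂ ω i - Z ω * V t₁ ω i) P := (hZV t₂ i).sub (hZV t₁ i)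
    rw [h4, integral_add h5 h3, integral_sub (hZV t₂ i) (hZV t₁ i), h1]
    ring

/-- Mean-square bounded strong solutions are unique up to modification. -/
lemma IsBoundedStrongSolution.ae_eq {r : ℝ → Matrix (Fin d) (Fin d) ℝ}
    (hr : IsDifferentialResolvent 0 γ r) (hγ : MemL1Pos γ) (hr1 : MemL1Pos r)
    {V' : ℝ → Ω → Fin d → ℝ} (hV' : IsBoundedStrongSolution 0 γ F V' P)
    (hV : IsBoundedStrongSolution 0 γ F V P) (t : ℝ) : V' t =ᵐ[P] V t := by
  obtain ⟨k, hk⟩ := hγ.exists_isKernelVersion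
  have hmem : ∀ {U : ℝ → Ω → Fin d → ℝ}, IsBoundedStrongSolution 0 γ F U P →
      ∀ t j, MemLp (fun ω => U t ω j) 2 P := fun hU t j => by
    obtain ⟨C, hC⟩ := hU.exists_eLpNorm_le
    exact ⟨((measurable_pi_apply j).comp hU.meas.of_uncurry_left).aestronglyMeasurable,
      (hC t j).trans_lt ENNReal.coe_lt_top⟩
  -- The forcing terms cancel in the difference of the mixed moments, which is therefore a bounded
  -- solution of the homogeneous equation.
  have key : ∀ Z : Ω → ℝ, MemLp Z 2 P → ∀ t j,
      ∫ ω, Z ω * V' t ω j ∂P = ∫ ω, Z ω * V t ω j ∂P := by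
    intro Z hZ
    obtain ⟨⟨B', hB'⟩, hi', he'⟩ := hV'.mixed_moment_equation hk hZ
    obtain ⟨⟨B, hB⟩, hi, he⟩ := hV.mixed_moment_equation hk hZ
    have h0 := hr.eq_zero_of_bounded hγ hr1 (C := B' + B)
      (u := fun t j => (∫ ω, Z ω * V' t ω j ∂P) - ∫ ω, Z ω * V t ω j ∂P)
      (fun t j => (norm_sub_le _ _).trans (add_le_add (hB' t j) (hB t j)))
      (fun t₁ t₂ h i => by
        have h1 : ∀ t, ∑ j, ∫ x, causal γ i j x *
            ((∫ ω, Z ω * V' (t - x) ω j ∂P) - ∫ ω, Z ω * V (t - x) ω j ∂P) =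
            (∑ j, ∫ x, k i j x * ∫ ω, Z ω * V' (t - x) ω j ∂P) -
              ∑ j, ∫ x, k i j x * ∫ ω, Z ω * V (t - x) ω j ∂P := by
          intro t
          rw [← Finset.sum_sub_distrib]
          refine Finset.sum_congr rfl fun j _ => ?_
          rw [← integral_sub (hi' t i j) (hi t i j)]
          refine integral_congr_ae ?_
          filter_upwards [hk.ae_eq i j] with x hx
          rw [hx]
          ring
        simp_rw [h1]
        rw [intervalIntegral.integral_sub (he' t₁ t₂ h i).1 (he t₁ t₂ h i).1]
        linarith [(he' t₁ t₂ h i).2, (he t₁ t₂ h i).2])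
    intro t j
    have := congrFun (h0 t) j
    exact sub_eq_zero.1 this
  have h2 : ∀ j, (fun ω => V' t ω j - V t ω j) =ᵐ[P] 0 := by
    intro j
    have hD : MemLp (fun ω => V' t ω j - V t ω j) 2 P := (hmem hV' t j).sub (hmem hV t j)
    -- Choosing `Z` as the difference of the two solutions at time `t` makes its second moment
    -- vanish.
    have h3 := key _ hD t j
    have h4 : ∫ ω, (V' t ω j - V t ω j) ^ 2 ∂P = 0 := by
      have h5 : ∀ {U : ℝ → Ω → Fin d → ℝ}, IsBoundedStrongSolution 0 γ F U P →
          Integrable (fun ω => (V' t ω j - V t ω j) * U t ω j) P := fun hU =>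
        hD.integrable_mul (hmem hU t j)
      rw [← sub_eq_zero, ← integral_sub (h5 hV') (h5 hV)] at h3
      refine (integral_congr_ae (.of_forall fun ω => ?_)).trans h3
      ring
    rw [integral_eq_zero_iff_of_nonneg (fun ω => sq_nonneg _) hD.integrable_sq] at h4
    filter_upwards [h4] with ω hω
    exact pow_eq_zero_iff two_ne_zero |>.1 hω
  filter_upwards [ae_all_iff.2 h2] with ω hω
  funext j
  exact sub_eq_zero.1 (hω j)

end Uniqueness

/-! ### Solutions from stationary families -/

section Existence

variable {d : ℕ} {Ω : Type*} [MeasurableSpace Ω] {P : Measure Ω} [IsProbabilityMeasure P]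
  {γ : ℝ → Matrix (Fin d) (Fin d) ℝ} {k : Fin d → Fin d → ℝ → ℝ} {F V : ℝ → Ω → Fin d → ℝ}
  {J : L2Vec d →ₗᵢ[ℝ] Lp ℝ 2 P}

/-- The memory term of the stationary family `t ↦ shiftVec t σ` at time `0`. -/
def memoryVector (k : Fin d → Fin d → ℝ → ℝ) (σ : Fin d → L2Vec d) (i : Fin d) : L2Vec d :=
  ∑ j, ∫ x, k i j x • shiftVec (-x) (σ j)

lemma integrable_smul_shiftVec {f : ℝ → ℝ} (hf : Integrable f) (h : L2Vec d) {g : ℝ → ℝ}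
    (hg : Continuous g) : Integrable fun x => f x • shiftVec (g x) h :=
  hf.smul_bdd ‖h‖ ((continuous_shiftVec h).comp hg).aestronglyMeasurable
    (.of_forall fun x => by simp)

lemma ae_intervalIntegral_eq {X : ℝ → Ω → ℝ} (hX : Measurable (Function.uncurry X)) {h : L2Vec d}
    (hXh : ∀ t, X t =ᵐ[P] J (shiftVec t h)) {t₁ t₂ : ℝ} (ht : t₁ ≤ t₂) :
    (∀ᵐ ω ∂P, IntervalIntegrable (fun t => X t ω) volume t₁ t₂) ∧
    (fun ω => ∫ t in t₁..t₂, X t ω) =ᵐ[P] J (∫ t in t₁..t₂, shiftVec t h) := by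
  have h1 := ae_integrable_weight_and_integral_ae_eq (μ := volume.restrict (Ioc t₁ t₂))
    (k := fun _ => (1 : ℝ)) (integrable_const 1) hX hXh (C := ‖h‖₊) (fun s => by simp)
    (by
      have h2 := (J.continuous.comp (continuous_shiftVec h)).intervalIntegrable (μ := volume) t₁ t₂
      simp only [one_smul]
      exact (intervalIntegrable_iff_integrableOn_Ioc_of_le ht).1 h2)
  simp only [one_mul, one_smul] at h1
  refine ⟨?_, ?_⟩
  · filter_upwards [h1.1] with ω hω
    exact (intervalIntegrable_iff_integrableOn_Ioc_of_le ht).2 hω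
  · have h3 := J.intervalIntegral_comp_comm (a := t₁) (b := t₂) (μ := volume)
      fun t => shiftVec t h
    rw [← h3]
    simp only [intervalIntegral.integral_of_le ht]
    exact h1.2

/-- The bounded operator `J ∘ shiftVec t` passes through the Bochner integral defining
`memoryVector`, so the memory term of a stationary curve is again a stationary curve. -/
lemma IsKernelVersion.memoryTerm_ae_eq (hk : IsKernelVersion γ k) {σ : Fin d → L2Vec d}
    (hV : Measurable (Function.uncurry V))
    (hVσ : ∀ t j, (fun ω => V t ω j) =ᵐ[P] J (shiftVec t (σ j))) (t : ℝ) (i : Fin d) :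
    (fun ω => memoryTerm γ V ω t i) =ᵐ[P] J (shiftVec t (memoryVector k σ i)) := by
  have h1 : ∀ i j, (∀ᵐ ω ∂P, Integrable fun x => k i j x * V (t - x) ω j) ∧
      (fun ω => ∫ x, k i j x * V (t - x) ω j) =ᵐ[P]
        J (shiftVec t (∫ x, k i j x • shiftVec (-x) (σ j))) := by
    intro i j
    have h2 := ae_integrable_weight_and_integral_ae_eq (P := P) (hk.integrable i j)
      (X := fun x ω => V (t - x) ω j) ((measurable_pi_apply j).comp
        (hV.comp (by fun_prop : Measurable fun p : ℝ × Ω => (t - p.1, p.2))))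
      (Y := fun x => J (shiftVec (t - x) (σ j))) (fun x => hVσ (t - x) j) (C := ‖σ j‖₊)
      (fun x => by simp)
      (by
        have := J.toContinuousLinearMap.integrable_comp
          (integrable_smul_shiftVec (hk.integrable i j) (σ j) (by fun_prop : Continuous fun x => t - x))
        simpa using this)
    have h3 := ((J.comp (shiftVec t)).toContinuousLinearMap).integral_comp_comm
      (integrable_smul_shiftVec (hk.integrable i j) (σ j) continuous_neg)
    simp only [map_smul, LinearIsometry.coe_toContinuousLinearMap, LinearIsometry.coe_comp,
      Function.comp_apply, ← shiftVec_add, ← sub_eq_add_neg] at h3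
    rw [h3] at h2
    exact h2
  have h4 : ∀ᵐ ω ∂P, ∀ i j, Integrable fun x => k i j x * V (t - x) ω j :=
    ae_all_iff.2 fun i => ae_all_iff.2 fun j => (h1 i j).1
  have h5 : ∀ᵐ ω ∂P, ∀ j, ∫ x, k i j x * V (t - x) ω j =
      J (shiftVec t (∫ x, k i j x • shiftVec (-x) (σ j))) ω :=
    ae_all_iff.2 fun j => (h1 i j).2
  rw [memoryVector, map_sum, map_sum]
  filter_upwards [h4, h5, Lp.coeFn_finsetSum Finset.univ fun j =>
    J (shiftVec t (∫ x, k i j x • shiftVec (-x) (σ j)))] with ω h4 h5 h6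
  rw [(hk.memoryTerm_apply h4).2 i, h6, Finset.sum_apply]
  exact Finset.sum_congr rfl fun j _ => h5 j

/-- Stationary families that satisfy the equation in `L²(ℝ; ℝᵈ)` give strong solutions. -/
lemma IsKernelVersion.isBoundedStrongSolution (hk : IsKernelVersion γ k) {σ κ : Fin d → L2Vec d}
    (hσκ : ∀ i t₁ t₂, shiftVec t₂ (σ i) - shiftVec t₁ (σ i) = ∫ t in t₁..t₂, shiftVec t (κ i))
    (hV : Measurable (Function.uncurry V))
    (hVσ : ∀ t j, (fun ω => V t ω j) =ᵐ[P] J (shiftVec t (σ j)))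
    (hF : Measurable (Function.uncurry F))
    (hFκ : ∀ t i, (fun ω => F t ω i) =ᵐ[P] J (shiftVec t (κ i + memoryVector k σ i))) :
    IsBoundedStrongSolution 0 γ F V P := by
  have hVn : ∀ t j, eLpNorm (fun ω => V t ω j) 2 P = ‖σ j‖ₑ := fun t j => by
    rw [eLpNorm_congr_ae (hVσ t j), ← Lp.enorm_def, LinearIsometry.enorm_map,
      LinearIsometry.enorm_map]
  have hVC : ∀ t j, eLpNorm (fun ω => V t ω j) 2 P ≤ (∑ j, ‖σ j‖₊ : ℝ≥0) := fun t j => by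
    rw [hVn, enorm_eq_nnnorm]
    exact_mod_cast Finset.single_le_sum (f := fun j => ‖σ j‖₊) (fun _ _ => zero_le)
      (Finset.mem_univ j)
  have hMm := hk.measurable_memoryTerm hV
  have hcomp : ∀ {X : ℝ → Ω → Fin d → ℝ}, Measurable (Function.uncurry X) → ∀ i,
      Measurable (Function.uncurry fun t ω => X t ω i) := fun hX i => (measurable_pi_apply i).comp hX
  have hMi := fun i => hk.memoryTerm_ae_eq hV hVσ (J := J) (i := i)
  have hint : ∀ t₁ t₂, t₁ ≤ t₂ → ∀ᵐ ω ∂P, IntervalIntegrable (fun t => V t ω) volume t₁ t₂ ∧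
      IntervalIntegrable (memoryTerm γ V ω) volume t₁ t₂ ∧
      IntervalIntegrable (fun t => F t ω) volume t₁ t₂ := by
    intro t₁ t₂ ht
    have h1 := ae_all_iff.2 fun i => (ae_intervalIntegral_eq (hcomp hV i) (fun t => hVσ t i) ht).1
    have h2 := ae_all_iff.2 fun i =>
      (ae_intervalIntegral_eq (hcomp hMm i) (fun t => hMi i t) ht).1
    have h3 := ae_all_iff.2 fun i => (ae_intervalIntegral_eq (hcomp hF i) (fun t => hFκ t i) ht).1
    have hpi : ∀ {f : ℝ → Fin d → ℝ}, (∀ i, IntervalIntegrable (fun t => f t i) volume t₁ t₂) →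
        IntervalIntegrable f volume t₁ t₂ := fun hf =>
      ⟨Integrable.of_eval fun i => (hf i).1, Integrable.of_eval fun i => (hf i).2⟩
    filter_upwards [h1, h2, h3] with ω h1 h2 h3
    exact ⟨hpi h1, hpi h2, hpi h3⟩
  refine ⟨⟨hV, hk.ae_memory_integrable hV hVC, hint, fun t₁ t₂ ht => ?_⟩, ∑ j, ‖σ j‖₊, fun t => ?_⟩
  · have h2 := ae_all_iff.2 fun i =>
      (ae_intervalIntegral_eq (hcomp hMm i) (fun t => hMi i t) ht).2
    have h3 := ae_all_iff.2 fun i => (ae_intervalIntegral_eq (hcomp hF i) (fun t => hFκ t i) ht).2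
    have h4 : ∀ᵐ ω ∂P, ∀ i, J (shiftVec t₂ (σ i)) ω - J (shiftVec t₁ (σ i)) ω =
        -(J (∫ t in t₁..t₂, shiftVec t (memoryVector k σ i)) ω) +
          J (∫ t in t₁..t₂, shiftVec t (κ i + memoryVector k σ i)) ω := by
      refine ae_all_iff.2 fun i => ?_
      -- The equation in `L²(P)`: adding the memory vector to `κ i` and subtracting it again leaves
      -- the increment of `σ i`.
      have h5 : J (shiftVec t₂ (σ i)) - J (shiftVec t₁ (σ i)) =
          -(J (∫ t in t₁..t₂, shiftVec t (memoryVector k σ i))) +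
            J (∫ t in t₁..t₂, shiftVec t (κ i + memoryVector k σ i)) := by
        simp only [map_add]
        rw [intervalIntegral.integral_add ((continuous_shiftVec _).intervalIntegrable _ _)
          ((continuous_shiftVec _).intervalIntegrable _ _), ← hσκ, map_add, map_sub]
        abel
      filter_upwards [Lp.coeFn_sub (J (shiftVec t₂ (σ i))) (J (shiftVec t₁ (σ i))),
        Lp.coeFn_add (-(J (∫ t in t₁..t₂, shiftVec t (memoryVector k σ i))))
          (J (∫ t in t₁..t₂, shiftVec t (κ i + memoryVector k σ i))),
        Lp.coeFn_neg (J (∫ t in t₁..t₂, shiftVec t (memoryVector k σ i)))] with ω h6 h7 h8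
      rw [← Pi.sub_apply, ← h6, h5, h7, Pi.add_apply, h8, Pi.neg_apply]
    filter_upwards [hint t₁ t₂ ht, h2, h3, h4, ae_all_iff.2 (hVσ t₁), ae_all_iff.2 (hVσ t₂)]
      with ω h1 h2 h3 h4 h5 h6
    funext i
    simp only [Pi.sub_apply, Pi.add_apply, Matrix.zero_mulVec, neg_zero, zero_sub, Pi.neg_apply,
      intervalIntegral_apply h1.2.1, intervalIntegral_apply h1.2.2, h5, h6, h4, h2, h3]
  · refine (eLpNorm_pi_le_sum fun i =>
      (hcomp hV i).of_uncurry_left.aestronglyMeasurable).trans_eq ?_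
    simp [hVn, enorm_eq_nnnorm]

end Existence

end

/-! ### Moving averages and the main theorem -/

noncomputable section

section MovingAverage

variable {d : ℕ}

/-- The matrix function whose convolution with white noise is the stationary family generated by
the vectors `Φ i`. -/
def reflectedKernel (Φ : Fin d → L2Vec d) (u : ℝ) : Matrix (Fin d) (Fin d) ℝ :=
  Matrix.of fun i j => Φ i j (-u)

lemma memL2_reflectedKernel (Φ : Fin d → L2Vec d) : MemL2 (reflectedKernel Φ) := fun i j =>
  (Lp.memLp (Φ i j)).comp_measurePreserving (Measure.measurePreserving_neg volume)

lemma memL2_reflectedKernel_sub (Φ : Fin d → L2Vec d) (t : ℝ) :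
    MemL2 fun s => reflectedKernel Φ (t - s) := fun i j =>
  (memL2_reflectedKernel Φ i j).comp_measurePreserving (Measure.measurePreserving_sub_left volume t)

/-- The reflection undoes the sign in `φ (t - s)`, leaving `Φ (s - t)`, a translate of `Φ`. -/
lemma row_reflectedKernel_sub (Φ : Fin d → L2Vec d) (t : ℝ) (i : Fin d) :
    (memL2_reflectedKernel_sub Φ t).row i = shiftVec t (Φ i) := by
  ext1 j
  refine Lp.ext ?_
  filter_upwards [(memL2_reflectedKernel_sub Φ t i j).coeFn_toLp, shiftL2_coeFn t (Φ i j)]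
    with s h1 h2
  rw [shiftVec_apply, h2]
  refine h1.trans ?_
  simp [reflectedKernel]

lemma exists_measurable_version_shiftVec {Ω : Type*} [MeasurableSpace Ω] {P : Measure Ω}
    [IsProbabilityMeasure P] (J : L2Vec d →ₗᵢ[ℝ] Lp ℝ 2 P) (Φ : Fin d → L2Vec d) :
    ∃ X : ℝ → Ω → Fin d → ℝ, Measurable (Function.uncurry X) ∧
      ∀ t i, (fun ω => X t ω i) =ᵐ[P] J (shiftVec t (Φ i)) := by
  choose X hX hXJ using fun i => exists_measurable_version
    (J.isometry.uniformContinuous.comp (uniformContinuous_shiftVec (Φ i)))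
  exact ⟨fun t ω i => X i t ω, measurable_pi_lambda _ fun i => hX i, fun t i => hXJ i t⟩

/-- This makes the argument independent of the version of the noise: only the classes in `L²(P)` at
each time matter. -/
lemma IsTwoSidedBrownianMotion.isMovingAverage_iff {Ω : Type*} [MeasurableSpace Ω] {P : Measure Ω}
    {W F : ℝ → Ω → Fin d → ℝ} (hW : IsTwoSidedBrownianMotion W P) (Φ : Fin d → L2Vec d) :
    IsMovingAverage (reflectedKernel Φ) W F P ↔ Measurable (Function.uncurry F) ∧
      ∀ t i, (fun ω => F t ω i) =ᵐ[P] hW.wiener (shiftVec t (Φ i)) := by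
  have h : ∀ (hF : Measurable (Function.uncurry F)) t,
      IsWienerIntegral (fun s => reflectedKernel Φ (t - s)) W (F t) P ↔
        ∀ i, (fun ω => F t ω i) =ᵐ[P] hW.wiener (shiftVec t (Φ i)) := fun hF t => by
    rw [hW.isWienerIntegral_iff (memL2_reflectedKernel_sub Φ t) hF.of_uncurry_left]
    simp only [row_reflectedKernel_sub]
  exact ⟨fun hF => ⟨hF.meas, fun t => (h hF.meas t).1 (hF.eq_integral t)⟩,
    fun hF => ⟨hF.1, fun t => (h hF.1 t).2 (hF.2 t)⟩⟩

end MovingAverage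

end

theorem corollary3 {d : ℕ} (γ r ψ : ℝ → Matrix (Fin d) (Fin d) ℝ)
    (hγ : MemL1Pos γ)
    (hr : IsDifferentialResolvent 0 γ r)
    (hr1 : MemL1Pos r)
    (hψ_cont : Continuous ψ)
    (hψ_sob : ∀ i j, MemSobolevH 3 (fun t => ψ t i j))
    (hψ_pos : IsPositiveType ψ) :
    ∃ φ : ℝ → Matrix (Fin d) (Fin d) ℝ, MemL2 φ ∧
      ∀ (Ω : Type*) [MeasurableSpace Ω] (P : Measure Ω) [IsProbabilityMeasure P]
        (W : ℝ → Ω → Fin d → ℝ), IsTwoSidedBrownianMotion W P →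
        (∃ F₀ : ℝ → Ω → Fin d → ℝ, IsMovingAverage φ W F₀ P) ∧
        ∀ F₀ : ℝ → Ω → Fin d → ℝ, IsMovingAverage φ W F₀ P →
          IsStationaryGaussian F₀ P ∧
          ∃ V : ℝ → Ω → Fin d → ℝ,
            IsBoundedStrongSolution 0 γ F₀ V P ∧
            IsStationaryGaussian V P ∧
            HasAutocorrelation V ψ P ∧
            ∀ V' : ℝ → Ω → Fin d → ℝ, IsBoundedStrongSolution 0 γ F₀ V' P →
              ∀ t, V' t =ᵐ[P] V t := by
  obtain ⟨σ, κ, hσψ, hσκ⟩ := hψ_pos.exists_stationary_family hψ_cont hψ_sob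
  obtain ⟨k, hk⟩ := hγ.exists_isKernelVersion
  -- The kernel is the reflected sum of derivative and memory vector. It is built from `γ` and `ψ`
  -- alone, before any probability space is introduced.
  refine ⟨_, memL2_reflectedKernel fun i => κ i + memoryVector k σ i,
    fun Ω _ P _ W hW => ⟨?_, fun F₀ hF₀ => ?_⟩⟩
  · obtain ⟨F, hF, hFκ⟩ := exists_measurable_version_shiftVec hW.wiener
      fun i => κ i + memoryVector k σ i
    exact ⟨F, (hW.isMovingAverage_iff _).2 ⟨hF, hFκ⟩⟩
  · obtain ⟨hF, hFκ⟩ := (hW.isMovingAverage_iff _).1 hF₀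
    obtain ⟨V, hV, hVσ⟩ := exists_measurable_version_shiftVec hW.wiener σ
    have hsol := hk.isBoundedStrongSolution hσκ hV hVσ hF hFκ
    refine ⟨hW.isStationaryGaussian (fun t => hF.of_uncurry_left) shiftVec_add hFκ, V, hsol,
      hW.isStationaryGaussian (fun t => hV.of_uncurry_left) shiftVec_add hVσ, ⟨fun t => ?_, ?_⟩,
      fun V' hV' => hV'.ae_eq hr hγ hr1 hsol⟩
    · obtain ⟨C, hC⟩ := hsol.bounded
      exact ⟨hV.of_uncurry_left.aestronglyMeasurable, (hC t).trans_lt ENNReal.coe_lt_top⟩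
    · intro s t i j
      rw [← hσψ, ← inner_shiftVec_shiftVec s, ← hW.integral_wiener_mul]
      refine integral_congr_ae ?_
      filter_upwards [hVσ (s + t) i, hVσ s j] with ω h1 h2
      rw [h1, h2]
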